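/- **Wise's event domain.** Let $\mathbf X$ be the directed square complex with one vertex, three vertical edges $a,b,c$, two horizontal edges $x,y$, and six squares; the squares are listed as (left, bottom, top, right), with vertical edges directed upwards and horizontal edges directed to the right: $$(a,x,x,b),\ (a,y,y,b),\ (b,x,y,a),\ (b,y,x,c),\ (c,x,y,c),\ (c,y,x,a).$$ Let $r$ be any bijection from $\{a,b,c,x,y\}$ to $\{1,2,3,4,5\}$. Let $W$ be obtained from the first barycentric subdivision of $\mathbf X$ (each square is cut into four; half-edges inherit their direction, and the edges joining the center of a square to the midpoints of its sides are directed from left to right and from bottom to top) by attaching, at the midpoint of each edge $\alpha$ of $\mathbf X$, a path with $r(\alpha)$ edges directed away from that midpoint. Let $\widetilde W$ be the universal cover of $W$ with the lifted directions $\tilde o^*$, let $\tilde v$ be any vertex of $\widetilde W$ lying over the vertex of $\mathbf X$, write $p\prec_{\tilde o^*} q$ if there is a directed path (possibly of length $0$) from $p$ to $q$, and let $\widetilde W_{\tilde v}=\{q:\tilde v\prec_{\tilde o^*} q\}$. **Event structures.** An event structure $\mathcal E=(E,\le,\#)$ is a partial order $\le$ with finite principal ideals and a symmetric irreflexive relation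 $\#$ (conflict) such that $e\# e'\le e''$ implies $e\# e''$. Its domain is the set of finite, downward-closed, conflict-free subsets of $E$ (configurations), ordered by inclusion. An event $e$ is enabled at $C$ if $e\notin C$ and $C\cup\{e\}$ is a configuration; events are co-initial at $C$ if both are enabled at $C$. Write $e\|e'$ if $e,e'$ are incomparable and not in conflict; $e\lessdot e'$ if $e$ is an immediate predecessor of $e'$; and $e\#_\mu e'$ if $e\# e'$ and there is no $e''\ne e,e'$ with ($e''\le e$ and $e''\# e'$) or ($e''\le e'$ and $e''\# e$). The relation $\natural$ is the least irreflexive symmetric relation on $E$ such that $e_1\natural e_2$ whenever $e_1\|e_2$, or $e_1\#_\mu e_2$, or there is an event $e_3$, co-initial with $e_1$ and with $e_2$ at two different configurations, with $e_1\|e_3$ and $e_2\#_\mu e_3$. A $\natural$-clique is a set of events that are pairwise related by $\natural$; $\mathcal E$ has bounded $\natural$-cliques if the sizes of its $\natural$-cliques are bounded by a constant. For a configuration $C$, let $\mathcal E\setminus C$ be the restriction of $\mathcal E$ to the events that are neither in $C$ nor in conflict with an element of $C$. $\mathcal E$ is regular if the structures $\mathcal E\setminus C$ fall into finitely many isomorphism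 types and the number of events enabled at a configuration is bounded. $\mathcal E$ is a regular trace event structure if there are a finite non-empty alphabet $\Sigma$, an irreflexive symmetric relation $I$ on $\Sigma$, and a labeling $\lambda:E\to\Sigma$ such that: $e\#_\mu e'$ implies $\lambda(e)\neq\lambda(e')$; $e\lessdot e'$ or $e\#_\mu e'$ implies $(\lambda(e),\lambda(e'))\notin I$; $(\lambda(e),\lambda(e'))\notin I$ implies $e\le e'$, $e'\le e$ or $e\# e'$; and the labeled structures $\mathcal E\setminus C$ fall into finitely many label-preserving isomorphism types. A finite trace automaton is a deterministic partial automaton with an initial state, finitely many states and a finite alphabet carrying an irreflexive symmetric independence relation, such that whenever $p$ and $q$ are independent letters with transitions $s\xrightarrow{p}s'$ and $s\xrightarrow{q}s''$, there is a state $t$ with $s'\xrightarrow{q}t$ and $s''\xrightarrow{p}t$. Its domain is the set of its finite computations from the initial state, modulo the equivalence generated by exchanging two consecutive independent letters (both words being computations), ordered by extension. The domain of $\mathcal E$ is recognizable if it is isomorphic, as an ordered set, to the domain of a finite trace automaton. **Proposition 5.6.** $(\widetilde W_{\tilde v},\prec_{\tilde o^*})$ is isomorphic to the domain of an event structure. Every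 event structure $\mathcal E$ whose domain is isomorphic to $(\widetilde W_{\tilde v},\prec_{\tilde o^*})$ has only $\natural$-cliques of size at most $11$ (so $\mathcal E$ has bounded $\natural$-cliques), is regular, is not a regular trace event structure, and has a domain that is not recognizable. Consequently it is a counterexample to both forms of the Badouel–Darondeau–Raoult conjecture: "the domain of $\mathcal E$ is recognizable if and only if $\mathcal E$ is regular and has bounded $\natural$-cliques" and "$\mathcal E$ is regular if and only if $\mathcal E$ is a regular trace event structure and has bounded $\natural$-cliques" are both false for it. -/

import Mathlib

universe u v

/-! ## Event structures -/

/-- A (prime) event structure on the set of events `E`: causal dependency `le`, conflict `conf`. -/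
structure EventStructure (E : Type u) where
  le : E → E → Prop
  le_refl : ∀ e, le e e
  le_trans : ∀ e₁ e₂ e₃, le e₁ e₂ → le e₂ e₃ → le e₁ e₃
  le_antisymm : ∀ e₁ e₂, le e₁ e₂ → le e₂ e₁ → e₁ = e₂
  conf : E → E → Prop
  conf_irrefl : ∀ e, ¬ conf e e
  conf_symm : ∀ e₁ e₂, conf e₁ e₂ → conf e₂ e₁
  finite_down : ∀ e, {e' | le e' e}.Finite
  conf_inherit : ∀ e e' e'', conf e e' → le e' e'' → conf e e''

namespace EventStructure

variable {E : Type u} (S : EventStructure E)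

/-- Concurrency: order-incomparable and not in conflict. -/
def Concurrent (e e' : E) : Prop := ¬ S.le e e' ∧ ¬ S.le e' e ∧ ¬ S.conf e e'

/-- Minimal conflict. -/
def MinConf (e' e'' : E) : Prop :=
  S.conf e' e'' ∧
    ¬ ∃ e, e ≠ e' ∧ e ≠ e'' ∧ ((S.le e e' ∧ S.conf e e'') ∨ (S.le e e'' ∧ S.conf e e'))

/-- `e` is an immediate predecessor of `e'`. -/
def ImmPred (e e' : E) : Prop :=
  S.le e e' ∧ e ≠ e' ∧ ∀ e'', S.le e e'' → S.le e'' e' → e'' = e ∨ e'' = e'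

/-- Configurations: finite, conflict-free, downward-closed sets of events. -/
structure IsConfig (c : Set E) : Prop where
  finite : c.Finite
  conflict_free : ∀ e ∈ c, ∀ e' ∈ c, ¬ S.conf e e'
  down_closed : ∀ e ∈ c, ∀ e', S.le e' e → e' ∈ c

/-- The domain of an event structure: all configurations, to be ordered by inclusion. -/
def Domain : Type u := {c : Set E // S.IsConfig c}

/-- The order of the domain: inclusion of configurations. -/
def DomainLE (c c' : S.Domain) : Prop := c.1 ⊆ c'.1

/-- The set of events enabled at a configuration. -/
def enabled (c : S.Domain) : Set E := {e | e ∉ c.1 ∧ S.IsConfig (insert e c.1)}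

/-- `e` and `e'` are both enabled at `c`. -/
def CoInitialAt (c : S.Domain) (e e' : E) : Prop := e ∈ S.enabled c ∧ e' ∈ S.enabled c

/-- There is a bound on the number of events enabled at a configuration. -/
def FiniteDegree : Prop := ∃ d : ℕ, ∀ c : S.Domain, (S.enabled c).encard ≤ d

/-- The events of the event structure rooted at `c`: neither in `c` nor in conflict with `c`. -/
def residualEvents (c : S.Domain) : Set E := {e | e ∉ c.1 ∧ ¬ ∃ e' ∈ c.1, S.conf e' e}

/-- The event structure rooted at the configuration `c`. -/
def residual (c : S.Domain) : EventStructure (S.residualEvents c) where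
  le e e' := S.le e.1 e'.1
  le_refl e := S.le_refl e.1
  le_trans e₁ e₂ e₃ := S.le_trans e₁.1 e₂.1 e₃.1
  le_antisymm e₁ e₂ h h' := Subtype.ext (S.le_antisymm e₁.1 e₂.1 h h')
  conf e e' := S.conf e.1 e'.1
  conf_irrefl e := S.conf_irrefl e.1
  conf_symm e₁ e₂ := S.conf_symm e₁.1 e₂.1
  finite_down e := (S.finite_down e.1).preimage Subtype.val_injective.injOn
  conf_inherit e e' e'' := S.conf_inherit e.1 e'.1 e''.1

/-- A bijection is an isomorphism of event structures. -/
def IsIso {F : Type v} (S : EventStructure E) (T : EventStructure F) (f : E ≃ F) : Prop :=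
  ∀ e e', (S.le e e' ↔ T.le (f e) (f e')) ∧ (S.conf e e' ↔ T.conf (f e) (f e'))

/-- Finite index: the futures of configurations fall into finitely many isomorphism types, i.e.
finitely many configurations represent all the types. -/
def FiniteIndex : Prop :=
  ∃ R : Set S.Domain, R.Finite ∧ ∀ c : S.Domain, ∃ c' ∈ R,
    ∃ f : S.residualEvents c ≃ S.residualEvents c', IsIso (S.residual c) (S.residual c') f

/-- Regular event structures. -/
def IsRegular : Prop := S.FiniteIndex ∧ S.FiniteDegree

/-- Finite index of the labeled event structure `(S, lab)`: isomorphisms have to preserve labels. -/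
def LabeledFiniteIndex {A : Type v} (lab : E → A) : Prop :=
  ∃ R : Set S.Domain, R.Finite ∧ ∀ c : S.Domain, ∃ c' ∈ R,
    ∃ f : S.residualEvents c ≃ S.residualEvents c',
      IsIso (S.residual c) (S.residual c') f ∧ ∀ e, lab (f e).1 = lab e.1

end EventStructure

/-- A Mazurkiewicz trace alphabet on the set of letters `A`, given by its independence relation. -/
structure TraceAlphabet (A : Type v) where
  indep : A → A → Prop
  irrefl : ∀ a, ¬ indep a a
  symm : ∀ a b, indep a b → indep b a

namespace EventStructure

variable {E : Type u} (S : EventStructure E)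

/-- Trace labelings: dependence of letters is the negation of independence. -/
structure IsTraceLabeling {A : Type v} (M : TraceAlphabet A) (lab : E → A) : Prop where
  les1 : ∀ e e', S.MinConf e e' → lab e ≠ lab e'
  les2 : ∀ e e', S.ImmPred e e' ∨ S.MinConf e e' → ¬ M.indep (lab e) (lab e')
  les3 : ∀ e e', ¬ M.indep (lab e) (lab e') → S.le e e' ∨ S.le e' e ∨ S.conf e e'

/-- Regular trace event structures: there is a trace labeling of finite index over some finite
non-empty trace alphabet. -/
def IsRegularTrace : Prop :=
  ∃ (A : Type) (_ : Finite A) (_ : Nonempty A) (M : TraceAlphabet A) (lab : E → A),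
    S.IsTraceLabeling M lab ∧ S.LabeledFiniteIndex lab

/-- The third clause in the definition of the relation `♮` (not yet symmetrized). -/
def Natural3 (e₁ e₂ : E) : Prop :=
  ∃ (e₃ : E) (c₁ c₂ : S.Domain), c₁ ≠ c₂ ∧ S.CoInitialAt c₁ e₁ e₃ ∧ S.CoInitialAt c₂ e₂ e₃ ∧
    S.Concurrent e₁ e₃ ∧ S.MinConf e₂ e₃

/-- The relation `♮` on events. -/
def Natural (e₁ e₂ : E) : Prop :=
  e₁ ≠ e₂ ∧ (S.Concurrent e₁ e₂ ∨ S.MinConf e₁ e₂ ∨ S.Natural3 e₁ e₂ ∨ S.Natural3 e₂ e₁)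

/-- `♮`-cliques: sets of events that are pairwise in relation `♮`. -/
def IsNaturalClique (Q : Set E) : Prop := ∀ e ∈ Q, ∀ e' ∈ Q, e ≠ e' → S.Natural e e'

/-- Every `♮`-clique has at most `n` elements. -/
def NaturalCliquesLE (n : ℕ) : Prop := ∀ Q : Set E, S.IsNaturalClique Q → Q.encard ≤ n

/-- The `♮`-cliques are bounded. -/
def BoundedNaturalCliques : Prop := ∃ n : ℕ, S.NaturalCliquesLE n

end EventStructure

/-! ## Trace automata and recognizability -/

/-- A trace automaton with states `Q` over the concurrent alphabet `alphabet`: a deterministic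
(partial) automaton with an initial state, in which independent actions enabled at the same
state commute. -/
structure TraceAutomaton (Q A : Type) where
  alphabet : TraceAlphabet A
  init : Q
  step : Q → A → Option Q
  commute : ∀ a b q r s, alphabet.indep a b → step q a = some r → step q b = some s →
    ∃ p, step r b = some p ∧ step s a = some p

namespace TraceAutomaton

variable {Q A : Type} (M : TraceAutomaton Q A)

/-- The state reached from `q` by reading a word, if every step is defined. -/
def run : Q → List A → Option Q
  | q, [] => some q
  | q, a :: w => (M.step q a).bind fun r => run r w

/-- Computations from the initial state (determined by their words of actions). -/
def Computation : Type := {w : List A // (M.run M.init w).isSome}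

/-- Two computations differ by one commutation of consecutive independent actions. -/
def Swap (w w' : M.Computation) : Prop :=
  ∃ (x y : List A) (a b : A), M.alphabet.indep a b ∧
    w.1 = x ++ a :: b :: y ∧ w'.1 = x ++ b :: a :: y

/-- Traces: computations up to commutation of independent actions. -/
def Trace : Type := Quot M.Swap

/-- The order of the domain of the automaton: `t ≤ t'` if `t'` extends `t`. -/
def TraceLE (t t' : M.Trace) : Prop :=
  ∃ w w' : M.Computation, Quot.mk _ w = t ∧ Quot.mk _ w' = t' ∧ w.1 <+: w'.1

end TraceAutomaton

namespace EventStructure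

variable {E : Type u} (S : EventStructure E)

/-- The domain of `S` is recognizable: it is isomorphic to the domain of a trace automaton with
finitely many states and a finite alphabet. -/
def IsRecognizable : Prop :=
  ∃ (Q A : Type) (_ : Finite Q) (_ : Finite A) (M : TraceAutomaton Q A),
    Nonempty (M.TraceLE ≃r S.DomainLE)

/-- The equivalence conjectured by Badouel, Darondeau and Raoult, for the event structure `S`. -/
def BDREquivalence : Prop := S.IsRecognizable ↔ S.IsRegular ∧ S.BoundedNaturalCliques

/-- The reformulation of the conjectured equivalence through regular trace event structures. -/
def BDRTraceEquivalence : Prop := S.IsRegular ↔ S.IsRegularTrace ∧ S.BoundedNaturalCliques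

end EventStructure

/-! ## Directed square complexes -/

/-- A directed square complex. Every square has its four sides `bot, right, left, top`, with
opposite sides directed in the same way: `bot` and `top` from left to right, `left` and `right` from
bottom to top. -/
structure DirectedSquareComplex where
  V : Type
  E : Type
  S : Type
  src : E → V
  tgt : E → V
  bot : S → E
  right : S → E
  left : S → E
  top : S → E
  src_bot : ∀ s, src (bot s) = src (left s)
  tgt_bot : ∀ s, tgt (bot s) = src (right s)
  tgt_left : ∀ s, tgt (left s) = src (top s)
  tgt_top : ∀ s, tgt (top s) = tgt (right s)

namespace DirectedSquareComplex

/-- There is an edge directed from `a` to `b`. -/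
def Arc (Y : DirectedSquareComplex) (a b : Y.V) : Prop := ∃ e, Y.src e = a ∧ Y.tgt e = b

/-- The relation `≺` on vertices: there is a directed path from `a` to `b`. -/
def Prec (Y : DirectedSquareComplex) : Y.V → Y.V → Prop := Relation.ReflTransGen Y.Arc

/-- The principal filter of a vertex with respect to `≺`. -/
def Filter (Y : DirectedSquareComplex) (a : Y.V) : Type := {b : Y.V // Y.Prec a b}

/-- The order of the principal filter: the restriction of `≺`. -/
def FilterLE (Y : DirectedSquareComplex) (a : Y.V) (b b' : Y.Filter a) : Prop := Y.Prec b.1 b'.1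

/-! ### The universal cover -/

/-- Edge paths starting at `a`, traversing edges forwards or backwards. -/
inductive EdgePath (Y : DirectedSquareComplex) (a : Y.V) : Y.V → Type
  | nil : EdgePath Y a a
  | fwd {b c : Y.V} (p : EdgePath Y a b) (e : Y.E) (hs : Y.src e = b) (ht : Y.tgt e = c) :
      EdgePath Y a c
  | bwd {b c : Y.V} (p : EdgePath Y a b) (e : Y.E) (ht : Y.tgt e = b) (hs : Y.src e = c) :
      EdgePath Y a c

/-- Homotopy of edge paths relative to their end-points: the congruence generated by the removal
of backtracks and by replacing two consecutive sides of a square by the other two sides. (The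
replacements that start at another corner of the square follow by inserting backtracks.) -/
inductive Homotopic (Y : DirectedSquareComplex) (a : Y.V) :
    ∀ {b : Y.V}, Y.EdgePath a b → Y.EdgePath a b → Prop
  | refl {b : Y.V} (p : Y.EdgePath a b) : Homotopic Y a p p
  | symm {b : Y.V} {p q : Y.EdgePath a b} : Homotopic Y a p q → Homotopic Y a q p
  | trans {b : Y.V} {p q r : Y.EdgePath a b} :
      Homotopic Y a p q → Homotopic Y a q r → Homotopic Y a p r
  | fwd {b c : Y.V} {p q : Y.EdgePath a b} (e : Y.E) (hs : Y.src e = b) (ht : Y.tgt e = c) :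
      Homotopic Y a p q → Homotopic Y a (p.fwd e hs ht) (q.fwd e hs ht)
  | bwd {b c : Y.V} {p q : Y.EdgePath a b} (e : Y.E) (ht : Y.tgt e = b) (hs : Y.src e = c) :
      Homotopic Y a p q → Homotopic Y a (p.bwd e ht hs) (q.bwd e ht hs)
  | fwd_bwd {b c : Y.V} (p : Y.EdgePath a b) (e : Y.E) (hs : Y.src e = b) (ht : Y.tgt e = c) :
      Homotopic Y a ((p.fwd e hs ht).bwd e ht hs) p
  | bwd_fwd {b c : Y.V} (p : Y.EdgePath a b) (e : Y.E) (ht : Y.tgt e = b) (hs : Y.src e = c) :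
      Homotopic Y a ((p.bwd e ht hs).fwd e hs ht) p
  | square {b : Y.V} (p : Y.EdgePath a b) (s : Y.S) (h : Y.src (Y.bot s) = b) :
      Homotopic Y a
        ((p.fwd (Y.bot s) h (Y.tgt_bot s)).fwd (Y.right s) rfl rfl)
        ((p.fwd (Y.left s) ((Y.src_bot s).symm.trans h) (Y.tgt_left s)).fwd (Y.top s) rfl
          (Y.tgt_top s))

/-- Vertices of the universal cover with base vertex `a`: homotopy classes of edge paths starting
at `a`. The first component, the end-point of the path, is the image under the covering map. -/
def CoverVertex (Y : DirectedSquareComplex) (a : Y.V) : Type :=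
  Σ b : Y.V, Quot (Homotopic Y a (b := b))

/-- The end-point of the lift of the edge `e` that starts at `x`. -/
def coverStep (Y : DirectedSquareComplex) (a : Y.V) (x : Y.CoverVertex a) (e : Y.E)
    (h : Y.src e = x.1) : Y.CoverVertex a :=
  ⟨Y.tgt e, Quot.map (fun p => p.fwd e h rfl) (fun _ _ hpq => hpq.fwd e h rfl) x.2⟩

theorem coverStep_square (Y : DirectedSquareComplex) (a : Y.V) (x : Y.CoverVertex a) (s : Y.S)
    (h : Y.src (Y.bot s) = x.1) (h₁ h₂ h₃) :
    Y.coverStep a (Y.coverStep a x (Y.left s) h₁) (Y.top s) h₂ =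
      Y.coverStep a (Y.coverStep a x (Y.bot s) h) (Y.right s) h₃ := by
  obtain ⟨b, x⟩ := x
  induction x using Quot.ind with
  | mk p =>
    have key := Quot.sound (Homotopic.square p s h)
    have aux : ∀ (c d f : Y.V) (e e' : Y.E) (hs : Y.src e = b) (ht : Y.tgt e = c)
        (hs' : Y.src e' = c) (ht' : Y.tgt e' = d) (h0 : Y.src e' = Y.tgt e) (hf : Y.tgt e' = f),
        (⟨d, Quot.mk _ ((p.fwd e hs ht).fwd e' hs' ht')⟩ : Y.CoverVertex a) =
          ⟨f, Quot.mk _ ((p.fwd e hs rfl).fwd e' h0 hf)⟩ := by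
      intro c d f e e' hs ht hs' ht' h0 hf
      subst ht; subst ht'; subst hf; rfl
    have e1 := aux _ _ _ _ _ ((Y.src_bot s).symm.trans h) (Y.tgt_left s) rfl (Y.tgt_top s)
      h₂ rfl
    have e2 := aux _ _ _ _ _ h (Y.tgt_bot s) rfl rfl h₃ rfl
    exact e1.symm.trans ((congrArg (Sigma.mk (β := fun b => Quot (Homotopic Y a (b := b))) _) key.symm).trans e2)

/-- The universal cover of the connected component of the vertex `a`: an edge (a square) of the
cover is an edge (a square) of `Y` together with a lift of its first vertex; it lifts the
incidences and the directions of `Y`. -/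
def universalCover (Y : DirectedSquareComplex) (a : Y.V) : DirectedSquareComplex where
  V := Y.CoverVertex a
  E := {xe : Y.CoverVertex a × Y.E // Y.src xe.2 = xe.1.1}
  S := {xs : Y.CoverVertex a × Y.S // Y.src (Y.bot xs.2) = xs.1.1}
  src xe := xe.1.1
  tgt xe := Y.coverStep a xe.1.1 xe.1.2 xe.2
  bot xs := ⟨(xs.1.1, Y.bot xs.1.2), xs.2⟩
  left xs := ⟨(xs.1.1, Y.left xs.1.2), (Y.src_bot _).symm.trans xs.2⟩
  right xs := ⟨(Y.coverStep a xs.1.1 (Y.bot xs.1.2) xs.2, Y.right xs.1.2), (Y.tgt_bot _).symm⟩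
  top xs := ⟨(Y.coverStep a xs.1.1 (Y.left xs.1.2) ((Y.src_bot _).symm.trans xs.2),
    Y.top xs.1.2), (Y.tgt_left _).symm⟩
  src_bot _ := rfl
  tgt_bot _ := rfl
  tgt_left _ := rfl
  tgt_top xs := Y.coverStep_square a xs.1.1 xs.1.2 xs.2 _ _ _

/-! ### Barycentric subdivision -/

/-- Vertices of the subdivision: old vertices, midpoints of edges, centers of squares. -/
inductive BaryVertex (Y : DirectedSquareComplex)
  | old (x : Y.V)
  | mid (e : Y.E)
  | center (s : Y.S)

/-- Edges of the subdivision: the two halves of each edge, and for each square the four edges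
between its center and the midpoints of its sides. -/
inductive BaryEdge (Y : DirectedSquareComplex)
  | fst (e : Y.E)
  | snd (e : Y.E)
  | botToCenter (s : Y.S)
  | leftToCenter (s : Y.S)
  | centerToRight (s : Y.S)
  | centerToTop (s : Y.S)

/-- Squares of the subdivision: each square is cut into four. -/
inductive BarySquare (Y : DirectedSquareComplex)
  | sw (s : Y.S)
  | se (s : Y.S)
  | nw (s : Y.S)
  | ne (s : Y.S)

/-- The first barycentric subdivision; the halves of an edge inherit its direction, and the
edges at a center are directed from left to right and from bottom to top. -/
def barySubdivision (Y : DirectedSquareComplex) : DirectedSquareComplex where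
  V := Y.BaryVertex
  E := Y.BaryEdge
  S := Y.BarySquare
  src
    | .fst e => .old (Y.src e)
    | .snd e => .mid e
    | .botToCenter s => .mid (Y.bot s)
    | .leftToCenter s => .mid (Y.left s)
    | .centerToRight s => .center s
    | .centerToTop s => .center s
  tgt
    | .fst e => .mid e
    | .snd e => .old (Y.tgt e)
    | .botToCenter s => .center s
    | .leftToCenter s => .center s
    | .centerToRight s => .mid (Y.right s)
    | .centerToTop s => .mid (Y.top s)
  bot
    | .sw s => .fst (Y.bot s)
    | .se s => .snd (Y.bot s)
    | .nw s => .leftToCenter s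
    | .ne s => .centerToRight s
  right
    | .sw s => .botToCenter s
    | .se s => .fst (Y.right s)
    | .nw s => .centerToTop s
    | .ne s => .snd (Y.right s)
  left
    | .sw s => .fst (Y.left s)
    | .se s => .botToCenter s
    | .nw s => .snd (Y.left s)
    | .ne s => .centerToTop s
  top
    | .sw s => .leftToCenter s
    | .se s => .centerToRight s
    | .nw s => .fst (Y.top s)
    | .ne s => .snd (Y.top s)
  src_bot s := by cases s <;> simp [Y.src_bot]
  tgt_bot s := by cases s <;> simp [Y.tgt_bot]
  tgt_left s := by cases s <;> simp [Y.tgt_left]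
  tgt_top s := by cases s <;> simp [Y.tgt_top]

/-! ### Attaching tips -/

/-- Attach to each vertex `x` of `Y` a path with `len x` edges, directed away from `x` (nothing is
attached if `len x = 0`). The new vertices on the path are `⟨x, 0⟩, ⟨x, 1⟩, …`, and the new edge
`⟨x, i⟩` is the one that ends at the new vertex `⟨x, i⟩`. -/
def attachTips (Y : DirectedSquareComplex) (len : Y.V → ℕ) : DirectedSquareComplex where
  V := Y.V ⊕ (Σ x : Y.V, Fin (len x))
  E := Y.E ⊕ (Σ x : Y.V, Fin (len x))
  S := Y.S
  src
    | .inl e => .inl (Y.src e)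
    | .inr ⟨x, ⟨0, _⟩⟩ => .inl x
    | .inr ⟨x, ⟨i + 1, h⟩⟩ => .inr ⟨x, ⟨i, (Nat.lt_succ_self i).trans h⟩⟩
  tgt
    | .inl e => .inl (Y.tgt e)
    | .inr t => .inr t
  bot s := .inl (Y.bot s)
  right s := .inl (Y.right s)
  left s := .inl (Y.left s)
  top s := .inl (Y.top s)
  src_bot s := congrArg Sum.inl (Y.src_bot s)
  tgt_bot s := congrArg Sum.inl (Y.tgt_bot s)
  tgt_left s := congrArg Sum.inl (Y.tgt_left s)
  tgt_top s := congrArg Sum.inl (Y.tgt_top s)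

end DirectedSquareComplex

/-! ## Wise's complexes -/

/-- The five edges of Wise's complex, which are also its colors: `a, b, c` are vertical and
`x, y` are horizontal. -/
inductive WiseColor
  | a | b | c | x | y

open WiseColor in
/-- Wise's complete square complex, with one vertex, five edges and six squares. -/
def wiseX : DirectedSquareComplex where
  V := Unit
  E := WiseColor
  S := Fin 6
  src _ := ()
  tgt _ := ()
  left := ![a, a, b, b, c, c]
  bot := ![x, y, x, y, x, y]
  top := ![x, y, y, x, y, x]
  right := ![b, b, a, c, c, a]
  src_bot _ := rfl
  tgt_bot _ := rfl
  tgt_left _ := rfl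
  tgt_top _ := rfl

/-- The lengths of the tips: `r α` at the middle of the edge with color `α`, no tip elsewhere. -/
def wiseTipLength (r : WiseColor → ℕ) : wiseX.barySubdivision.V → ℕ
  | .old _ => 0
  | .mid e => r e
  | .center _ => 0

/-- The complex `W`: the barycentric subdivision of `wiseX` with tips encoding the colors. -/
def wiseW (r : WiseColor → ℕ) : DirectedSquareComplex :=
  wiseX.barySubdivision.attachTips (wiseTipLength r)

/-- The vertex of `W` that comes from the unique vertex of `wiseX`. -/
def wiseBase (r : WiseColor → ℕ) : (wiseW r).V := Sum.inl (.old ())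

/-- The universal cover of `W`. -/
def wiseCover (r : WiseColor → ℕ) : DirectedSquareComplex :=
  (wiseW r).universalCover (wiseBase r)

/-- The `0`-vertices of the universal cover of `W`: the lifts of the vertex of `wiseX`. -/
def IsZeroVertex (r : WiseColor → ℕ) (w : (wiseCover r).V) : Prop :=
  Sigma.fst (show (wiseW r).CoverVertex (wiseBase r) from w) = wiseBase r

-- The proof replaces the universal cover by a combinatorial model. Each pair (left side, bottom)
-- determines exactly one square of $\mathbf X$. So a horizontal word $u$ in $x,y$ and a vertical
-- word $v$ in $a,b,c$ span a unique rectangle, and the directed part of the cover above a lift of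
-- the vertex is the product of two subdivided trees of words, with a tip at each point above the
-- middle of an edge. The model maps to the cover and lifts arcs. The map is injective because there
-- is a representation that separates its points. The squares act as a bireversible automaton, which
-- gives permutations of the free groups on the two alphabets. Horizontal letters act by left
-- multiplication on the first group and vertical letters on the second, while letters of the other
-- kind fix the neutral element. Evaluating a path therefore recovers both words (`exists_values`,
-- `modelPos_injective`, `nonempty_filter_of_lift`).
--
-- A product of trees with chains attached is visibly the domain of an event structure, `modelES`. A
-- domain determines its event structure, the events being the elements with a greatest element
-- strictly below them (`exists_isIso_of_domain`), so the clique bound need only be checked on the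
-- model. There, events of one tree related by ♮ are siblings and no two tip events are related.
-- Regularity follows from the cover: the future of a configuration is the filter of a vertex, which
-- depends only on the image of that vertex in the finite complex $W$.
--
-- For the negative results, a regular trace labeling and a recognizing automaton both yield a
-- `FiniteLabelling` of the order: finitely many states, deterministic labels on covering pairs,
-- equal labels on opposite sides of a square. In the quadrant spanned by $x^\infty$ and $c^\infty$,
-- the labels of horizontal edges are constant along columns. The states on the bottom row repeat,
-- and the tips let a state recognize which continuation is $x$, so the bottom labels are eventually
-- periodic. Determinism and the pigeonhole principle then make the states of every row periodic,
-- with one period and one starting point valid for all rows. Tips reveal colors, so the color words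
-- of all rows share that period. But $c$ acts transitively on words of each length
-- (`turn_transitive`), so some row has $x$ at a given position and $y$ one period later
-- (`exists_row_not_periodic`). This contradiction is `false_of_finiteLabelling`.

universe w

open Relation DirectedSquareComplex

/-! ### Relations above a point, and prime elements -/

/-- The restriction of a relation to the elements above `c`. -/
def upRel {α : Type u} (r : α → α → Prop) (c : α) : {d // r c d} → {d // r c d} → Prop :=
  fun a b => r a.1 b.1

/-- A relation isomorphism restricts to the elements above corresponding points. -/
def upRelCongr {α : Type u} {β : Type v} {r : α → α → Prop} {s : β → β → Prop} (f : r ≃r s)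
    (c : α) : upRel r c ≃r upRel s (f c) where
  toFun d := ⟨f d.1, f.map_rel_iff.2 d.2⟩
  invFun d := ⟨f.symm d.1, by
    have := d.2
    rw [← f.apply_symm_apply d.1] at this
    exact f.map_rel_iff.1 this⟩
  left_inv d := Subtype.ext (f.symm_apply_apply d.1)
  right_inv d := Subtype.ext (f.apply_symm_apply d.1)
  map_rel_iff' := f.map_rel_iff

/-- Restricting twice amounts to restricting once. -/
def upRelUpRel {α : Type u} {r : α → α → Prop} (hr : ∀ a b c, r a b → r b c → r a c) (c : α)
    (d : {d // r c d}) : upRel (upRel r c) d ≃r upRel r d.1 where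
  toFun e := ⟨e.1.1, e.2⟩
  invFun e := ⟨⟨e.1, hr _ _ _ d.2 e.2⟩, e.2⟩
  left_inv _ := rfl
  right_inv _ := rfl
  map_rel_iff' := Iff.rfl

/-- `c` has a greatest element strictly below it. -/
def IsCompletePrime {α : Type u} (r : α → α → Prop) (c : α) : Prop :=
  ∃ c', r c' c ∧ c' ≠ c ∧ ∀ d, r d c → d ≠ c → r d c'

theorem IsCompletePrime.map {α : Type u} {β : Type v} {r : α → α → Prop} {s : β → β → Prop}
    (f : r ≃r s) {c : α} (h : IsCompletePrime r c) : IsCompletePrime s (f c) := by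
  obtain ⟨c', h1, h2, h3⟩ := h
  refine ⟨f c', f.map_rel_iff.2 h1, fun h => h2 (f.injective h), fun d hd hne => ?_⟩
  obtain ⟨d, rfl⟩ := f.surjective d
  exact f.map_rel_iff.2 (h3 d (f.map_rel_iff.1 hd) fun h => hne (congrArg f h))

/-! ### Recovering an event structure from its domain -/

namespace EventStructure

section

variable {E : Type u} (S : EventStructure E)

theorem conf_mono {a b c d : E} (h : S.conf a b) (hac : S.le a c) (hbd : S.le b d) :
    S.conf c d :=
  S.conf_inherit _ _ _ (S.conf_symm _ _ (S.conf_inherit _ _ _ (S.conf_symm _ _ h) hac)) hbd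

/-- The configuration of all causes of `e`, with `e` itself. -/
def principal (e : E) : S.Domain :=
  ⟨{e' | S.le e' e}, S.finite_down e,
    fun _ ha _ hb h => S.conf_irrefl e (S.conf_mono h ha hb),
    fun _ ha _ h => S.le_trans _ _ _ h ha⟩

theorem principal_le_iff (c : S.Domain) (e : E) : S.DomainLE (S.principal e) c ↔ e ∈ c.1 :=
  ⟨fun h => h (S.le_refl e), fun h _ he => c.2.down_closed _ h _ he⟩

theorem principal_injective : Function.Injective S.principal := fun a b h =>
  S.le_antisymm _ _
    ((S.principal_le_iff _ _).1 (h ▸ Set.Subset.rfl : S.DomainLE (S.principal a) (S.principal b)))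
    ((S.principal_le_iff _ _).1 (h ▸ Set.Subset.rfl : S.DomainLE (S.principal b) (S.principal a)))

theorem domainLE_antisymm {c d : S.Domain} (h : S.DomainLE c d) (h' : S.DomainLE d c) : c = d :=
  Subtype.ext (Set.Subset.antisymm h h')

/-- This describes events by the order alone. If `c'` is the greatest element strictly below `c`, an
event of `c` missing from `c'` has a principal configuration below `c` but not below `c'`, so that
configuration must be `c`. Conversely, removing `e` from its principal configuration leaves the
greatest proper part. -/
theorem isCompletePrime_iff (c : S.Domain) :
    IsCompletePrime S.DomainLE c ↔ ∃ e, c = S.principal e := by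
  constructor
  · rintro ⟨c', h1, h2, h3⟩
    have : ∃ e ∈ c.1, e ∉ c'.1 := by
      by_contra! h
      exact h2 (S.domainLE_antisymm h1 h)
    obtain ⟨e, he, he'⟩ := this
    refine ⟨e, ?_⟩
    by_contra hne
    exact he' ((S.principal_le_iff _ _).1
      (h3 _ ((S.principal_le_iff _ _).2 he) fun h => hne h.symm))
  · rintro ⟨e, rfl⟩
    refine ⟨⟨(S.principal e).1 \ {e}, (S.principal e).2.finite.subset Set.sdiff_subset,
      fun a ha b hb => (S.principal e).2.conflict_free a ha.1 b hb.1,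
      fun a ha b hb => ⟨(S.principal e).2.down_closed a ha.1 b hb, ?_⟩⟩, Set.sdiff_subset, ?_, ?_⟩
    · rintro rfl
      exact ha.2 (S.le_antisymm _ _ ha.1 hb)
    · intro h
      exact ((Set.ext_iff.1 (congrArg Subtype.val h) e).2 (S.le_refl e)).2 rfl
    · intro d hd hne a ha
      refine ⟨hd ha, ?_⟩
      rintro rfl
      exact hne (S.domainLE_antisymm hd ((S.principal_le_iff _ _).2 ha))

/-- Conflict is also visible in the order. When two events are not in conflict, heredity of conflict
makes the union of their principal configurations a configuration, hence an upper bound. -/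
theorem conf_iff_principal (e e' : E) : S.conf e e' ↔
    ¬ ∃ c, S.DomainLE (S.principal e) c ∧ S.DomainLE (S.principal e') c := by
  constructor
  · rintro h ⟨c, h1, h2⟩
    exact c.2.conflict_free e (h1 (S.le_refl e)) e' (h2 (S.le_refl e')) h
  · intro h
    by_contra hc
    refine h ⟨⟨(S.principal e).1 ∪ (S.principal e').1,
      (S.finite_down e).union (S.finite_down e'), ?_, ?_⟩,
      Set.subset_union_left, Set.subset_union_right⟩
    · rintro a (ha | ha) b (hb | hb) hab
      · exact S.conf_irrefl e (S.conf_mono hab ha hb)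
      · exact hc (S.conf_mono hab ha hb)
      · exact hc (S.conf_symm _ _ (S.conf_mono hab ha hb))
      · exact S.conf_irrefl e' (S.conf_mono hab ha hb)
    · rintro a (ha | ha) b hb
      · exact Or.inl (S.le_trans _ _ _ hb ha)
      · exact Or.inr (S.le_trans _ _ _ hb ha)

end

/-- Event structures with isomorphic domains are isomorphic. -/
theorem exists_isIso_of_domain {E : Type u} {F : Type v} (S : EventStructure E)
    (T : EventStructure F) (φ : S.DomainLE ≃r T.DomainLE) : ∃ f : E ≃ F, IsIso S T f := by
  have h1 : ∀ e, ∃ e', φ (S.principal e) = T.principal e' := fun e =>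
    (T.isCompletePrime_iff _).1 (((S.isCompletePrime_iff _).2 ⟨e, rfl⟩).map φ)
  have h2 : ∀ e, ∃ e', φ.symm (T.principal e) = S.principal e' := fun e =>
    (S.isCompletePrime_iff _).1 (((T.isCompletePrime_iff _).2 ⟨e, rfl⟩).map φ.symm)
  choose f hf using h1
  choose g hg using h2
  refine ⟨⟨f, g, fun e => S.principal_injective ?_, fun e => T.principal_injective ?_⟩,
    fun e e' => ⟨?_, ?_⟩⟩
  · rw [← hg, ← hf, φ.symm_apply_apply]
  · rw [← hf, ← hg, φ.apply_symm_apply]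
  · change _ ↔ T.le (f e) (f e')
    rw [show S.le e e' ↔ S.DomainLE (S.principal e) (S.principal e') from
        (S.principal_le_iff (S.principal e') e).symm,
      show T.le (f e) (f e') ↔ T.DomainLE (T.principal (f e)) (T.principal (f e')) from
        (T.principal_le_iff (T.principal (f e')) (f e)).symm, ← hf, ← hf, φ.map_rel_iff]
  · change _ ↔ T.conf (f e) (f e')
    rw [conf_iff_principal, conf_iff_principal, not_iff_not, ← hf, ← hf]
    constructor
    · rintro ⟨c, hc, hc'⟩
      exact ⟨φ c, φ.map_rel_iff.2 hc, φ.map_rel_iff.2 hc'⟩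
    · rintro ⟨c, hc, hc'⟩
      obtain ⟨c, rfl⟩ := φ.surjective c
      exact ⟨c, φ.map_rel_iff.1 hc, φ.map_rel_iff.1 hc'⟩

section

variable {E : Type u} (S : EventStructure E)

/-- The domain of the residual at `c` consists of the configurations containing `c`. -/
def residualDomain (c : S.Domain) : (S.residual c).DomainLE ≃r upRel S.DomainLE c where
  toFun d := ⟨⟨c.1 ∪ Subtype.val '' d.1, c.2.finite.union (d.2.finite.image _), by
    rintro a (ha | ⟨a, ha, rfl⟩) b (hb | ⟨b, hb, rfl⟩) h
    · exact c.2.conflict_free a ha b hb h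
    · exact b.2.2 ⟨a, ha, h⟩
    · exact a.2.2 ⟨b, hb, S.conf_symm _ _ h⟩
    · exact d.2.conflict_free a ha b hb h, by
    rintro a (ha | ⟨a, ha, rfl⟩) b hb
    · exact Or.inl (c.2.down_closed a ha b hb)
    · by_cases hbc : b ∈ c.1
      · exact Or.inl hbc
      · refine Or.inr ⟨⟨b, hbc, ?_⟩, d.2.down_closed a ha _ hb, rfl⟩
        rintro ⟨e, he, hc⟩
        exact a.2.2 ⟨e, he, S.conf_inherit _ _ _ hc hb⟩⟩, Set.subset_union_left⟩
  invFun d := ⟨{e | e.1 ∈ d.1.1}, d.1.2.finite.preimage Subtype.val_injective.injOn,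
    fun a ha b hb => d.1.2.conflict_free a.1 ha b.1 hb,
    fun a ha b hb => d.1.2.down_closed a.1 ha b.1 hb⟩
  left_inv d := by
    apply Subtype.ext
    ext e
    constructor
    · rintro (h | ⟨e', h, h'⟩)
      · exact absurd h e.2.1
      · exact Subtype.ext h' ▸ h
    · exact fun h => Or.inr ⟨e, h, rfl⟩
  right_inv d := by
    apply Subtype.ext
    apply Subtype.ext
    ext e
    constructor
    · rintro (h | ⟨e', h, rfl⟩)
      · exact d.2 h
      · exact h
    · intro h
      by_cases hc : e ∈ c.1
      · exact Or.inl hc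
      · refine Or.inr ⟨⟨e, hc, ?_⟩, h, rfl⟩
        rintro ⟨a, ha, hae⟩
        exact d.1.2.conflict_free a (d.2 ha) e h hae
  map_rel_iff' {d d'} := by
    constructor
    · intro h e he
      rcases h (Or.inr ⟨e, he, rfl⟩) with h | ⟨e', h, h'⟩
      · exact absurd h e.2.1
      · exact Subtype.ext h' ▸ h
    · exact fun h => Set.union_subset_union_right _ (Set.image_mono h)

end

namespace IsIso

variable {E : Type u} {F : Type v} {S : EventStructure E} {T : EventStructure F} {f : E ≃ F}

theorem symm (h : IsIso S T f) : IsIso T S f.symm := fun e e' => by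
  have := h (f.symm e) (f.symm e')
  simp only [Equiv.apply_symm_apply] at this
  exact ⟨this.1.symm, this.2.symm⟩

theorem isConfig (h : IsIso S T f) {c : Set E} (hc : S.IsConfig c) : T.IsConfig (f '' c) where
  finite := hc.finite.image _
  conflict_free := by
    rintro _ ⟨a, ha, rfl⟩ _ ⟨b, hb, rfl⟩ hab
    exact hc.conflict_free a ha b hb ((h a b).2.2 hab)
  down_closed := by
    rintro _ ⟨a, ha, rfl⟩ b hb
    obtain ⟨b, rfl⟩ := f.surjective b
    exact ⟨b, hc.down_closed a ha b ((h b a).1.2 hb), rfl⟩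

/-- The image of a configuration. -/
def mapConfig (h : IsIso S T f) (c : S.Domain) : T.Domain := ⟨f '' c.1, h.isConfig c.2⟩

theorem mapConfig_injective (h : IsIso S T f) : Function.Injective h.mapConfig := fun _ _ hcd =>
  Subtype.ext (f.injective.image_injective (congrArg Subtype.val hcd))

theorem enabled (h : IsIso S T f) {c : S.Domain} {e : E} (he : e ∈ S.enabled c) :
    f e ∈ T.enabled (h.mapConfig c) := by
  refine ⟨fun hm => he.1 ((Function.Injective.mem_set_image f.injective).1 hm), ?_⟩
  have := h.isConfig he.2
  rwa [Set.image_insert_eq] at this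

theorem concurrent (h : IsIso S T f) {e e' : E} (he : S.Concurrent e e') :
    T.Concurrent (f e) (f e') :=
  ⟨fun hl => he.1 ((h _ _).1.2 hl), fun hl => he.2.1 ((h _ _).1.2 hl),
    fun hl => he.2.2 ((h _ _).2.2 hl)⟩

theorem minConf (h : IsIso S T f) {e e' : E} (he : S.MinConf e e') :
    T.MinConf (f e) (f e') := by
  refine ⟨(h _ _).2.1 he.1, ?_⟩
  rintro ⟨a, h1, h2, h3⟩
  obtain ⟨a, rfl⟩ := f.surjective a
  refine he.2 ⟨a, fun h => h1 (congrArg f h), fun h => h2 (congrArg f h), ?_⟩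
  rw [(h _ _).1, (h _ _).1, (h _ _).2, (h _ _).2]
  exact h3

theorem natural3 (h : IsIso S T f) {e e' : E} (he : S.Natural3 e e') :
    T.Natural3 (f e) (f e') := by
  obtain ⟨a, c, c', hc, h1, h2, h3, h4⟩ := he
  exact ⟨f a, h.mapConfig c, h.mapConfig c', fun hcc => hc (h.mapConfig_injective hcc),
    ⟨h.enabled h1.1, h.enabled h1.2⟩, ⟨h.enabled h2.1, h.enabled h2.2⟩, h.concurrent h3,
    h.minConf h4⟩

theorem natural (h : IsIso S T f) {e e' : E} (he : S.Natural e e') : T.Natural (f e) (f e') :=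
  ⟨fun hh => he.1 (f.injective hh), he.2.imp h.concurrent
    (Or.imp h.minConf (Or.imp h.natural3 h.natural3))⟩

theorem naturalCliquesLE (h : IsIso S T f) {n : ℕ} (hn : T.NaturalCliquesLE n) :
    S.NaturalCliquesLE n := by
  intro Q hQ
  rw [← f.injective.encard_image]
  apply hn
  rintro _ ⟨a, ha, rfl⟩ _ ⟨b, hb, rfl⟩ hab
  exact h.natural (hQ a ha b hb fun hh => hab (congrArg f hh))

end IsIso

end EventStructure

/-! ### Change of base vertex in universal covers -/

namespace DirectedSquareComplex

variable {Y : DirectedSquareComplex} {a b c d : Y.V}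

namespace EdgePath

/-- Concatenation of edge paths. -/
def append (p : Y.EdgePath a b) : ∀ {c : Y.V}, Y.EdgePath b c → Y.EdgePath a c
  | _, .nil => p
  | _, .fwd q e hs ht => (p.append q).fwd e hs ht
  | _, .bwd q e ht hs => (p.append q).bwd e ht hs

theorem append_assoc (p : Y.EdgePath a b) (q : Y.EdgePath b c) {d : Y.V} (s : Y.EdgePath c d) :
    (p.append q).append s = p.append (q.append s) := by
  induction s with
  | nil => rfl
  | fwd s e hs ht ih => simp only [append, ih]
  | bwd s e ht hs ih => simp only [append, ih]

theorem nil_append {b : Y.V} (p : Y.EdgePath a b) : EdgePath.nil.append p = p := by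
  induction p with
  | nil => rfl
  | fwd s e hs ht ih => simp only [append, ih]
  | bwd s e ht hs ih => simp only [append, ih]

/-- The inverse of an edge path. -/
def reverse : ∀ {b : Y.V}, Y.EdgePath a b → Y.EdgePath b a
  | _, .nil => .nil
  | _, .fwd q e hs ht => (EdgePath.nil.bwd e ht hs).append q.reverse
  | _, .bwd q e ht hs => (EdgePath.nil.fwd e hs ht).append q.reverse

end EdgePath

namespace Homotopic

theorem append_right {p p' : Y.EdgePath a b} (h : Homotopic Y a p p') {c : Y.V}
    (q : Y.EdgePath b c) : Homotopic Y a (p.append q) (p'.append q) := by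
  induction q with
  | nil => exact h
  | fwd s e hs ht ih => exact ih.fwd e hs ht
  | bwd s e ht hs ih => exact ih.bwd e ht hs

theorem append_left (p : Y.EdgePath a b) {c : Y.V} {q q' : Y.EdgePath b c}
    (h : Homotopic Y b q q') : Homotopic Y a (p.append q) (p.append q') := by
  induction h with
  | refl q => exact .refl _
  | symm _ ih => exact ih.symm
  | trans _ _ ih ih' => exact ih.trans ih'
  | fwd e hs ht _ ih => exact ih.fwd e hs ht
  | bwd e ht hs _ ih => exact ih.bwd e ht hs
  | fwd_bwd q e hs ht => exact .fwd_bwd _ e hs ht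
  | bwd_fwd q e ht hs => exact .bwd_fwd _ e ht hs
  | square q s h => exact .square _ s h

theorem append_reverse {b : Y.V} (p : Y.EdgePath a b) :
    Homotopic Y a (p.append p.reverse) .nil := by
  induction p with
  | nil => exact .refl _
  | fwd q e hs ht ih =>
    rw [EdgePath.reverse, ← EdgePath.append_assoc]
    exact .trans (append_right (.fwd_bwd _ e hs ht) _) ih
  | bwd q e ht hs ih =>
    rw [EdgePath.reverse, ← EdgePath.append_assoc]
    exact .trans (append_right (.bwd_fwd _ e ht hs) _) ih

theorem reverse_append {b : Y.V} (p : Y.EdgePath a b) :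
    Homotopic Y b (p.reverse.append p) .nil := by
  induction p with
  | nil => exact .refl _
  | fwd q e hs ht ih =>
    have : (q.fwd e hs ht).reverse.append (q.fwd e hs ht) =
        ((EdgePath.nil.bwd e ht hs).append (q.reverse.append q)).fwd e hs ht := by
      simp only [EdgePath.reverse, EdgePath.append, EdgePath.append_assoc]
    rw [this]
    exact .trans ((append_left _ ih).fwd e hs ht) (.bwd_fwd _ e ht hs)
  | bwd q e ht hs ih =>
    have : (q.bwd e ht hs).reverse.append (q.bwd e ht hs) =
        ((EdgePath.nil.fwd e hs ht).append (q.reverse.append q)).bwd e ht hs := by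
      simp only [EdgePath.reverse, EdgePath.append, EdgePath.append_assoc]
    rw [this]
    exact .trans ((append_left _ ih).bwd e ht hs) (.fwd_bwd _ e hs ht)

end Homotopic

/-- Precomposition with an edge path, as a map between the vertices of universal covers. -/
def changeBase (p : Y.EdgePath a b) (x : Y.CoverVertex b) : Y.CoverVertex a :=
  ⟨x.1, Quot.map (fun q => p.append q) (fun _ _ h => h.append_left p) x.2⟩

theorem changeBase_changeBase (p : Y.EdgePath a b) (q : Y.EdgePath b a)
    (h : Homotopic Y a (p.append q) .nil) (x : Y.CoverVertex a) :
    changeBase p (changeBase q x) = x := by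
  obtain ⟨c, x⟩ := x
  induction x using Quot.ind with
  | mk s =>
    refine congrArg (Sigma.mk c) (Quot.sound ?_)
    change Homotopic Y a (p.append (q.append s)) s
    rw [← EdgePath.append_assoc]
    simpa only [EdgePath.nil_append] using h.append_right s

/-- The isomorphism of universal covers with different base vertices, on vertices. -/
def changeBaseEquiv (p : Y.EdgePath a b) : Y.CoverVertex b ≃ Y.CoverVertex a where
  toFun := changeBase p
  invFun := changeBase p.reverse
  left_inv := changeBase_changeBase _ _ (Homotopic.reverse_append p)
  right_inv := changeBase_changeBase _ _ (Homotopic.append_reverse p)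

theorem changeBase_coverStep (p : Y.EdgePath a b) (x : Y.CoverVertex b) (e : Y.E)
    (h : Y.src e = x.1) :
    changeBase p (Y.coverStep b x e h) = Y.coverStep a (changeBase p x) e h := by
  obtain ⟨c, x⟩ := x
  induction x using Quot.ind with
  | mk s => rfl

theorem universalCover_arc_iff {x y : Y.CoverVertex a} :
    (Y.universalCover a).Arc x y ↔ ∃ e, ∃ h : Y.src e = x.1, y = Y.coverStep a x e h := by
  constructor
  · rintro ⟨⟨⟨x, e⟩, h⟩, rfl, rfl⟩
    exact ⟨e, h, rfl⟩
  · rintro ⟨e, h, rfl⟩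
    exact ⟨⟨⟨x, e⟩, h⟩, rfl, rfl⟩

theorem Arc.changeBase (p : Y.EdgePath a b) {x y : Y.CoverVertex b}
    (h : (Y.universalCover b).Arc x y) :
    (Y.universalCover a).Arc (changeBase p x) (DirectedSquareComplex.changeBase p y) := by
  obtain ⟨e, he, rfl⟩ := universalCover_arc_iff.1 h
  exact universalCover_arc_iff.2 ⟨e, he, changeBase_coverStep p x e he⟩

theorem Prec.changeBase (p : Y.EdgePath a b) {x y : Y.CoverVertex b}
    (h : (Y.universalCover b).Prec x y) :
    (Y.universalCover a).Prec (changeBase p x) (DirectedSquareComplex.changeBase p y) :=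
  Relation.ReflTransGen.lift (DirectedSquareComplex.changeBase p)
    (fun _ _ h => Arc.changeBase p h) _ _ h

/-- The base vertex of the universal cover. -/
def coverBase (Y : DirectedSquareComplex) (a : Y.V) : Y.CoverVertex a := ⟨a, Quot.mk _ .nil⟩

/-- The change of base vertex preserves `≺`. -/
def precChangeBase (p : Y.EdgePath a b) :
    (Y.universalCover b).Prec ≃r (Y.universalCover a).Prec where
  toEquiv := changeBaseEquiv p
  map_rel_iff' {x y} := by
    refine ⟨fun h => ?_, fun h => h.changeBase p⟩
    have := Prec.changeBase p.reverse h
    exact (changeBaseEquiv p).left_inv x ▸ (changeBaseEquiv p).left_inv y ▸ this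

/-- A principal filter of the universal cover depends only on the image of its vertex. -/
theorem nonempty_filter_base (x : Y.CoverVertex a) :
    Nonempty ((Y.universalCover x.1).FilterLE (Y.coverBase x.1) ≃r
      (Y.universalCover a).FilterLE x) := by
  obtain ⟨b, x⟩ := x
  induction x using Quot.ind with
  | mk p => exact ⟨upRelCongr (precChangeBase p) (Y.coverBase b)⟩

/-- Both filters are compared with the filter of the base vertex in the cover based at the common
image. This replaces the use of deck transformations, and it is where finiteness of index comes
from. -/
theorem nonempty_filter_congr {x y : Y.CoverVertex a} (h : x.1 = y.1) :
    Nonempty ((Y.universalCover a).FilterLE x ≃r (Y.universalCover a).FilterLE y) := by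
  obtain ⟨f⟩ := nonempty_filter_base x
  obtain ⟨g⟩ := nonempty_filter_base y
  rw [h] at f
  exact ⟨f.symm.trans g⟩

/-- A directed path may begin with loops, which are skipped to reach the first arc that really
moves. -/
theorem Prec.exists_arc {Z : DirectedSquareComplex} {x y : Z.V} (h : Z.Prec x y) (hne : x ≠ y) :
    ∃ z, z ≠ x ∧ Z.Arc x z ∧ Z.Prec z y := by
  induction h using Relation.ReflTransGen.head_induction_on with
  | refl => exact absurd rfl hne
  | @head x z hxz hzy ih =>
    by_cases hz : z = x
    · subst hz
      exact ih hne
    · exact ⟨z, hz, hxz, hzy⟩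

end DirectedSquareComplex

/-! ### Regularity from the finiteness of the complex -/

namespace EventStructure

variable {E : Type u} {S : EventStructure E} {Y : DirectedSquareComplex} {a : Y.V}
  {x : Y.CoverVertex a}

/-- The domain of the residual at `c` is the filter of the vertex of `c`, and its isomorphism type
depends only on the image of that vertex in `Y`. Domains determine event structures, so one
configuration for each image that occurs suffices. -/
theorem finiteIndex_of_filter [Finite Y.V] (φ : (Y.universalCover a).FilterLE x ≃r S.DomainLE) :
    S.FiniteIndex := by
  let pt : S.Domain → Y.CoverVertex a := fun c => (φ.symm c).1
  have key : ∀ c c', (pt c).1 = (pt c').1 →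
      ∃ f : S.residualEvents c ≃ S.residualEvents c', IsIso (S.residual c) (S.residual c') f := by
    intro c c' h
    have up : ∀ c, Nonempty ((S.residual c).DomainLE ≃r (Y.universalCover a).FilterLE (pt c)) :=
      fun c => ⟨(S.residualDomain c).trans <| (upRelCongr φ.symm c).trans <|
        upRelUpRel (fun _ _ _ => Relation.ReflTransGen.trans) x (φ.symm c)⟩
    obtain ⟨f⟩ := up c
    obtain ⟨g⟩ := up c'
    obtain ⟨k⟩ := nonempty_filter_congr h
    exact exists_isIso_of_domain _ _ (f.trans (k.trans g.symm))
  let B := {b : Y.V // ∃ c, (pt c).1 = b}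
  refine ⟨Set.range fun b : B => b.2.choose, Set.finite_range _, fun c => ?_⟩
  let b : B := ⟨(pt c).1, c, rfl⟩
  exact ⟨_, ⟨b, rfl⟩, key _ _ b.2.choose_spec.symm⟩

theorem finiteDegree_of_filter [Finite Y.E] (φ : (Y.universalCover a).FilterLE x ≃r S.DomainLE) :
    S.FiniteDegree := by
  refine ⟨Nat.card Y.E, fun c => ?_⟩
  let add : S.enabled c → S.Domain := fun e => ⟨insert e.1 c.1, e.2.2⟩
  have hle : ∀ e, S.DomainLE c (add e) := fun e => Set.subset_insert _ _
  have harc : ∀ e, (Y.universalCover a).Arc (φ.symm c).1 (φ.symm (add e)).1 := by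
    intro e
    have hne : c ≠ add e := fun h => e.2.1 (congrArg Subtype.val h ▸ Set.mem_insert e.1 c.1)
    have h1 : (Y.universalCover a).Prec (φ.symm c).1 (φ.symm (add e)).1 :=
      φ.symm.map_rel_iff.2 (hle e)
    obtain ⟨z, hz, hcz, hze⟩ := h1.exists_arc
      fun h => hne (φ.symm.injective (Subtype.ext h))
    have hxz : (Y.universalCover a).Prec x z := (φ.symm c).2.tail hcz
    obtain ⟨d, hd⟩ := φ.symm.surjective ⟨z, hxz⟩
    have hdz : (φ.symm d).1 = z := congrArg Subtype.val hd
    rw [← hdz] at hcz hze hz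
    have hcd : S.DomainLE c d := φ.symm.map_rel_iff.1
      (Relation.ReflTransGen.single hcz : (Y.universalCover a).Prec _ _)
    have hde : S.DomainLE d (add e) := φ.symm.map_rel_iff.1 hze
    -- No configuration lies strictly between `c` and `insert e c`, so the first proper arc on the
    -- path already ends at `add e`.
    suffices d = add e by rwa [← this]
    refine S.domainLE_antisymm hde (Set.insert_subset ?_ hcd)
    by_contra he
    refine hz (congrArg (fun d => (φ.symm d).1) (S.domainLE_antisymm ?_ hcd))
    intro e' he'
    rcases hde he' with rfl | h
    · exact absurd he' he
    · exact h
  choose g hs ht using fun e => universalCover_arc_iff.1 (harc e)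
  -- An edge of `Y` has only one lift starting at the vertex of `c`, so different events use
  -- different edges.
  have hg : Function.Injective g := by
    intro e e' h
    have h1 : (φ.symm (add e)).1 = (φ.symm (add e')).1 := by
      rw [ht e, ht e']
      congr 1
    have h2 : insert e.1 c.1 = insert e'.1 c.1 :=
      congrArg Subtype.val (φ.symm.injective (Subtype.ext h1))
    have h3 : e.1 ∈ insert e'.1 c.1 := h2 ▸ Set.mem_insert _ _
    exact Subtype.ext (h3.resolve_right e.2.1)
  have := Finite.of_injective g hg
  rw [Set.encard, ENat.card_eq_coe_natCard]
  exact_mod_cast Nat.card_le_card_of_injective g hg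

theorem isRegular_of_filter [Finite Y.V] [Finite Y.E]
    (φ : (Y.universalCover a).FilterLE x ≃r S.DomainLE) : S.IsRegular :=
  ⟨finiteIndex_of_filter φ, finiteDegree_of_filter φ⟩

end EventStructure

/-! ## Orders generated by arcs -/

/-- A reflexive and antisymmetric relation is isomorphic to any relation that it maps onto. -/
noncomputable def relIsoOfSurjective {α : Type u} {β : Type v} {r : α → α → Prop}
    {s : β → β → Prop} (f : α → β) (hf : ∀ a b, s (f a) (f b) ↔ r a b) (hr : ∀ a, r a a)
    (ha : ∀ a b, r a b → r b a → a = b) (hs : Function.Surjective f) : r ≃r s where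
  toEquiv := Equiv.ofBijective f ⟨fun a b h => ha a b
    ((hf a b).1 (h ▸ (hf a a).2 (hr a))) ((hf b a).1 (h ▸ (hf a a).2 (hr a))), hs⟩
  map_rel_iff' {a b} := hf a b

section Graded

variable {α : Type u} {arc : α → α → Prop} {rank : α → ℕ}

theorem rank_le_of_reflTransGen (h : ∀ p q, arc p q → rank q = rank p + 1) {p q : α}
    (hpq : ReflTransGen arc p q) : rank p ≤ rank q := by
  induction hpq with
  | refl => exact le_rfl
  | tail _ h' ih => exact ih.trans ((Nat.le_succ _).trans (h _ _ h').ge)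

theorem eq_of_reflTransGen_of_rank (h : ∀ p q, arc p q → rank q = rank p + 1) {p q : α}
    (hpq : ReflTransGen arc p q) (hr : rank q ≤ rank p) : p = q := by
  rcases ReflTransGen.cases_head hpq with rfl | ⟨z, hz, hzq⟩
  · rfl
  · have := rank_le_of_reflTransGen h hzq
    have := h _ _ hz
    omega

theorem reflTransGen_antisymm (h : ∀ p q, arc p q → rank q = rank p + 1) {p q : α}
    (hpq : ReflTransGen arc p q) (hqp : ReflTransGen arc q p) : p = q :=
  eq_of_reflTransGen_of_rank h hpq (rank_le_of_reflTransGen h hqp)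

/-- `q` is an immediate successor of `p`. -/
def Cov (r : α → α → Prop) (p q : α) : Prop :=
  r p q ∧ p ≠ q ∧ ∀ z, r p z → r z q → z = p ∨ z = q

/-- Each arc raises the rank by one, so nothing fits between its ends. This makes the arcs
recoverable from the order. -/
theorem cov_reflTransGen_iff (h : ∀ p q, arc p q → rank q = rank p + 1) {p q : α} :
    Cov (ReflTransGen arc) p q ↔ arc p q := by
  constructor
  · rintro ⟨h1, h2, h3⟩
    rcases ReflTransGen.cases_head h1 with rfl | ⟨z, hz, hzq⟩
    · exact absurd rfl h2
    · rcases h3 z (.single hz) hzq with rfl | rfl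
      · have := h _ _ hz
        omega
      · exact hz
  · intro hpq
    have h1 := h _ _ hpq
    refine ⟨.single hpq, ?_, fun z hz hz' => ?_⟩
    · rintro rfl
      omega
    · by_cases hr : rank z ≤ rank p
      · exact Or.inl (eq_of_reflTransGen_of_rank h hz hr).symm
      · exact Or.inr (eq_of_reflTransGen_of_rank h hz' (by omega))

theorem Cov.map {β : Type v} {r : α → α → Prop} {s : β → β → Prop} (f : r ≃r s) {p q : α}
    (h : Cov r p q) : Cov s (f p) (f q) := by
  refine ⟨f.map_rel_iff.2 h.1, fun hh => h.2.1 (f.injective hh), fun z hz hz' => ?_⟩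
  obtain ⟨z, rfl⟩ := f.surjective z
  exact (h.2.2 z (f.map_rel_iff.1 hz) (f.map_rel_iff.1 hz')).imp (congrArg f) (congrArg f)

end Graded

/-- The product of two relations. -/
def prodRel {α : Type u} {β : Type v} (r : α → α → Prop) (s : β → β → Prop) (p q : α × β) : Prop :=
  r p.1 q.1 ∧ s p.2 q.2

/-- A step in one of the two coordinates. -/
def prodArc {α : Type u} {β : Type v} (r : α → α → Prop) (s : β → β → Prop) (p q : α × β) : Prop :=
  (r p.1 q.1 ∧ p.2 = q.2) ∨ (p.1 = q.1 ∧ s p.2 q.2)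

/-- Steps in different coordinates commute, so a path can be sorted: first coordinate first, then
second. -/
theorem reflTransGen_prodArc_iff {α : Type u} {β : Type v} {r : α → α → Prop} {s : β → β → Prop}
    {p q : α × β} : ReflTransGen (prodArc r s) p q ↔
      prodRel (ReflTransGen r) (ReflTransGen s) p q := by
  constructor
  · intro h
    induction h with
    | refl => exact ⟨.refl, .refl⟩
    | tail _ h ih =>
      rcases h with ⟨h1, h2⟩ | ⟨h1, h2⟩
      · exact ⟨ih.1.tail h1, h2 ▸ ih.2⟩
      · exact ⟨h1 ▸ ih.1, ih.2.tail h2⟩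
  · obtain ⟨a, b⟩ := p
    obtain ⟨c, d⟩ := q
    rintro ⟨h1, h2⟩
    exact (ReflTransGen.lift (r := r) (p := prodArc r s) (fun a => (a, b))
      (fun _ _ h => Or.inl ⟨h, rfl⟩) _ _ h1).trans
      (ReflTransGen.lift (r := s) (p := prodArc r s) (fun b => (c, b))
      (fun _ _ h => Or.inr ⟨rfl, h⟩) _ _ h2)

/-- The relation obtained by attaching to each point `a` a chain of length `len a` above `a`. -/
def tipRel {α : Type u} (r : α → α → Prop) (len : α → ℕ) :
    α ⊕ (Σ a, Fin (len a)) → α ⊕ (Σ a, Fin (len a)) → Prop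
  | .inl p, .inl q => r p q
  | .inl p, .inr t => r p t.1
  | .inr _, .inl _ => False
  | .inr t, .inr t' => t.1 = t'.1 ∧ t.2.val ≤ t'.2.val

/-- The arcs after attaching chains. -/
def tipArc {α : Type u} (r : α → α → Prop) (len : α → ℕ) :
    α ⊕ (Σ a, Fin (len a)) → α ⊕ (Σ a, Fin (len a)) → Prop
  | .inl p, .inl q => r p q
  | .inl p, .inr t => p = t.1 ∧ t.2.val = 0
  | .inr _, .inl _ => False
  | .inr t, .inr t' => t.1 = t'.1 ∧ t'.2.val = t.2.val + 1

theorem reflTransGen_tipArc_iff {α : Type u} {r : α → α → Prop} {len : α → ℕ}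
    {p q : α ⊕ (Σ a, Fin (len a))} : ReflTransGen (tipArc r len) p q ↔
      tipRel (ReflTransGen r) len p q := by
  have tip : ∀ (a : α) (n k : ℕ) (hn : n < len a) (hk : k < len a), k ≤ n →
      ReflTransGen (tipArc r len) (.inr ⟨a, k, hk⟩) (.inr ⟨a, n, hn⟩) := by
    intro a n
    induction n with
    | zero =>
      intro k hn hk h
      obtain rfl := Nat.le_zero.1 h
      exact .refl
    | succ n ih =>
      intro k hn hk h
      rcases Nat.le_succ_iff.1 h with h | rfl
      · exact (ih k (by omega) hk h).tail ⟨rfl, rfl⟩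
      · exact .refl
  constructor
  · intro h
    induction h with
    | refl =>
      rcases p with p | p
      · exact ReflTransGen.refl
      · exact ⟨rfl, le_rfl⟩
    | @tail y z _ h ih =>
      rcases p with p | p <;> rcases y with y | y <;> rcases z with z | z
      · exact ReflTransGen.tail ih h
      · exact show ReflTransGen r p z.1 from h.1 ▸ ih
      · exact h.elim
      · exact show ReflTransGen r p z.1 from h.1 ▸ (show ReflTransGen r p y.1 from ih)
      · exact ih.elim
      · exact ih.elim
      · exact h.elim
      · exact ⟨ih.1.trans h.1, ih.2.trans (by rw [h.2]; exact Nat.le_succ _)⟩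
  · intro h
    rcases p with p | ⟨p, k, hk⟩ <;> rcases q with q | ⟨q, n, hn⟩
    · exact ReflTransGen.lift (r := r) (p := tipArc r len) Sum.inl (fun _ _ h => h) _ _ h
    · exact (ReflTransGen.lift (r := r) (p := tipArc r len) Sum.inl (fun _ _ h => h) _ _ h).trans
        ((ReflTransGen.single (show tipArc r len (.inl q) (.inr ⟨q, 0, by omega⟩) from
          ⟨rfl, rfl⟩)).trans (tip q n 0 hn _ (Nat.zero_le _)))
    · exact h.elim
    · obtain ⟨h1, h2⟩ := h
      dsimp only at h1
      subst h1
      exact tip p n k hn hk h2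

/-- Isomorphic relations remain isomorphic after attaching chains of the same lengths. -/
noncomputable def tipRelCongr {α : Type u} {β : Type v} {r : α → α → Prop} {s : β → β → Prop}
    (f : r ≃r s) (len : α → ℕ) : tipRel r len ≃r tipRel s (len ∘ f.symm) where
  toEquiv := Equiv.sumCongr f.toEquiv
    (Equiv.sigmaCongr f.toEquiv fun a => finCongr (by simp))
  map_rel_iff' {p q} := by
    rcases p with p | p <;> rcases q with q | q
    · exact f.map_rel_iff
    · exact f.map_rel_iff
    · exact Iff.rfl
    · exact and_congr f.injective.eq_iff Iff.rfl

/-! ## Constructions of event structures -/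

/-- A rooted tree, given by the parents of the vertices. -/
structure ParentTree (T : Type u) where
  root : T
  parent : T → T
  depth : T → ℕ
  depth_parent : ∀ p, p ≠ root → depth p = depth (parent p) + 1

namespace ParentTree

variable {T : Type u} (t : ParentTree T)

/-- `p` is the parent of `q`. -/
def arc (p q : T) : Prop := q ≠ t.root ∧ t.parent q = p

/-- `p` is an ancestor of `q`. -/
def le : T → T → Prop := ReflTransGen t.arc

theorem depth_arc (p q : T) (h : t.arc p q) : t.depth q = t.depth p + 1 :=
  h.2 ▸ t.depth_parent q h.1

theorem le_antisymm {p q : T} (h : t.le p q) (h' : t.le q p) : p = q :=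
  reflTransGen_antisymm t.depth_arc h h'

theorem induction {motive : T → Prop} (hroot : motive t.root)
    (harc : ∀ p q, t.arc p q → motive p → motive q) (p : T) : motive p := by
  induction hn : t.depth p using Nat.strong_induction_on generalizing p with
  | _ n ih =>
    by_cases h : p = t.root
    · exact h ▸ hroot
    · have h' := t.depth_parent p h
      exact harc _ _ ⟨h, rfl⟩ (ih _ (by omega) _ rfl)

theorem root_le (p : T) : t.le t.root p := by
  induction p using t.induction with
  | hroot => exact .refl
  | harc p q h ih => exact ih.tail h

theorem eq_root_of_le {p : T} (h : t.le p t.root) : p = t.root := t.le_antisymm h (t.root_le p)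

theorem le_iff_of_arc {p q x : T} (h : t.arc p q) : t.le x q ↔ x = q ∨ t.le x p := by
  constructor
  · intro hx
    rcases ReflTransGen.cases_tail hx with h1 | ⟨z, hz, hzq⟩
    · exact Or.inl h1.symm
    · exact Or.inr (by rwa [← h.2, hzq.2])
  · rintro (rfl | hx)
    · exact .refl
    · exact hx.tail h

theorem finite_le (p : T) : {q | t.le q p}.Finite := by
  induction p using t.induction with
  | hroot => exact (Set.finite_singleton t.root).subset fun q hq => t.eq_root_of_le hq
  | harc p q h ih =>
    exact (ih.insert q).subset fun x hx => (t.le_iff_of_arc h).1 hx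

theorem le_total_of_le {p q x : T} (hp : t.le p x) (hq : t.le q x) : t.le p q ∨ t.le q p := by
  induction x using t.induction with
  | hroot =>
    rw [t.eq_root_of_le hp]
    exact Or.inl (t.root_le q)
  | harc y x h ih =>
    rcases (t.le_iff_of_arc h).1 hp with rfl | hp'
    · exact Or.inr hq
    · rcases (t.le_iff_of_arc h).1 hq with rfl | hq'
      · exact Or.inl hp
      · exact ih hp' hq'

/-- The event structure of a rooted tree: the events are the edges, given by their lower ends. -/
def eventStructure : EventStructure {p // p ≠ t.root} where
  le p q := t.le p.1 q.1
  le_refl _ := .refl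
  le_trans _ _ _ := .trans
  le_antisymm _ _ h h' := Subtype.ext (t.le_antisymm h h')
  conf p q := ¬ t.le p.1 q.1 ∧ ¬ t.le q.1 p.1
  conf_irrefl p h := h.1 .refl
  conf_symm _ _ h := h.symm
  finite_down p := (t.finite_le p.1).preimage Subtype.val_injective.injOn
  conf_inherit p q x h hqx := by
    refine ⟨fun hpx => ?_, fun hxp => h.2 (hqx.trans hxp)⟩
    rcases t.le_total_of_le hpx hqx with h' | h'
    · exact h.1 h'
    · exact h.2 h'

/-- The path from the root to a vertex. -/
def config (p : T) : t.eventStructure.Domain :=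
  ⟨{q | t.le q.1 p}, (t.finite_le p).preimage Subtype.val_injective.injOn,
    fun _ ha _ hb h => (t.le_total_of_le ha hb).elim h.1 h.2,
    fun _ ha _ h => ReflTransGen.trans h ha⟩

theorem config_le_iff (p q : T) :
    t.eventStructure.DomainLE (t.config p) (t.config q) ↔ t.le p q := by
  constructor
  · intro h
    by_cases hp : p = t.root
    · exact hp ▸ t.root_le q
    · exact h (show (⟨p, hp⟩ : {p // p ≠ t.root}) ∈ (t.config p).1 from ReflTransGen.refl)
  · exact fun h x hx => ReflTransGen.trans hx h

/-- Vertices of a tree that are not in conflict are comparable, so a nonempty configuration is a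
chain and equals the path to its deepest vertex. The empty one is the path to the root. -/
theorem config_surjective : Function.Surjective t.config := by
  intro c
  by_cases hc : c.1.Nonempty
  · obtain ⟨m, hm, hmax⟩ := Set.exists_max_image c.1 (fun p => t.depth p.1) c.2.finite hc
    refine ⟨m.1, Subtype.ext (Set.Subset.antisymm (fun x hx => c.2.down_closed m hm x hx) ?_)⟩
    intro x hx
    by_contra hxm
    have hmx : t.le m.1 x.1 := by
      by_contra h
      exact c.2.conflict_free x hx m hm ⟨hxm, h⟩
    have := eq_of_reflTransGen_of_rank t.depth_arc hmx (hmax x hx)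
    exact hxm (this ▸ ReflTransGen.refl)
  · refine ⟨t.root, Subtype.ext ?_⟩
    rw [Set.not_nonempty_iff_eq_empty.1 hc]
    ext x
    exact ⟨fun hx => (x.2 (t.eq_root_of_le hx)).elim, fun hx => hx.elim⟩

/-- The domain of the event structure of a tree is the tree. -/
noncomputable def domainIso : t.le ≃r t.eventStructure.DomainLE :=
  relIsoOfSurjective t.config t.config_le_iff (fun _ => .refl) (fun _ _ => t.le_antisymm)
    t.config_surjective

end ParentTree

namespace EventStructure

variable {E : Type u} {F : Type v} (S : EventStructure E) (T : EventStructure F)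

/-- Two event structures side by side. -/
def sum : EventStructure (E ⊕ F) where
  le := Sum.LiftRel S.le T.le
  le_refl e := by rcases e with e | e <;> constructor <;> apply le_refl
  le_trans := by
    rintro _ _ _ (h | h) (h' | h') <;> constructor <;> exact le_trans _ _ _ _ h h'
  le_antisymm := by
    rintro _ _ (h | h) (h' | h')
    · exact congrArg _ (S.le_antisymm _ _ h h')
    · exact congrArg _ (T.le_antisymm _ _ h h')
  conf := Sum.LiftRel S.conf T.conf
  conf_irrefl := by
    rintro _ (h | h)
    · exact S.conf_irrefl _ h
    · exact T.conf_irrefl _ h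
  conf_symm := by
    rintro _ _ (h | h) <;> constructor <;> exact conf_symm _ _ _ h
  finite_down e := by
    rcases e with e | e
    · refine ((S.finite_down e).image Sum.inl).subset ?_
      rintro _ ⟨h⟩
      exact ⟨_, h, rfl⟩
    · refine ((T.finite_down e).image Sum.inr).subset ?_
      rintro _ (_ | h)
      exact ⟨_, h, rfl⟩
  conf_inherit := by
    rintro _ _ _ (h | h) (h' | h') <;> constructor <;> exact conf_inherit _ _ _ _ h h'

/-- A pair of configurations. -/
def sumConfig (c : S.Domain × T.Domain) : (S.sum T).Domain :=
  ⟨Sum.inl '' c.1.1 ∪ Sum.inr '' c.2.1, (c.1.2.finite.image _).union (c.2.2.finite.image _), by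
    rintro _ (⟨a, ha, rfl⟩ | ⟨a, ha, rfl⟩) _ (⟨b, hb, rfl⟩ | ⟨b, hb, rfl⟩) (h | h)
    · exact c.1.2.conflict_free a ha b hb h
    · exact c.2.2.conflict_free a ha b hb h, by
    rintro _ (⟨a, ha, rfl⟩ | ⟨a, ha, rfl⟩) _ (h | h)
    · exact Or.inl ⟨_, c.1.2.down_closed a ha _ h, rfl⟩
    · exact Or.inr ⟨_, c.2.2.down_closed a ha _ h, rfl⟩⟩

theorem inl_mem_sumConfig {c : S.Domain × T.Domain} {e : E} :
    Sum.inl e ∈ (S.sumConfig T c).1 ↔ e ∈ c.1.1 := by simp [sumConfig]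

theorem inr_mem_sumConfig {c : S.Domain × T.Domain} {e : F} :
    Sum.inr e ∈ (S.sumConfig T c).1 ↔ e ∈ c.2.1 := by simp [sumConfig]

theorem sumConfig_le_iff (c d : S.Domain × T.Domain) :
    (S.sum T).DomainLE (S.sumConfig T c) (S.sumConfig T d) ↔ prodRel S.DomainLE T.DomainLE c d := by
  constructor
  · exact fun h => ⟨fun e he => (S.inl_mem_sumConfig T).1 (h ((S.inl_mem_sumConfig T).2 he)),
      fun e he => (S.inr_mem_sumConfig T).1 (h ((S.inr_mem_sumConfig T).2 he))⟩
  · exact fun h => Set.union_subset_union (Set.image_mono h.1) (Set.image_mono h.2)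

theorem sumConfig_surjective : Function.Surjective (S.sumConfig T) := by
  intro c
  refine ⟨⟨⟨Sum.inl ⁻¹' c.1, c.2.finite.preimage Sum.inl_injective.injOn,
    fun a ha b hb h => c.2.conflict_free _ ha _ hb (.inl h),
    fun a ha b h => c.2.down_closed _ ha _ (.inl h)⟩,
    ⟨Sum.inr ⁻¹' c.1, c.2.finite.preimage Sum.inr_injective.injOn,
    fun a ha b hb h => c.2.conflict_free _ ha _ hb (.inr h),
    fun a ha b h => c.2.down_closed _ ha _ (.inr h)⟩⟩, Subtype.ext ?_⟩
  ext (e | e)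
  · exact S.inl_mem_sumConfig T
  · exact S.inr_mem_sumConfig T

/-- The domain of `S.sum T` is the product of the domains. -/
noncomputable def sumDomainIso : prodRel S.DomainLE T.DomainLE ≃r (S.sum T).DomainLE :=
  relIsoOfSurjective (S.sumConfig T) (S.sumConfig_le_iff T)
    (fun _ => ⟨Set.Subset.rfl, Set.Subset.rfl⟩)
    (fun _ _ h h' => Prod.ext (S.domainLE_antisymm h.1 h'.1) (T.domainLE_antisymm h.2 h'.2))
    (S.sumConfig_surjective T)

variable (len : S.Domain → ℕ)

/-- Attach to every configuration `c` a chain of `len c` new events that are enabled one after the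
other at `c` and exclude all other events. -/
def attach : EventStructure (E ⊕ (Σ c : S.Domain, Fin (len c))) where
  le
    | .inl e, .inl e' => S.le e e'
    | .inl e, .inr t => e ∈ t.1.1
    | .inr _, .inl _ => False
    | .inr t, .inr t' => t.1 = t'.1 ∧ t.2.val ≤ t'.2.val
  le_refl e := by
    rcases e with e | e
    · exact S.le_refl e
    · exact ⟨rfl, le_rfl⟩
  le_trans := by
    rintro (a | a) (b | b) (c | c) h h'
    · exact S.le_trans _ _ _ h h'
    · exact c.1.2.down_closed _ h' _ h
    · exact h'.elim
    · exact show a ∈ c.1.1 from h'.1 ▸ h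
    · exact h.elim
    · exact h.elim
    · exact h'.elim
    · exact ⟨h.1.trans h'.1, h.2.trans h'.2⟩
  le_antisymm := by
    rintro (a | a) (b | b) h h'
    · exact congrArg _ (S.le_antisymm _ _ h h')
    · exact h'.elim
    · exact h.elim
    · obtain ⟨a, i⟩ := a
      obtain ⟨b, j⟩ := b
      obtain ⟨h1, h2⟩ := h
      dsimp only at h1 h2
      subst h1
      rw [Fin.ext (h2.antisymm h'.2)]
  conf
    | .inl e, .inl e' => S.conf e e'
    | .inl e, .inr t => e ∉ t.1.1
    | .inr t, .inl e => e ∉ t.1.1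
    | .inr t, .inr t' => t.1 ≠ t'.1
  conf_irrefl := by
    rintro (a | a) h
    · exact S.conf_irrefl _ h
    · exact h rfl
  conf_symm := by
    rintro (a | a) (b | b) h
    · exact S.conf_symm _ _ h
    · exact h
    · exact h
    · exact Ne.symm h
  finite_down := by
    rintro (a | ⟨c, k⟩)
    · refine ((S.finite_down a).image Sum.inl).subset ?_
      rintro (b | b) h
      · exact ⟨b, h, rfl⟩
      · exact h.elim
    · refine ((c.2.finite.image Sum.inl).union
        (Set.finite_range fun i : Fin (len c) => Sum.inr ⟨c, i⟩)).subset ?_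
      rintro (b | ⟨d, i⟩) h
      · exact Or.inl ⟨b, h, rfl⟩
      · obtain ⟨h1, h2⟩ := h
        dsimp only at h1
        subst h1
        exact Or.inr ⟨i, rfl⟩
  conf_inherit := by
    rintro (a | a) (b | b) (c | c) h h'
    · exact S.conf_inherit _ _ _ h h'
    · exact fun ha => c.1.2.conflict_free _ ha _ h' h
    · exact h'.elim
    · exact fun ha => h (by rw [h'.1]; exact ha)
    · exact fun hc => h (a.1.2.down_closed _ hc _ h')
    · exact fun hac => h (by rw [hac]; exact h')
    · exact h'.elim
    · exact fun hac => h (hac.trans h'.1.symm)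

/-- The configurations of `S.attach len`. -/
def attachConfig : S.Domain ⊕ (Σ c : S.Domain, Fin (len c)) → (S.attach len).Domain
  | .inl c => ⟨Sum.inl '' c.1, c.2.finite.image _, by
      rintro _ ⟨a, ha, rfl⟩ _ ⟨b, hb, rfl⟩ h
      exact c.2.conflict_free a ha b hb h, by
      rintro _ ⟨a, ha, rfl⟩ (b | b) h
      · exact ⟨b, c.2.down_closed a ha b h, rfl⟩
      · exact h.elim⟩
  | .inr t => (S.attach len).principal (.inr t)

theorem attachConfig_le_iff (c d : S.Domain ⊕ (Σ c : S.Domain, Fin (len c))) :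
    (S.attach len).DomainLE (S.attachConfig len c) (S.attachConfig len d) ↔
      tipRel S.DomainLE len c d := by
  rcases c with c | c
  · rcases d with d | d
    · exact Set.image_subset_image_iff Sum.inl_injective
    · constructor
      · exact fun h e he => h ⟨e, he, rfl⟩
      · rintro h _ ⟨e, he, rfl⟩
        exact h he
  · refine ((S.attach len).principal_le_iff _ _).trans ?_
    rcases d with d | d
    · exact ⟨fun ⟨_, _, h⟩ => (Sum.inl_ne_inr h).elim, fun h => False.elim h⟩
    · exact Iff.rfl

/-- A configuration with a tip event is the principal ideal of its highest tip event, because that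
event excludes everything outside its own base configuration and its own chain. A configuration
without tip events is a configuration of `S`. -/
theorem attachConfig_surjective : Function.Surjective (S.attachConfig len) := by
  intro X
  by_cases hX : ∃ t, Sum.inr t ∈ X.1
  · obtain ⟨m, hm, hmax⟩ := Set.exists_max_image (Sum.inr ⁻¹' X.1)
      (fun t : Σ c : S.Domain, Fin (len c) => t.2.val)
      (X.2.finite.preimage Sum.inr_injective.injOn) hX
    refine ⟨.inr m, Subtype.ext (Set.Subset.antisymm (fun x hx => X.2.down_closed _ hm x hx) ?_)⟩
    rintro (e | t) he
    · by_contra h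
      exact X.2.conflict_free _ he _ hm h
    · refine ⟨?_, hmax t he⟩
      by_contra h
      exact X.2.conflict_free _ he _ hm h
  · refine ⟨.inl ⟨Sum.inl ⁻¹' X.1, X.2.finite.preimage Sum.inl_injective.injOn,
      fun a ha b hb h => X.2.conflict_free _ ha _ hb h,
      fun a ha b h => X.2.down_closed _ ha _ h⟩, Subtype.ext ?_⟩
    ext (e | t)
    · exact ⟨fun ⟨_, h, h'⟩ => Sum.inl.inj h' ▸ h, fun h => ⟨e, h, rfl⟩⟩
    · exact ⟨fun ⟨_, _, h⟩ => (Sum.inl_ne_inr h).elim, fun h => (hX ⟨t, h⟩).elim⟩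

/-- The domain of `S.attach len` is the domain of `S` with chains attached. -/
noncomputable def attachDomainIso : tipRel S.DomainLE len ≃r (S.attach len).DomainLE :=
  relIsoOfSurjective (S.attachConfig len) (S.attachConfig_le_iff len)
    (by
      rintro (c | t)
      · exact Set.Subset.rfl
      · exact ⟨rfl, le_rfl⟩)
    (by
      rintro (c | ⟨c, k⟩) (d | ⟨d, l⟩) h h'
      · exact congrArg _ (S.domainLE_antisymm h h')
      · exact h'.elim
      · exact h.elim
      · obtain ⟨h1, h2⟩ := h
        dsimp only at h1 h2
        subst h1
        rw [Fin.ext (h2.antisymm h'.2)])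
    (S.attachConfig_surjective len)

end EventStructure

/-! ## Automata acting on free groups -/

namespace SquareAutomaton

variable {Q : Type u} {T : Type v} {L : Type w}

/-- Reading the letter `k` in the state `t`: the square with left side `t` and input `k`
determines the next state and the output letter. -/
noncomputable def stepPerm (l r : Q → T) (i o : Q → L) (hl : Function.Bijective fun s => (l s, i s))
    (hr : Function.Bijective fun s => (r s, i s)) (k : L) : Equiv.Perm (T × FreeGroup L) where
  toFun p := (r ((Equiv.ofBijective _ hl).symm (p.1, k)),
    p.2 * .of (o ((Equiv.ofBijective _ hl).symm (p.1, k))))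
  invFun p := (l ((Equiv.ofBijective _ hr).symm (p.1, k)),
    p.2 * (.of (o ((Equiv.ofBijective _ hr).symm (p.1, k))))⁻¹)
  left_inv p := by
    obtain ⟨t, g⟩ := p
    set s := (Equiv.ofBijective _ hl).symm (t, k) with hs
    have h1 : (l s, i s) = (t, k) := (Equiv.ofBijective _ hl).apply_symm_apply (t, k)
    have ht : l s = t := congrArg Prod.fst h1
    have hk : i s = k := congrArg Prod.snd h1
    have h2 : (Equiv.ofBijective _ hr).symm (r s, k) = s := by
      rw [Equiv.symm_apply_eq, ← hk]
      rfl
    dsimp only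
    rw [← hs, h2, mul_inv_cancel_right, ht]
  right_inv p := by
    obtain ⟨t, g⟩ := p
    set s := (Equiv.ofBijective _ hr).symm (t, k) with hs
    have h1 : (r s, i s) = (t, k) := (Equiv.ofBijective _ hr).apply_symm_apply (t, k)
    have ht : r s = t := congrArg Prod.fst h1
    have hk : i s = k := congrArg Prod.snd h1
    have h2 : (Equiv.ofBijective _ hl).symm (l s, k) = s := by
      rw [Equiv.symm_apply_eq, ← hk]
      rfl
    dsimp only
    rw [← hs, h2, inv_mul_cancel_right, ht]

variable (l r : Q → T) (i o : Q → L) (hl : Function.Bijective fun s => (l s, i s))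
  (hr : Function.Bijective fun s => (r s, i s))

theorem stepPerm_apply (s : Q) (g : FreeGroup L) :
    stepPerm l r i o hl hr (i s) (l s, g) = (r s, g * .of (o s)) := by
  have : (Equiv.ofBijective _ hl).symm (l s, i s) = s := (Equiv.ofBijective _ hl).symm_apply_apply s
  simp only [stepPerm, Equiv.coe_fn_mk, this]

theorem stepPerm_symm_apply (s : Q) (g : FreeGroup L) :
    (stepPerm l r i o hl hr (i s)).symm (r s, g) = (l s, g * (.of (o s))⁻¹) := by
  rw [Equiv.symm_apply_eq, stepPerm_apply, inv_mul_cancel_right]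

/-- Reading a word, from left to right, and appending the output. -/
noncomputable def read (w : FreeGroup L) : Equiv.Perm (T × FreeGroup L) :=
  (FreeGroup.lift (fun k => MulOpposite.op (stepPerm l r i o hl hr k)) w).unop

theorem read_one : read l r i o hl hr 1 = 1 := by simp [read]

theorem read_mul (w w' : FreeGroup L) (p : T × FreeGroup L) :
    read l r i o hl hr (w * w') p = read l r i o hl hr w' (read l r i o hl hr w p) := by
  simp [read]

theorem read_of (k : L) : read l r i o hl hr (.of k) = stepPerm l r i o hl hr k := by
  simp [read]

theorem read_of_inv (k : L) :
    read l r i o hl hr (.of k)⁻¹ = (stepPerm l r i o hl hr k).symm := by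
  simp [read]
  rfl

/-- Output is only ever appended on the right, so an initial output `g` stays as a left factor and
does not influence the states. This lets runs be composed. -/
theorem read_eq (w : FreeGroup L) : ∀ (t : T) (g : FreeGroup L), read l r i o hl hr w (t, g) =
    ((read l r i o hl hr w (t, 1)).1, g * (read l r i o hl hr w (t, 1)).2) := by
  induction w using FreeGroup.induction_on with
  | C1 => simp [read_one]
  | of k =>
    intro t g
    obtain ⟨s, hs⟩ := hl.2 (t, k)
    obtain ⟨rfl, rfl⟩ := Prod.ext_iff.1 hs
    simp only [read_of, stepPerm_apply, one_mul]
  | inv_of k _ =>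
    intro t g
    obtain ⟨s, hs⟩ := hr.2 (t, k)
    obtain ⟨rfl, rfl⟩ := Prod.ext_iff.1 hs
    simp only [read_of_inv, stepPerm_symm_apply, one_mul]
  | mul w w' ih ih' =>
    intro t g
    rw [read_mul, read_mul, ih t g, ih', ih' (read l r i o hl hr w (t, 1)).1
      (read l r i o hl hr w (t, 1)).2, mul_assoc]

variable (hl' : Function.Bijective fun s => (l s, o s))
  (hr' : Function.Bijective fun s => (r s, o s))

/-- A run is a strip of squares. The same strip, read with input and output sides exchanged, turns
the output back into the input and passes through the same states. -/
theorem read_read (w : FreeGroup L) : ∀ t : T,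
    read l r o i hl' hr' (read l r i o hl hr w (t, 1)).2 (t, 1) =
      ((read l r i o hl hr w (t, 1)).1, w) := by
  induction w using FreeGroup.induction_on with
  | C1 => simp [read_one]
  | of k =>
    intro t
    obtain ⟨s, hs⟩ := hl.2 (t, k)
    obtain ⟨rfl, rfl⟩ := Prod.ext_iff.1 hs
    simp only [read_of, stepPerm_apply, one_mul]
  | inv_of k _ =>
    intro t
    obtain ⟨s, hs⟩ := hr.2 (t, k)
    obtain ⟨rfl, rfl⟩ := Prod.ext_iff.1 hs
    simp only [read_of_inv, stepPerm_symm_apply, one_mul]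
  | mul w w' ih ih' =>
    intro t
    rw [read_mul, read_eq _ _ _ _ _ _ w' (read l r i o hl hr w (t, 1)).1, read_mul, ih,
      read_eq, ih']

/-- The states of a bireversible automaton act by permutations on the free group on the
letters. -/
theorem exists_perm (l r : Q → T) (i o : Q → L) (hl : Function.Bijective fun s => (l s, i s))
    (hr : Function.Bijective fun s => (r s, i s)) (hl' : Function.Bijective fun s => (l s, o s))
    (hr' : Function.Bijective fun s => (r s, o s)) :
    ∃ A : T → Equiv.Perm (FreeGroup L), (∀ t, A t 1 = 1) ∧
    ∀ s w, A (l s) (.of (i s) * w) = .of (o s) * A (r s) w := by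
  -- The permutation of `t` sends an input word to its output. Its inverse is the automaton with
  -- input and output letters exchanged.
  refine ⟨fun t => ⟨fun w => (read l r i o hl hr w (t, 1)).2,
    fun w => (read l r o i hl' hr' w (t, 1)).2, fun w => ?_, fun w => ?_⟩, fun t => ?_,
    fun s w => ?_⟩
  · exact congrArg Prod.snd (read_read l r i o hl hr hl' hr' w t)
  · exact congrArg Prod.snd (read_read l r o i hl' hr' hl hr w t)
  · simp [read_one]
  · simp only [Equiv.coe_fn_mk]
    rw [read_mul, read_of, stepPerm_apply, read_eq, one_mul]

end SquareAutomaton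

/-! ### Evaluating edge paths in a group, and lifting graphs to the cover -/

namespace DirectedSquareComplex

variable {Y : DirectedSquareComplex} {a : Y.V} {G : Type u} [Group G]

/-- The product of the values of the edges of a path. -/
def EdgePath.eval (val : Y.E → G) : ∀ {b : Y.V}, Y.EdgePath a b → G
  | _, .nil => 1
  | _, .fwd p e _ _ => p.eval val * val e
  | _, .bwd p e _ _ => p.eval val * (val e)⁻¹

variable (val : Y.E → G)

theorem Homotopic.eval_eq
    (hval : ∀ s, val (Y.bot s) * val (Y.right s) = val (Y.left s) * val (Y.top s)) {b : Y.V} {p q : Y.EdgePath a b} (h : Homotopic Y a p q) :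
    p.eval val = q.eval val := by
  induction h with
  | refl p => rfl
  | symm _ ih => exact ih.symm
  | trans _ _ ih ih' => exact ih.trans ih'
  | fwd e hs ht _ ih => simp only [EdgePath.eval, ih]
  | bwd e ht hs _ ih => simp only [EdgePath.eval, ih]
  | fwd_bwd p e hs ht => simp only [EdgePath.eval, mul_inv_cancel_right]
  | bwd_fwd p e ht hs => simp only [EdgePath.eval, inv_mul_cancel_right]
  | square p s h => simp only [EdgePath.eval, mul_assoc, hval]

variable (hval : ∀ s, val (Y.bot s) * val (Y.right s) = val (Y.left s) * val (Y.top s))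

/-- The product of the values of the edges of a path, as a function of its homotopy class. -/
def coverEval (x : Y.CoverVertex a) : G :=
  Quot.lift (fun p => p.eval val) (fun _ _ h => h.eval_eq val hval) x.2

theorem coverEval_coverStep (x : Y.CoverVertex a) (e : Y.E) (h : Y.src e = x.1) :
    coverEval val hval (Y.coverStep a x e h) = coverEval val hval x * val e := by
  obtain ⟨b, x⟩ := x
  induction x using Quot.ind with
  | mk p => rfl

open Classical in
/-- The end-point of the lift of `e` that starts at `x`, if there is one, and `x` otherwise. -/
noncomputable def liftStep (x : Y.CoverVertex a) (e : Y.E) : Y.CoverVertex a :=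
  if h : Y.src e = x.1 then Y.coverStep a x e h else x

theorem liftStep_eq {x : Y.CoverVertex a} {e : Y.E} (h : Y.src e = x.1) :
    liftStep x e = Y.coverStep a x e h := dif_pos h

theorem liftStep_fst {x : Y.CoverVertex a} {e : Y.E} (h : Y.src e = x.1) :
    (liftStep x e).1 = Y.tgt e := by
  rw [liftStep_eq h]
  rfl

theorem arc_liftStep {x : Y.CoverVertex a} {e : Y.E} (h : Y.src e = x.1) :
    (Y.universalCover a).Arc x (liftStep x e) :=
  universalCover_arc_iff.2 ⟨e, h, liftStep_eq h⟩

theorem coverEval_liftStep {x : Y.CoverVertex a} {e : Y.E} (h : Y.src e = x.1) :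
    coverEval val hval (liftStep x e) = coverEval val hval x * val e := by
  rw [liftStep_eq h, coverEval_coverStep]

/-- This allows the order of the two steps around a square to be changed inside constructions that
use the total function `liftStep`, without carrying proofs of incidence. -/
theorem liftStep_square {x : Y.CoverVertex a} (s : Y.S) (h : Y.src (Y.bot s) = x.1) :
    liftStep (liftStep x (Y.left s)) (Y.top s) = liftStep (liftStep x (Y.bot s)) (Y.right s) := by
  have h1 : Y.src (Y.left s) = x.1 := (Y.src_bot s).symm.trans h
  have h2 : Y.src (Y.top s) = (liftStep x (Y.left s)).1 := by
    rw [liftStep_fst h1, Y.tgt_left]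
  have h3 : Y.src (Y.right s) = (liftStep x (Y.bot s)).1 := by
    rw [liftStep_fst h, Y.tgt_bot]
  rw [liftStep_eq h2, liftStep_eq h3]
  simp only [liftStep_eq h, liftStep_eq h1]
  exact Y.coverStep_square a x s h _ _ _

/-- A graph with a map to the universal cover that lifts arcs uniquely is the filter of the image of
its root. -/
theorem nonempty_filter_of_lift {D : Type v} {arc : D → D → Prop} {x : Y.CoverVertex a} {d₀ : D}
    (F : D → Y.CoverVertex a) (h₀ : F d₀ = x) (hroot : ∀ d, ReflTransGen arc d₀ d)
    (hF : Function.Injective F) (harc : ∀ d d', arc d d' → (Y.universalCover a).Arc (F d) (F d'))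
    (hlift : ∀ d y, (Y.universalCover a).Arc (F d) y → ∃ d', arc d d' ∧ F d' = y) :
    Nonempty (ReflTransGen arc ≃r (Y.universalCover a).FilterLE x) := by
  have up : ∀ d d', ReflTransGen arc d d' → (Y.universalCover a).Prec (F d) (F d') :=
    fun d d' h => ReflTransGen.lift (p := (Y.universalCover a).Arc) F harc _ _ h
  have down : ∀ d y, (Y.universalCover a).Prec (F d) y → ∃ d', ReflTransGen arc d d' ∧ F d' = y := by
    intro d y h
    induction h with
    | refl => exact ⟨d, .refl, rfl⟩
    | tail _ h ih =>
      obtain ⟨d', hd', rfl⟩ := ih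
      obtain ⟨d'', hd'', rfl⟩ := hlift _ _ h
      exact ⟨d'', hd'.tail hd'', rfl⟩
  refine ⟨⟨Equiv.ofBijective (fun d => ⟨F d, h₀ ▸ up _ _ (hroot d)⟩) ⟨fun d d' h => ?_, ?_⟩, ?_⟩⟩
  · exact hF (congrArg Subtype.val h)
  · rintro ⟨y, hy⟩
    obtain ⟨d, -, hd⟩ := down d₀ y (h₀ ▸ hy)
    exact ⟨d, Subtype.ext hd⟩
  · intro d d'
    constructor
    · intro h
      obtain ⟨d'', h1, h2⟩ := down d (F d') h
      exact hF h2 ▸ h1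
    · exact up d d'

end DirectedSquareComplex

/-! ## The Wise quadrant -/

namespace Wise

/-- The colors of the vertical edges. -/
def vcol : Fin 3 → WiseColor := ![.a, .b, .c]

/-- The colors of the horizontal edges. -/
def hcol : Fin 2 → WiseColor := ![.x, .y]

/-- The right side of the square with given left side and bottom. -/
def next : Fin 3 → Fin 2 → Fin 3 := ![![1, 1], ![0, 2], ![2, 0]]

/-- The top of the square with given left side and bottom. -/
def out : Fin 3 → Fin 2 → Fin 2 := ![![0, 1], ![1, 0], ![1, 0]]

/-- The square with given left side and bottom. -/
def sq : Fin 3 → Fin 2 → Fin 6 := ![![0, 1], ![2, 3], ![4, 5]]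

theorem left_sq (t : Fin 3) (h : Fin 2) : wiseX.left (sq t h) = vcol t := by
  fin_cases t <;> fin_cases h <;> rfl

theorem bot_sq (t : Fin 3) (h : Fin 2) : wiseX.bot (sq t h) = hcol h := by
  fin_cases t <;> fin_cases h <;> rfl

theorem right_sq (t : Fin 3) (h : Fin 2) : wiseX.right (sq t h) = vcol (next t h) := by
  fin_cases t <;> fin_cases h <;> rfl

theorem top_sq (t : Fin 3) (h : Fin 2) : wiseX.top (sq t h) = hcol (out t h) := by
  fin_cases t <;> fin_cases h <;> rfl

theorem exists_sq (s : Fin 6) : ∃ t h, s = sq t h := by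
  revert s
  decide

theorem vcol_injective : Function.Injective vcol := by
  intro a b h
  fin_cases a <;> fin_cases b <;> first | rfl | cases h

theorem hcol_injective : Function.Injective hcol := by
  intro a b h
  fin_cases a <;> fin_cases b <;> first | rfl | cases h

theorem hcol_ne_vcol (h : Fin 2) (t : Fin 3) : hcol h ≠ vcol t := by
  intro hh
  fin_cases h <;> fin_cases t <;> cases hh

theorem exists_col (e : WiseColor) : (∃ h, e = hcol h) ∨ ∃ t, e = vcol t := by
  cases e
  · exact Or.inr ⟨0, rfl⟩
  · exact Or.inr ⟨1, rfl⟩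
  · exact Or.inr ⟨2, rfl⟩
  · exact Or.inl ⟨0, rfl⟩
  · exact Or.inl ⟨1, rfl⟩

/-! Words are written backwards: the head of a list is its last letter. -/

/-- The state reached from `t` after reading the word `u`. -/
def nextWord (t : Fin 3) : List (Fin 2) → Fin 3
  | [] => t
  | s :: u => next (nextWord t u) s

/-- The output of the state `t` on the word `u`. -/
def outWord (t : Fin 3) : List (Fin 2) → List (Fin 2)
  | [] => []
  | s :: u => out (nextWord t u) s :: outWord t u

/-- The top of the rectangle with bottom `u` and left side `v`. -/
def row (u : List (Fin 2)) : List (Fin 3) → List (Fin 2)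
  | [] => u
  | t :: v => outWord t (row u v)

/-- The last vertical edge of the right side of the rectangle with bottom `u` and left side `vt`. -/
def vert (u : List (Fin 2)) (v : List (Fin 3)) (t : Fin 3) : Fin 3 := nextWord t (row u v)

/-- The last edge of the top of the rectangle with bottom `us` and left side `v`. -/
def hor (u : List (Fin 2)) (s : Fin 2) : List (Fin 3) → Fin 2
  | [] => s
  | t :: v => out (vert u v t) (hor u s v)

theorem row_nil (v : List (Fin 3)) : row [] v = [] := by
  induction v with
  | nil => rfl
  | cons t v ih => simp only [row, ih, outWord]

theorem row_cons (u : List (Fin 2)) (s : Fin 2) (v : List (Fin 3)) :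
    row (s :: u) v = hor u s v :: row u v := by
  induction v with
  | nil => rfl
  | cons t v ih => simp only [row, ih, outWord, hor, vert]

theorem vert_nil (v : List (Fin 3)) (t : Fin 3) : vert [] v t = t := by
  simp only [vert, row_nil, nextWord]

theorem vert_cons (u : List (Fin 2)) (s : Fin 2) (v : List (Fin 3)) (t : Fin 3) :
    vert (s :: u) v t = next (vert u v t) (hor u s v) := by
  simp only [vert, row_cons, nextWord]

/-- Each state permutes the letters. So at every vertex of the quadrant the outgoing horizontal
edges carry each horizontal color exactly once, which is what unique lifting of edges needs. -/
theorem hor_bijective (u : List (Fin 2)) (v : List (Fin 3)) :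
    Function.Bijective fun s => hor u s v := by
  induction v with
  | nil => exact Function.bijective_id
  | cons t v ih =>
    have : ∀ t, Function.Bijective (out t) := by decide
    exact (this (vert u v t)).comp ih

/-- Dually, each letter permutes the states, so every vertical color leaves each vertex exactly
once. -/
theorem vert_bijective (u : List (Fin 2)) (v : List (Fin 3)) : Function.Bijective (vert u v) := by
  induction u with
  | nil =>
    rw [show vert [] v = id from funext (vert_nil v)]
    exact Function.bijective_id
  | cons s u ih =>
    have : ∀ h, Function.Bijective fun t => next t h := by decide
    rw [show vert (s :: u) v = (fun t => next t (hor u s v)) ∘ vert u v from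
      funext (vert_cons u s v)]
    exact (this _).comp ih

/-! ### The subdivided quadrant -/

/-- A vertex of the subdivided tree of words: `(u, none)` is the word `u`, and `(u, some s)` is the
midpoint of the edge from `u` to `us`. -/
abbrev Node (L : Type) := List L × Option L

/-- The subdivided tree of words. -/
def nodeTree (L : Type) : ParentTree (Node L) where
  root := ([], none)
  parent
    | (u, some _) => (u, none)
    | (s :: u, none) => (u, some s)
    | ([], none) => ([], none)
  depth
    | (u, some _) => 2 * u.length + 1
    | (u, none) => 2 * u.length
  depth_parent := by
    rintro ⟨_ | ⟨s, u⟩, _ | s⟩ h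
    · exact absurd rfl h
    · rfl
    · rfl
    · rfl

theorem arc_half {L : Type} (u : List L) (s : L) : (nodeTree L).arc (u, none) (u, some s) :=
  ⟨fun h => Option.some_ne_none s (congrArg Prod.snd h), rfl⟩

theorem arc_full {L : Type} (u : List L) (s : L) : (nodeTree L).arc (u, some s) (s :: u, none) :=
  ⟨fun h => List.cons_ne_nil s u (congrArg Prod.fst h), rfl⟩

theorem arc_cases {L : Type} {p q : Node L} (h : (nodeTree L).arc p q) :
    (∃ u s, p = (u, none) ∧ q = (u, some s)) ∨ ∃ u s, p = (u, some s) ∧ q = (s :: u, none) := by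
  obtain ⟨h1, rfl⟩ := h
  obtain ⟨_ | ⟨s, u⟩, _ | s⟩ := q
  · exact absurd rfl h1
  · exact Or.inl ⟨_, _, rfl, rfl⟩
  · exact Or.inr ⟨_, _, rfl, rfl⟩
  · exact Or.inl ⟨_, _, rfl, rfl⟩

/-- A vertex of the subdivided quadrant. -/
abbrev Point := Node (Fin 2) × Node (Fin 3)

/-- The image of a vertex of the quadrant. -/
def proj : Point → wiseX.BaryVertex
  | ((_, none), (_, none)) => .old ()
  | ((u, some s), (v, none)) => .mid (hcol (hor u s v))
  | ((u, none), (v, some t)) => .mid (vcol (vert u v t))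
  | ((u, some s), (v, some t)) => .center (sq (vert u v t) (hor u s v))

/-- The image of the horizontal edge that ends at a vertex of the quadrant. -/
def hedge : Node (Fin 2) → Node (Fin 3) → wiseX.BaryEdge
  | (u, some s), (v, none) => .fst (hcol (hor u s v))
  | (u, some s), (v, some t) => .leftToCenter (sq (vert u v t) (hor u s v))
  | (s :: u, none), (v, none) => .snd (hcol (hor u s v))
  | (s :: u, none), (v, some t) => .centerToRight (sq (vert u v t) (hor u s v))
  | ([], none), _ => .fst .x

/-- The image of the vertical edge that ends at a vertex of the quadrant. -/
def vedge : Node (Fin 2) → Node (Fin 3) → wiseX.BaryEdge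
  | (u, none), (v, some t) => .fst (vcol (vert u v t))
  | (u, some s), (v, some t) => .botToCenter (sq (vert u v t) (hor u s v))
  | (u, none), (t :: v, none) => .snd (vcol (vert u v t))
  | (u, some s), (t :: v, none) => .centerToTop (sq (vert u v t) (hor u s v))
  | _, ([], none) => .fst .x

theorem src_hedge {p p' : Node (Fin 2)} (q : Node (Fin 3)) (h : (nodeTree _).arc p p') :
    wiseX.barySubdivision.src (hedge p' q) = proj (p, q) := by
  obtain ⟨v, _ | t⟩ := q <;>
  rcases arc_cases h with ⟨u, s, rfl, rfl⟩ | ⟨u, s, rfl, rfl⟩ <;>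
  simp [hedge, proj, barySubdivision, left_sq]
  rfl

theorem tgt_hedge {p p' : Node (Fin 2)} (q : Node (Fin 3)) (h : (nodeTree _).arc p p') :
    wiseX.barySubdivision.tgt (hedge p' q) = proj (p', q) := by
  obtain ⟨v, _ | t⟩ := q <;>
  rcases arc_cases h with ⟨u, s, rfl, rfl⟩ | ⟨u, s, rfl, rfl⟩ <;>
  simp [hedge, proj, barySubdivision, right_sq, vert_cons]
  rfl

theorem src_vedge (p : Node (Fin 2)) {q q' : Node (Fin 3)} (h : (nodeTree _).arc q q') :
    wiseX.barySubdivision.src (vedge p q') = proj (p, q) := by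
  obtain ⟨u, _ | s⟩ := p <;>
  rcases arc_cases h with ⟨v, t, rfl, rfl⟩ | ⟨v, t, rfl, rfl⟩ <;>
  simp [vedge, proj, barySubdivision, bot_sq]
  rfl

theorem tgt_vedge (p : Node (Fin 2)) {q q' : Node (Fin 3)} (h : (nodeTree _).arc q q') :
    wiseX.barySubdivision.tgt (vedge p q') = proj (p, q') := by
  obtain ⟨u, _ | s⟩ := p <;>
  rcases arc_cases h with ⟨v, t, rfl, rfl⟩ | ⟨v, t, rfl, rfl⟩ <;>
  simp [vedge, proj, barySubdivision, top_sq, hor]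
  rfl

/-- Each cell of the subdivided quadrant is one quarter of a square of `wiseX`. The four
combinations of first and second half edges give the four quarters. -/
theorem exists_square {p p' : Node (Fin 2)} {q q' : Node (Fin 3)} (hp : (nodeTree _).arc p p')
    (hq : (nodeTree _).arc q q') : ∃ s, wiseX.barySubdivision.bot s = hedge p' q ∧
      wiseX.barySubdivision.left s = vedge p q' ∧ wiseX.barySubdivision.right s = vedge p' q' ∧
      wiseX.barySubdivision.top s = hedge p' q' := by
  rcases arc_cases hp with ⟨u, s, rfl, rfl⟩ | ⟨u, s, rfl, rfl⟩ <;>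
  rcases arc_cases hq with ⟨v, t, rfl, rfl⟩ | ⟨v, t, rfl, rfl⟩
  · refine ⟨.sw (sq (vert u v t) (hor u s v)), ?_⟩
    simp [hedge, vedge, barySubdivision, bot_sq, left_sq]
  · refine ⟨.nw (sq (vert u v t) (hor u s v)), ?_⟩
    simp [hedge, vedge, barySubdivision, top_sq, left_sq, hor]
  · refine ⟨.se (sq (vert u v t) (hor u s v)), ?_⟩
    simp [hedge, vedge, barySubdivision, bot_sq, right_sq, vert_cons]
  · refine ⟨.ne (sq (vert u v t) (hor u s v)), ?_⟩
    simp [hedge, vedge, barySubdivision, right_sq, top_sq, hor, vert_cons]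

/-- The arcs of the quadrant. -/
abbrev quadArc : Point → Point → Prop := prodArc (nodeTree (Fin 2)).arc (nodeTree (Fin 3)).arc

/-- Every edge of the subdivision lifts to the quadrant. -/
theorem exists_lift (p : Node (Fin 2)) (q : Node (Fin 3)) (e : wiseX.BaryEdge)
    (he : wiseX.barySubdivision.src e = proj (p, q)) :
    (∃ p', (nodeTree _).arc p p' ∧ e = hedge p' q) ∨ ∃ q', (nodeTree _).arc q q' ∧ e = vedge p q' := by
  obtain ⟨u, _ | s⟩ := p <;> obtain ⟨v, _ | t⟩ := q
  · cases e <;> simp [proj, barySubdivision] at he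
    rename_i e
    rcases exists_col e with ⟨h, rfl⟩ | ⟨t, rfl⟩
    -- The coordinate letter is a color on the bottom row, not the color seen at this height.
    -- Bijectivity finds the letter whose edge has the required color here.
    · obtain ⟨s, rfl⟩ := (hor_bijective u v).2 h
      exact Or.inl ⟨_, arc_half u s, rfl⟩
    · obtain ⟨t, rfl⟩ := (vert_bijective u v).2 t
      exact Or.inr ⟨_, arc_half v t, rfl⟩
  · cases e <;> simp [proj, barySubdivision] at he
    · obtain rfl := BaryVertex.mid.inj he
      exact Or.inr ⟨_, arc_full v t, rfl⟩
    · rename_i s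
      obtain ⟨t', h, rfl⟩ := exists_sq s
      replace he := BaryVertex.mid.inj he
      rw [bot_sq] at he
      -- The present point is the middle of a vertical edge, so no edge from the middle of a bottom
      -- side can start here.
      exact absurd he (hcol_ne_vcol _ _)
    · rename_i s
      obtain ⟨t', h, rfl⟩ := exists_sq s
      replace he := BaryVertex.mid.inj he
      rw [left_sq] at he
      obtain ⟨s, rfl⟩ := (hor_bijective u v).2 h
      obtain rfl := vcol_injective he
      exact Or.inl ⟨_, arc_half u s, rfl⟩
  · cases e <;> simp [proj, barySubdivision] at he
    · obtain rfl := BaryVertex.mid.inj he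
      exact Or.inl ⟨_, arc_full u s, rfl⟩
    · rename_i s'
      obtain ⟨t', h, rfl⟩ := exists_sq s'
      replace he := BaryVertex.mid.inj he
      rw [bot_sq] at he
      obtain ⟨t, rfl⟩ := (vert_bijective u v).2 t'
      obtain rfl := hcol_injective he
      exact Or.inr ⟨_, arc_half v t, rfl⟩
    · rename_i s'
      obtain ⟨t', h, rfl⟩ := exists_sq s'
      replace he := BaryVertex.mid.inj he
      rw [left_sq] at he
      exact absurd he.symm (hcol_ne_vcol _ _)
  · cases e <;> simp [proj, barySubdivision] at he
    · obtain rfl := BaryVertex.center.inj he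
      exact Or.inl ⟨_, arc_full u s, rfl⟩
    · obtain rfl := BaryVertex.center.inj he
      exact Or.inr ⟨_, arc_full v t, rfl⟩

end Wise

namespace Wise

variable (r : WiseColor → ℕ)

/-! ### The map to the universal cover -/

/-- The vertex of the universal cover above the last vertex of a horizontal word. -/
noncomputable def rowPos : List (Fin 2) → (wiseW r).CoverVertex (wiseBase r)
  | [] => coverBase _ _
  | s :: u => liftStep (liftStep (rowPos u) (.inl (hedge (u, some s) ([], none))))
      (.inl (hedge (s :: u, none) ([], none)))

/-- The vertex of the universal cover above a vertex at the bottom of the quadrant. -/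
noncomputable def basePos : Node (Fin 2) → (wiseW r).CoverVertex (wiseBase r)
  | (u, none) => rowPos r u
  | (u, some s) => liftStep (rowPos r u) (.inl (hedge (u, some s) ([], none)))

/-- The vertex of the universal cover that is reached after a vertical word. -/
noncomputable def colPos (p : Node (Fin 2)) : List (Fin 3) → (wiseW r).CoverVertex (wiseBase r)
  | [] => basePos r p
  | t :: v => liftStep (liftStep (colPos p v) (.inl (vedge p (v, some t))))
      (.inl (vedge p (t :: v, none)))

/-- The vertex of the universal cover above a vertex of the quadrant. -/
noncomputable def pos (p : Node (Fin 2)) : Node (Fin 3) → (wiseW r).CoverVertex (wiseBase r)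
  | (v, none) => colPos r p v
  | (v, some t) => liftStep (colPos r p v) (.inl (vedge p (v, some t)))

theorem pos_vertical (p : Node (Fin 2)) {q q' : Node (Fin 3)} (h : (nodeTree _).arc q q') :
    pos r p q' = liftStep (pos r p q) (.inl (vedge p q')) := by
  rcases arc_cases h with ⟨v, t, rfl, rfl⟩ | ⟨v, t, rfl, rfl⟩ <;> rfl

theorem pos_bottom {p p' : Node (Fin 2)} (h : (nodeTree _).arc p p') :
    pos r p' ([], none) = liftStep (pos r p ([], none)) (.inl (hedge p' ([], none))) := by
  rcases arc_cases h with ⟨v, t, rfl, rfl⟩ | ⟨v, t, rfl, rfl⟩ <;> rfl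

theorem pos_fst (p : Node (Fin 2)) (q : Node (Fin 3)) : (pos r p q).1 = .inl (proj (p, q)) := by
  induction q using (nodeTree _).induction with
  | hroot =>
    change (pos r p ([], none)).1 = .inl (proj (p, ([], none)))
    induction p using (nodeTree _).induction with
    | hroot => rfl
    | harc p p' h ih =>
      rw [pos_bottom r h]
      exact (liftStep_fst (x := pos r p ([], none)) (e := .inl (hedge p' ([], none)))
        ((congrArg Sum.inl (src_hedge _ h)).trans ih.symm)).trans
        (congrArg Sum.inl (tgt_hedge _ h))
  | harc q q' h ih =>
    rw [pos_vertical r p h]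
    exact (liftStep_fst (x := pos r p q) (e := .inl (vedge p q'))
      ((congrArg Sum.inl (src_vedge _ h)).trans ih.symm)).trans
      (congrArg Sum.inl (tgt_vedge _ h))

theorem src_hedge_pos {p p' : Node (Fin 2)} (q : Node (Fin 3)) (h : (nodeTree _).arc p p') :
    (wiseW r).src (.inl (hedge p' q)) = (pos r p q).1 := by
  rw [pos_fst, ← src_hedge q h]
  rfl

theorem src_vedge_pos (p : Node (Fin 2)) {q q' : Node (Fin 3)} (h : (nodeTree _).arc q q') :
    (wiseW r).src (.inl (vedge p q')) = (pos r p q).1 := by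
  rw [pos_fst, ← src_vedge p h]
  rfl

/-- Positions are built along the bottom and then upwards, so horizontal incidence holds by
construction only on the bottom row. It climbs one cell at a time because the two ways around a cell
are homotopic. -/
theorem pos_horizontal {p p' : Node (Fin 2)} (q : Node (Fin 3)) (h : (nodeTree _).arc p p') :
    pos r p' q = liftStep (pos r p q) (.inl (hedge p' q)) := by
  induction q using (nodeTree _).induction with
  | hroot => exact pos_bottom r h
  | harc q q' hq ih =>
    obtain ⟨s, hb, hl, hr, ht⟩ := exists_square h hq
    rw [pos_vertical r p' hq, pos_vertical r p hq, ih, ← hb, ← hl, ← hr, ← ht]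
    refine (liftStep_square (Y := wiseW r) s ?_).symm
    rw [← src_hedge_pos r q h, ← hb]
    rfl

/-- The number of new vertices attached to a vertex of the quadrant. -/
def tipLen (p : Point) : ℕ := wiseTipLength r (proj p)

/-- The filter of a vertex of the universal cover: the quadrant with tips. -/
abbrev Model : Type := Point ⊕ (Σ p : Point, Fin (tipLen r p))

/-- The arcs of the quadrant with tips. -/
abbrev modelArc : Model r → Model r → Prop := tipArc quadArc (tipLen r)

/-- The edge of `W` that ends at a vertex of a tip. -/
def tipEdge (p : Point) (k : ℕ) (hk : k < tipLen r p) : (wiseW r).E := .inr ⟨proj p, k, hk⟩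

/-- The vertex of the universal cover above a vertex of a tip. -/
noncomputable def tipPos (p : Point) :
    ∀ k : ℕ, k < tipLen r p → (wiseW r).CoverVertex (wiseBase r)
  | 0, hk => liftStep (pos r p.1 p.2) (tipEdge r p 0 hk)
  | k + 1, hk => liftStep (tipPos p k (Nat.lt_of_succ_lt hk)) (tipEdge r p (k + 1) hk)

theorem src_tipEdge_zero (p : Point) (hk : 0 < tipLen r p) :
    (wiseW r).src (tipEdge r p 0 hk) = (pos r p.1 p.2).1 := (pos_fst r p.1 p.2).symm

theorem tipPos_fst (p : Point) (k : ℕ) (hk : k < tipLen r p) :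
    (tipPos r p k hk).1 = .inr ⟨proj p, k, hk⟩ := by
  induction k with
  | zero =>
    rw [tipPos, liftStep_fst (src_tipEdge_zero r p hk)]
    rfl
  | succ k ih =>
    rw [tipPos, liftStep_fst]
    · rfl
    · rw [ih]
      rfl

theorem src_tipEdge_succ (p : Point) (k : ℕ) (hk : k + 1 < tipLen r p) :
    (wiseW r).src (tipEdge r p (k + 1) hk) = (tipPos r p k (Nat.lt_of_succ_lt hk)).1 :=
  (tipPos_fst r p k _).symm

/-- The vertex of the universal cover above a vertex of the quadrant with tips. -/
noncomputable def modelPos : Model r → (wiseW r).CoverVertex (wiseBase r)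
  | .inl p => pos r p.1 p.2
  | .inr ⟨p, k, hk⟩ => tipPos r p k hk

theorem arc_modelPos {d d' : Model r} (h : modelArc r d d') :
    (wiseCover r).Arc (modelPos r d) (modelPos r d') := by
  rcases d with ⟨p, q⟩ | ⟨p, k, hk⟩ <;> rcases d' with ⟨p', q'⟩ | ⟨p', k', hk'⟩
  · rcases h with ⟨h1, h2⟩ | ⟨h1, h2⟩
    · dsimp only at h1 h2
      subst h2
      rw [show modelPos r (.inl (p', q)) = _ from pos_horizontal r q h1]
      exact arc_liftStep (src_hedge_pos r q h1)
    · dsimp only at h1 h2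
      subst h1
      rw [show modelPos r (.inl (p, q')) = _ from pos_vertical r p h2]
      exact arc_liftStep (src_vedge_pos r p h2)
  · obtain ⟨h1, h2⟩ := h
    dsimp only at h1 h2
    subst h1 h2
    exact arc_liftStep (src_tipEdge_zero r _ hk')
  · exact h.elim
  · obtain ⟨h1, h2⟩ := h
    dsimp only at h1 h2
    subst h1 h2
    exact arc_liftStep (src_tipEdge_succ r p k hk')

theorem exists_arc_modelPos (d : Model r) (y : (wiseW r).CoverVertex (wiseBase r))
    (h : (wiseCover r).Arc (modelPos r d) y) : ∃ d', modelArc r d d' ∧ modelPos r d' = y := by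
  obtain ⟨e, he, rfl⟩ := universalCover_arc_iff.1 h
  rw [← liftStep_eq he]
  rcases d with ⟨p, q⟩ | ⟨p, k, hk⟩
  · rw [show (modelPos r (.inl (p, q))).1 = _ from pos_fst r p q] at he
    rcases e with e | ⟨x, _ | i, hi⟩
    · rcases exists_lift p q e (Sum.inl.inj he) with ⟨p', hp, rfl⟩ | ⟨q', hq, rfl⟩
      · exact ⟨.inl (p', q), Or.inl ⟨hp, rfl⟩, pos_horizontal r q hp⟩
      · exact ⟨.inl (p, q'), Or.inr ⟨rfl, hq⟩, pos_vertical r p hq⟩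
    · obtain rfl : x = proj (p, q) := Sum.inl.inj he
      exact ⟨.inr ⟨(p, q), 0, hi⟩, ⟨rfl, rfl⟩, rfl⟩
    · exact (Sum.inr_ne_inl he).elim
  · rw [show (modelPos r (.inr ⟨p, k, hk⟩)).1 = _ from tipPos_fst r p k hk] at he
    rcases e with e | ⟨x, _ | i, hi⟩
    · exact (Sum.inl_ne_inr he).elim
    · exact (Sum.inl_ne_inr he).elim
    · have he := Sum.inr.inj he
      obtain rfl : x = proj p := congrArg Sigma.fst he
      obtain rfl : i = k := congrArg (fun t => t.2.val) he
      exact ⟨.inr ⟨p, i + 1, hi⟩, ⟨rfl, rfl⟩, rfl⟩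

/-! ### Injectivity -/

/-- The group element spelled by a word. -/
def spell {L : Type} : List L → FreeGroup L
  | [] => 1
  | s :: u => spell u * .of s

theorem spell_eq {L : Type} (u : List L) :
    spell u = FreeGroup.mk (u.reverse.map fun s => (s, true)) := by
  induction u with
  | nil => rfl
  | cons s u ih =>
    rw [spell, ih, FreeGroup.of, FreeGroup.mul_mk, List.reverse_cons, List.map_append]
    rfl

/-- A word in positive letters has no cancellations, so it is the reduced form of the element that
it spells. -/
theorem spell_injective {L : Type} : Function.Injective (spell (L := L)) := by
  classical
  intro u u' h
  have hred : ∀ l : List L, FreeGroup.IsReduced (l.map fun s => (s, true)) := by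
    intro l
    rw [FreeGroup.IsReduced, List.isChain_map]
    induction l with
    | nil => exact .nil
    | cons a l ih =>
      cases l with
      | nil => exact .singleton a
      | cons b l => exact .cons_cons (fun _ => rfl) ih
  rw [spell_eq, spell_eq] at h
  have h' := congrArg FreeGroup.toWord h
  rw [FreeGroup.toWord_mk, FreeGroup.toWord_mk, (hred _).reduce_eq, (hred _).reduce_eq] at h'
  exact List.reverse_injective (List.map_injective_iff.2 (fun a b hab => congrArg Prod.fst hab) h')

/-- Any two adjacent sides determine a square, so the squares form a bireversible automaton in both
directions. Taking the top (respectively the right side) as input and the bottom (respectively the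
left side) as output gives the form in which the relation of a square becomes an equality of
composed permutations. -/
theorem exists_actions : ∃ (A : Fin 3 → Equiv.Perm (FreeGroup (Fin 2)))
    (B : Fin 2 → Equiv.Perm (FreeGroup (Fin 3))), (∀ t, A t 1 = 1) ∧ (∀ h, B h 1 = 1) ∧
    (∀ t h w, A t (.of (out t h) * w) = .of h * A (next t h) w) ∧
    ∀ t h w, B h (.of (next t h) * w) = .of t * B (out t h) w := by
  obtain ⟨A, hA, hA'⟩ := SquareAutomaton.exists_perm (Q := Fin 3 × Fin 2) Prod.fst
    (fun p => next p.1 p.2) (fun p => out p.1 p.2) Prod.snd (by decide) (by decide) (by decide)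
    (by decide)
  obtain ⟨B, hB, hB'⟩ := SquareAutomaton.exists_perm (Q := Fin 3 × Fin 2) Prod.snd
    (fun p => out p.1 p.2) (fun p => next p.1 p.2) Prod.fst (by decide) (by decide) (by decide)
    (by decide)
  exact ⟨A, B, hA, hB, fun t h w => hA' (t, h) w, fun t h w => hB' (t, h) w⟩

/-- On each free group, the letters of one kind act by left multiplication and those of the other
kind through the automaton. The recursion of the automaton is exactly the relation of a square, so
this represents the fundamental group. -/
theorem exists_values : ∃ (a : Fin 3 → Equiv.Perm (FreeGroup (Fin 2)) × Equiv.Perm (FreeGroup (Fin 3)))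
    (b : Fin 2 → Equiv.Perm (FreeGroup (Fin 2)) × Equiv.Perm (FreeGroup (Fin 3))),
    (∀ t h, b h * a (next t h) = a t * b (out t h)) ∧
    (∀ t, (a t).1 1 = 1) ∧ (∀ t w, (a t).2 w = .of t * w) ∧
    (∀ h, (b h).2 1 = 1) ∧ ∀ h w, (b h).1 w = .of h * w := by
  obtain ⟨A, B, hA, hB, hA', hB'⟩ := exists_actions
  refine ⟨fun t => (A t, Equiv.mulLeft (.of t)), fun h => (Equiv.mulLeft (.of h), B h), ?_, hA,
    fun _ _ => rfl, hB, fun _ _ => rfl⟩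
  intro t h
  refine Prod.ext (Equiv.ext fun w => ?_) (Equiv.ext fun w => ?_)
  · exact (hA' t h w).symm
  · exact hB' t h w

section Values

variable {G : Type} (a : Fin 3 → G) (b : Fin 2 → G)

/-- The value of an edge of Wise's complex. -/
def colorVal : WiseColor → G
  | .a => a 0
  | .b => a 1
  | .c => a 2
  | .x => b 0
  | .y => b 1

theorem colorVal_vcol (t : Fin 3) : colorVal a b (vcol t) = a t := by
  fin_cases t <;> rfl

theorem colorVal_hcol (h : Fin 2) : colorVal a b (hcol h) = b h := by
  fin_cases h <;> rfl

variable [Group G]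

/-- The value of an edge of `W`. -/
def edgeVal : (wiseW r).E → G
  | .inl (.snd e) => colorVal a b e
  | .inl (.centerToRight s) => colorVal a b (wiseX.bot s)
  | .inl (.centerToTop s) => colorVal a b (wiseX.left s)
  | .inl (.fst _) => 1
  | .inl (.botToCenter _) => 1
  | .inl (.leftToCenter _) => 1
  | .inr _ => 1

/-- The value of an edge is carried by its second half and by the parallel half-segment after a
center. Hence the three quarters other than the upper right one have trivial relations, and the
upper right one carries the relation of the whole square. -/
theorem edgeVal_square (hab : ∀ t h, b h * a (next t h) = a t * b (out t h)) (s : (wiseW r).S) :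
    edgeVal r a b ((wiseW r).bot s) * edgeVal r a b ((wiseW r).right s) =
      edgeVal r a b ((wiseW r).left s) * edgeVal r a b ((wiseW r).top s) := by
  rcases s with s | s | s | s
  · rfl
  · exact (mul_one (colorVal a b (wiseX.bot s))).trans (one_mul _).symm
  · exact (one_mul (colorVal a b (wiseX.left s))).trans (mul_one _).symm
  · obtain ⟨t, h, rfl⟩ := exists_sq s
    change colorVal a b _ * colorVal a b _ = colorVal a b _ * colorVal a b _
    rw [bot_sq, right_sq, left_sq, top_sq, colorVal_vcol, colorVal_vcol, colorVal_hcol,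
      colorVal_hcol, hab]

end Values

theorem proj_injective {u : List (Fin 2)} {v : List (Fin 3)} {o o₁ : Option (Fin 2)}
    {o' o₁' : Option (Fin 3)} (hp : proj ((u, o), (v, o')) = proj ((u, o₁), (v, o₁'))) :
    o = o₁ ∧ o' = o₁' := by
  have hh : ∀ {s s₁}, hcol (hor u s v) = hcol (hor u s₁ v) → s = s₁ :=
    fun h => (hor_bijective u v).1 (hcol_injective h)
  have hv : ∀ {t t₁}, vcol (vert u v t) = vcol (vert u v t₁) → t = t₁ :=
    fun h => (vert_bijective u v).1 (vcol_injective h)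
  rcases o with _ | s <;> rcases o' with _ | t <;> rcases o₁ with _ | s₁ <;>
    rcases o₁' with _ | t₁ <;> try first | exact ⟨rfl, rfl⟩ | cases hp
  · rw [hv (BaryVertex.mid.inj hp)]
    exact ⟨rfl, rfl⟩
  · exact absurd (BaryVertex.mid.inj hp).symm (hcol_ne_vcol _ _)
  · exact absurd (BaryVertex.mid.inj hp) (hcol_ne_vcol _ _)
  · rw [hh (BaryVertex.mid.inj hp)]
    exact ⟨rfl, rfl⟩
  · have h := BaryVertex.center.inj hp
    have h1 := congrArg wiseX.left h
    have h2 := congrArg wiseX.bot h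
    rw [left_sq, left_sq] at h1
    rw [bot_sq, bot_sq] at h2
    rw [hv h1, hh h2]
    exact ⟨rfl, rfl⟩

/-- Reach a point along the bottom and then upwards, evaluate, and apply the first component to 1:
vertical edges fix 1 and horizontal ones prepend their letters, so the result spells the horizontal
word. The path up the left side and then across gives the vertical word in the second component. The
covering projection then tells apart the points with the same words, and the position on a tip. -/
theorem modelPos_injective : Function.Injective (modelPos r) := by
  obtain ⟨a, b, hab, ha, ha', hb, hb'⟩ := exists_values
  let ev := coverEval (a := wiseBase r) _ (edgeVal_square r a b hab)
  have ev_base : ev (pos r ([], none) ([], none)) = 1 := rfl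
  have ev_v : ∀ (p : Node (Fin 2)) {q q' : Node (Fin 3)}, (nodeTree _).arc q q' →
      ev (pos r p q') = ev (pos r p q) * edgeVal r a b (.inl (vedge p q')) := by
    intro p q q' h
    rw [pos_vertical r p h]
    exact coverEval_liftStep _ _ (src_vedge_pos r p h)
  have ev_h : ∀ {p p' : Node (Fin 2)} (q : Node (Fin 3)), (nodeTree _).arc p p' →
      ev (pos r p' q) = ev (pos r p q) * edgeVal r a b (.inl (hedge p' q)) := by
    intro p p' q h
    rw [pos_horizontal r q h]
    exact coverEval_liftStep _ _ (src_hedge_pos r q h)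
  have fix_v : ∀ (p : Node (Fin 2)) {q q' : Node (Fin 3)}, (nodeTree _).arc q q' →
      (edgeVal r a b (.inl (vedge p q'))).1 1 = 1 := by
    intro p q q' h
    obtain ⟨u, _ | s⟩ := p <;> rcases arc_cases h with ⟨v, t, rfl, rfl⟩ | ⟨v, t, rfl, rfl⟩
    · rfl
    · simp only [vedge, edgeVal, colorVal_vcol, ha]
    · rfl
    · simp only [vedge, edgeVal, left_sq, colorVal_vcol, ha]
  have fix_h : ∀ {p p' : Node (Fin 2)} (q : Node (Fin 3)), (nodeTree _).arc p p' →
      (edgeVal r a b (.inl (hedge p' q))).2 1 = 1 := by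
    intro p p' q h
    obtain ⟨v, _ | t⟩ := q <;> rcases arc_cases h with ⟨u, s, rfl, rfl⟩ | ⟨u, s, rfl, rfl⟩
    · rfl
    · simp only [hedge, edgeVal, colorVal_hcol, hb]
    · rfl
    · simp only [hedge, edgeVal, bot_sq, colorVal_hcol, hb]
  have bottom : ∀ (p : Node (Fin 2)) w, (ev (pos r p ([], none))).1 w = spell p.1 * w := by
    intro p
    induction p using (nodeTree _).induction with
    | hroot =>
      intro w
      exact (one_mul w).symm
    | harc p p' h ih =>
      intro w
      rw [ev_h _ h, Prod.fst_mul, Equiv.Perm.mul_apply, ih]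
      rcases arc_cases h with ⟨u, s, rfl, rfl⟩ | ⟨u, s, rfl, rfl⟩
      · rfl
      · simp only [hedge, edgeVal, colorVal_hcol, hb', hor, spell, mul_assoc]
  have left : ∀ (q : Node (Fin 3)) w, (ev (pos r ([], none) q)).2 w = spell q.1 * w := by
    intro q
    induction q using (nodeTree _).induction with
    | hroot =>
      intro w
      exact (one_mul w).symm
    | harc q q' h ih =>
      intro w
      rw [ev_v _ h, Prod.snd_mul, Equiv.Perm.mul_apply, ih]
      rcases arc_cases h with ⟨v, t, rfl, rfl⟩ | ⟨v, t, rfl, rfl⟩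
      · rfl
      · simp only [vedge, edgeVal, colorVal_vcol, ha', vert_nil, spell, mul_assoc]
  have coord : ∀ p q, (ev (pos r p q)).1 1 = spell p.1 ∧ (ev (pos r p q)).2 1 = spell q.1 := by
    intro p q
    constructor
    · induction q using (nodeTree _).induction with
      | hroot => exact (bottom p 1).trans (mul_one _)
      | harc q q' h ih => rw [ev_v _ h, Prod.fst_mul, Equiv.Perm.mul_apply, fix_v p h, ih]
    · induction p using (nodeTree _).induction with
      | hroot => exact (left q 1).trans (mul_one _)
      | harc p p' h ih => rw [ev_h _ h, Prod.snd_mul, Equiv.Perm.mul_apply, fix_h q h, ih]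
  have key : ∀ p p' : Point, ev (pos r p.1 p.2) = ev (pos r p'.1 p'.2) → proj p = proj p' →
      p = p' := by
    rintro ⟨⟨u, o⟩, ⟨v, o'⟩⟩ ⟨⟨u₁, o₁⟩, ⟨v₁, o₁'⟩⟩ h hp
    obtain ⟨h1, h2⟩ := coord (u, o) (v, o')
    obtain ⟨h3, h4⟩ := coord (u₁, o₁) (v₁, o₁')
    obtain rfl : u = u₁ := spell_injective (h1.symm.trans ((by rw [h]) : _ = _) |>.trans h3)
    obtain rfl : v = v₁ := spell_injective (h2.symm.trans ((by rw [h]) : _ = _) |>.trans h4)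
    obtain ⟨rfl, rfl⟩ := proj_injective hp
    rfl
  have ev_tip : ∀ p k hk, ev (tipPos r p k hk) = ev (pos r p.1 p.2) := by
    intro p k hk
    induction k with
    | zero =>
      exact (coverEval_liftStep _ _ (src_tipEdge_zero r p hk)).trans (mul_one _)
    | succ k ih =>
      exact ((coverEval_liftStep _ _ (src_tipEdge_succ r p k hk)).trans (mul_one _)).trans (ih _)
  intro d d' h
  have h1 : (modelPos r d).1 = (modelPos r d').1 := by rw [h]
  have h2 : ev (modelPos r d) = ev (modelPos r d') := by rw [h]
  rcases d with ⟨p, q⟩ | ⟨p, k, hk⟩ <;> rcases d' with ⟨p', q'⟩ | ⟨p', k', hk'⟩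
  · rw [show (modelPos r (.inl (p, q))).1 = _ from pos_fst r p q,
      show (modelPos r (.inl (p', q'))).1 = _ from pos_fst r p' q'] at h1
    exact congrArg Sum.inl (key _ _ h2 (Sum.inl.inj h1))
  · rw [show (modelPos r (.inl (p, q))).1 = _ from pos_fst r p q,
      show (modelPos r (.inr ⟨p', k', hk'⟩)).1 = _ from tipPos_fst r p' k' hk'] at h1
    exact (Sum.inl_ne_inr h1).elim
  · rw [show (modelPos r (.inl (p', q'))).1 = _ from pos_fst r p' q',
      show (modelPos r (.inr ⟨p, k, hk⟩)).1 = _ from tipPos_fst r p k hk] at h1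
    exact (Sum.inr_ne_inl h1).elim
  · rw [show (modelPos r (.inr ⟨p, k, hk⟩)).1 = _ from tipPos_fst r p k hk,
      show (modelPos r (.inr ⟨p', k', hk'⟩)).1 = _ from tipPos_fst r p' k' hk'] at h1
    have h1 := Sum.inr.inj h1
    obtain rfl : k = k' := congrArg (fun t => t.2.val) h1
    obtain rfl := key p p' (((ev_tip p k hk).symm.trans h2).trans (ev_tip p' k hk'))
      (congrArg Sigma.fst h1)
    rfl

/-! ### The filters of the universal cover -/

theorem model_root_le (d : Model r) : ReflTransGen (modelArc r) (.inl (([], none), ([], none))) d := by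
  rw [reflTransGen_tipArc_iff]
  have : ∀ p : Point, ReflTransGen quadArc (([], none), ([], none)) p := fun p =>
    reflTransGen_prodArc_iff.2 ⟨(nodeTree _).root_le p.1, (nodeTree _).root_le p.2⟩
  rcases d with p | t
  · exact this p
  · exact this t.1

/-- The model is compared with the filter of the base vertex of the cover. Any other lift of the
vertex has an isomorphic filter. -/
theorem nonempty_model_iso (w : (wiseCover r).V) (hw : IsZeroVertex r w) :
    Nonempty (ReflTransGen (modelArc r) ≃r (wiseCover r).FilterLE w) := by
  obtain ⟨f⟩ := nonempty_filter_of_lift (x := coverBase (wiseW r) (wiseBase r)) (modelPos r) rfl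
    (model_root_le r) (modelPos_injective r) (fun d d' h => arc_modelPos r h)
    (exists_arc_modelPos r)
  obtain ⟨g⟩ := nonempty_filter_congr (x := coverBase (wiseW r) (wiseBase r)) (y := w) hw.symm
  exact ⟨f.trans g⟩

end Wise

/-- Isomorphic relations have isomorphic products. -/
def prodRelCongr {α α' : Type u} {β β' : Type v} {r : α → α → Prop} {r' : α' → α' → Prop}
    {s : β → β → Prop} {s' : β' → β' → Prop} (f : r ≃r r') (g : s ≃r s') :
    prodRel r s ≃r prodRel r' s' where
  toEquiv := Equiv.prodCongr f.toEquiv g.toEquiv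
  map_rel_iff' := and_congr f.map_rel_iff g.map_rel_iff

/-! ## Cliques -/

namespace EventStructure

theorem not_concurrent_tip {E : Type u} (S : EventStructure E) (len : S.Domain → ℕ)
    (t : Σ c : S.Domain, Fin (len c)) (e : E ⊕ (Σ c : S.Domain, Fin (len c))) :
    ¬ (S.attach len).Concurrent (.inr t) e := by
  rintro ⟨h1, h2, h3⟩
  rcases e with e | t'
  · exact h3 h2
  · have h : t.1 = t'.1 := not_not.1 h3
    rcases le_total t.2.val t'.2.val with h' | h'
    · exact h1 ⟨h, h'⟩
    · exact h2 ⟨h.symm, h'⟩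

theorem Concurrent.symm {E : Type u} {S : EventStructure E} {e e' : E} (h : S.Concurrent e e') :
    S.Concurrent e' e :=
  ⟨h.2.1, h.1, fun hc => h.2.2 (S.conf_symm _ _ hc)⟩

theorem MinConf.symm {E : Type u} {S : EventStructure E} {e e' : E} (h : S.MinConf e e') :
    S.MinConf e' e :=
  ⟨S.conf_symm _ _ h.1, fun ⟨a, h1, h2, h3⟩ => h.2 ⟨a, h2, h1, h3.symm⟩⟩

/-- Two tips in conflict sit at different configurations. An event belonging to only one of these is
a cause of one tip and in conflict with the other. -/
theorem not_minConf_tip {E : Type u} (S : EventStructure E) (len : S.Domain → ℕ)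
    (t t' : Σ c : S.Domain, Fin (len c)) : ¬ (S.attach len).MinConf (.inr t) (.inr t') := by
  rintro ⟨h1, h2⟩
  have : (∃ e ∈ t.1.1, e ∉ t'.1.1) ∨ ∃ e ∈ t'.1.1, e ∉ t.1.1 := by
    by_contra! h
    exact h1 (S.domainLE_antisymm h.1 h.2)
  rcases this with ⟨e, he, he'⟩ | ⟨e, he, he'⟩
  · exact h2 ⟨.inl e, Sum.inl_ne_inr, Sum.inl_ne_inr, Or.inl ⟨he, he'⟩⟩
  · exact h2 ⟨.inl e, Sum.inl_ne_inr, Sum.inl_ne_inr, Or.inr ⟨he, he'⟩⟩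

/-- A tip event is concurrent with nothing, so the first and the third clause fail, and minimal
conflict between tips is impossible. -/
theorem not_natural_tip {E : Type u} (S : EventStructure E) (len : S.Domain → ℕ)
    (t t' : Σ c : S.Domain, Fin (len c)) : ¬ (S.attach len).Natural (.inr t) (.inr t') := by
  rintro ⟨-, h | h | ⟨_, _, _, _, _, _, h, _⟩ | ⟨_, _, _, _, _, _, h, _⟩⟩
  · exact S.not_concurrent_tip len _ _ h
  · exact S.not_minConf_tip len _ _ h
  · exact S.not_concurrent_tip len _ _ h
  · exact S.not_concurrent_tip len _ _ h

end EventStructure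

namespace ParentTree

variable {T₁ : Type u} {T₂ : Type v}

theorem not_concurrent {T : Type u} (t : ParentTree T) (p q : {p // p ≠ t.root}) :
    ¬ t.eventStructure.Concurrent p q := fun h => h.2.2 ⟨h.1, h.2.1⟩

theorem le_parent_iff {T : Type u} (t : ParentTree T) {p q : T} (hq : q ≠ t.root) (hne : p ≠ q) :
    t.le p (t.parent q) ↔ t.le p q := by
  rw [t.le_iff_of_arc (⟨hq, rfl⟩ : t.arc (t.parent q) q)]
  exact ⟨Or.inr, fun h => h.resolve_left hne⟩

theorem parent_le {T : Type u} (t : ParentTree T) {p : T} (hp : p ≠ t.root) :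
    t.le (t.parent p) p := .single ⟨hp, rfl⟩

/-- Without witnesses against minimality, conflicting vertices are siblings. -/
theorem parent_le_parent {T : Type u} (t : ParentTree T) {p q : {p // p ≠ t.root}}
    (h : t.eventStructure.conf p q)
    (hmin : ¬ ∃ e, e ≠ p ∧ e ≠ q ∧ t.eventStructure.le e p ∧ t.eventStructure.conf e q) :
    t.le (t.parent p.1) (t.parent q.1) := by
  by_cases hp : t.parent p.1 = t.root
  · rw [hp]
    exact t.root_le _
  · have hpp := t.parent_le p.2
    have hq : t.parent p.1 ≠ q.1 := fun hh => h.2 (hh ▸ hpp)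
    rw [t.le_parent_iff q.2 hq]
    by_contra hle
    -- If the parent of `p` were not below that of `q`, it would be a cause of `p` already in
    -- conflict with `q`.
    refine hmin ⟨⟨t.parent p.1, hp⟩, fun hh => ?_, fun hh => hq (congrArg Subtype.val hh), hpp,
      hle, fun hqp => h.2 (hqp.trans hpp)⟩
    have h1 := t.depth_parent p.1 p.2
    have h2 : t.parent p.1 = p.1 := congrArg Subtype.val hh
    rw [h2] at h1
    omega

variable (t₁ : ParentTree T₁) (t₂ : ParentTree T₂)
  (len : (t₁.eventStructure.sum t₂.eventStructure).Domain → ℕ)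

/-- Events of one tree are never concurrent, and the third clause adds nothing: an event concurrent
with `p` must lie in the other tree, where it is not in conflict with `q`. Only minimal conflict
remains, and in a tree it relates siblings. -/
theorem parent_eq_of_natural_left {p q : {p // p ≠ t₁.root}}
    (h : ((t₁.eventStructure.sum t₂.eventStructure).attach len).Natural
      (.inl (.inl p)) (.inl (.inl q))) : t₁.parent p.1 = t₁.parent q.1 := by
  have nat3 : ∀ p q : {p // p ≠ t₁.root},
      ¬ ((t₁.eventStructure.sum t₂.eventStructure).attach len).Natural3
        (.inl (.inl p)) (.inl (.inl q)) := by
    rintro p q ⟨(e | e) | e, _, _, _, _, _, h1, h2⟩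
    · exact t₁.not_concurrent p e
        ⟨fun h => h1.1 (.inl h), fun h => h1.2.1 (.inl h), fun h => h1.2.2 (.inl h)⟩
    · cases h2.1
    · exact EventStructure.not_concurrent_tip _ len _ _ h1.symm
  have half : ∀ p q : {p // p ≠ t₁.root},
      ((t₁.eventStructure.sum t₂.eventStructure).attach len).MinConf
        (.inl (.inl p)) (.inl (.inl q)) → t₁.le (t₁.parent p.1) (t₁.parent q.1) := by
    rintro p q ⟨h1 | h1, h2⟩
    refine t₁.parent_le_parent h1 fun ⟨e, he1, he2, he3, he4⟩ => h2 ⟨.inl (.inl e), ?_, ?_,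
      Or.inl ⟨.inl he3, .inl he4⟩⟩
    · exact fun hh => he1 (Sum.inl.inj (Sum.inl.inj hh))
    · exact fun hh => he2 (Sum.inl.inj (Sum.inl.inj hh))
  rcases h.2 with h | h | h | h
  · exact (t₁.not_concurrent p q
      ⟨fun hh => h.1 (.inl hh), fun hh => h.2.1 (.inl hh), fun hh => h.2.2 (.inl hh)⟩).elim
  · exact t₁.le_antisymm (half p q h) (half q p h.symm)
  · exact (nat3 _ _ h).elim
  · exact (nat3 _ _ h).elim

theorem parent_eq_of_natural_right {p q : {p // p ≠ t₂.root}}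
    (h : ((t₁.eventStructure.sum t₂.eventStructure).attach len).Natural
      (.inl (.inr p)) (.inl (.inr q))) : t₂.parent p.1 = t₂.parent q.1 := by
  have nat3 : ∀ p q : {p // p ≠ t₂.root},
      ¬ ((t₁.eventStructure.sum t₂.eventStructure).attach len).Natural3
        (.inl (.inr p)) (.inl (.inr q)) := by
    rintro p q ⟨(e | e) | e, _, _, _, _, _, h1, h2⟩
    · cases h2.1
    · exact t₂.not_concurrent p e
        ⟨fun h => h1.1 (.inr h), fun h => h1.2.1 (.inr h), fun h => h1.2.2 (.inr h)⟩
    · exact EventStructure.not_concurrent_tip _ len _ _ h1.symm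
  have half : ∀ p q : {p // p ≠ t₂.root},
      ((t₁.eventStructure.sum t₂.eventStructure).attach len).MinConf
        (.inl (.inr p)) (.inl (.inr q)) → t₂.le (t₂.parent p.1) (t₂.parent q.1) := by
    rintro p q ⟨h1 | h1, h2⟩
    refine t₂.parent_le_parent h1 fun ⟨e, he1, he2, he3, he4⟩ => h2 ⟨.inl (.inr e), ?_, ?_,
      Or.inl ⟨.inr he3, .inr he4⟩⟩
    · exact fun hh => he1 (Sum.inr.inj (Sum.inl.inj hh))
    · exact fun hh => he2 (Sum.inr.inj (Sum.inl.inj hh))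
  rcases h.2 with h | h | h | h
  · exact (t₂.not_concurrent p q
      ⟨fun hh => h.1 (.inr hh), fun hh => h.2.1 (.inr hh), fun hh => h.2.2 (.inr hh)⟩).elim
  · exact t₂.le_antisymm (half p q h) (half q p h.symm)
  · exact (nat3 _ _ h).elim
  · exact (nat3 _ _ h).elim

/-- If the children of the vertices of the trees are told apart by keys, the number of keys bounds
the cliques. -/
theorem naturalCliquesLE {K₁ K₂ : Type} [Fintype K₁] [Fintype K₂] (k₁ : T₁ → K₁) (k₂ : T₂ → K₂)
    (h₁ : ∀ p q, p ≠ t₁.root → q ≠ t₁.root → t₁.parent p = t₁.parent q → k₁ p = k₁ q → p = q)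
    (h₂ : ∀ p q, p ≠ t₂.root → q ≠ t₂.root → t₂.parent p = t₂.parent q → k₂ p = k₂ q → p = q) :
    ((t₁.eventStructure.sum t₂.eventStructure).attach len).NaturalCliquesLE
      (Fintype.card K₁ + Fintype.card K₂ + 1) := by
  intro Q hQ
  let key : ({p // p ≠ t₁.root} ⊕ {p // p ≠ t₂.root}) ⊕ (Σ c, Fin (len c)) → (K₁ ⊕ K₂) ⊕ Unit :=
    Sum.map (Sum.map (fun p => k₁ p.1) fun p => k₂ p.1) fun _ => ()
  have hkey : Set.InjOn key Q := by
    intro e he e' he' h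
    by_contra hne
    have hn := hQ e he e' he' hne
    rcases e with (p | p) | t <;> rcases e' with (p' | p') | t' <;> try cases h
    · exact hne (congrArg (fun p => Sum.inl (Sum.inl p)) (Subtype.ext
        (h₁ _ _ p.2 p'.2 (t₁.parent_eq_of_natural_left t₂ len hn) (Sum.inl.inj (Sum.inl.inj h)))))
    · exact hne (congrArg (fun p => Sum.inl (Sum.inr p)) (Subtype.ext
        (h₂ _ _ p.2 p'.2 (t₁.parent_eq_of_natural_right t₂ len hn) (Sum.inr.inj (Sum.inl.inj h)))))
    · exact EventStructure.not_natural_tip _ len _ _ hn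
  rw [← hkey.encard_image]
  refine (Set.encard_le_encard (Set.subset_univ _)).trans ?_
  rw [Set.encard_univ, ENat.card_eq_coe_fintype_card]
  simp

end ParentTree

/-! ### The event structure of the quadrant with tips -/

namespace Wise

variable (r : WiseColor → ℕ)

/-- The event structure of the quadrant. -/
abbrev quadES := (nodeTree (Fin 2)).eventStructure.sum (nodeTree (Fin 3)).eventStructure

/-- The domain of the event structure of the quadrant. -/
noncomputable def quadIso :
    prodRel (nodeTree (Fin 2)).le (nodeTree (Fin 3)).le ≃r quadES.DomainLE :=
  (prodRelCongr (nodeTree _).domainIso (nodeTree _).domainIso).trans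
    (EventStructure.sumDomainIso _ _)

/-- The event structure of the quadrant with tips. -/
noncomputable abbrev modelES := quadES.attach (tipLen r ∘ quadIso.symm)

/-- The domain of the event structure of the quadrant with tips. -/
noncomputable def modelIso : ReflTransGen (modelArc r) ≃r (modelES r).DomainLE :=
  (RelIso.trans (s := tipRel (prodRel (nodeTree (Fin 2)).le (nodeTree (Fin 3)).le) (tipLen r))
    ⟨Equiv.refl _, by
      intro d d'
      rw [reflTransGen_tipArc_iff, show ReflTransGen quadArc = prodRel (nodeTree (Fin 2)).le
        (nodeTree (Fin 3)).le from funext fun p => funext fun q =>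
          propext reflTransGen_prodArc_iff]
      rfl⟩
    (tipRelCongr quadIso (tipLen r))).trans (quadES.attachDomainIso _)

/-- The last letter of a non-empty word, completing midpoints of edges. -/
def lastLetter {L : Type} [Inhabited L] : Node L → L
  | (_, some s) => s
  | (s :: _, none) => s
  | ([], none) => default

theorem eq_of_parent_eq {L : Type} [Inhabited L] (p q : Node L) (hp : p ≠ (nodeTree L).root)
    (hq : q ≠ (nodeTree L).root) (h : (nodeTree L).parent p = (nodeTree L).parent q)
    (h' : lastLetter p = lastLetter q) : p = q := by
  rcases arc_cases (⟨hp, rfl⟩ : (nodeTree L).arc _ p) with ⟨u, s, -, rfl⟩ | ⟨u, s, -, rfl⟩ <;>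
  rcases arc_cases (⟨hq, rfl⟩ : (nodeTree L).arc _ q) with ⟨v, t, -, rfl⟩ | ⟨v, t, -, rfl⟩
  · obtain rfl : u = v := congrArg Prod.fst h
    obtain rfl : s = t := h'
    rfl
  · cases congrArg Prod.snd h
  · cases congrArg Prod.snd h
  · obtain rfl : u = v := congrArg Prod.fst h
    obtain rfl : s = t := h'
    rfl

/-- Siblings are told apart by their last letters, of which there are two horizontal and three
vertical ones, and a clique has at most one tip. The bound obtained is 2 + 3 + 1 = 6. -/
theorem naturalCliquesLE_modelES : (modelES r).NaturalCliquesLE 11 := fun Q hQ =>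
  (ParentTree.naturalCliquesLE (nodeTree (Fin 2)) (nodeTree (Fin 3)) _ lastLetter lastLetter
    eq_of_parent_eq eq_of_parent_eq Q hQ).trans (by
      norm_num [Fintype.card_fin])

end Wise

/-! ## Finite labellings -/

/-- A labelling of the covering pairs of an order, with finitely many states `Q` of its elements:
the state determines the labels of the covers and their states, different covers have different
labels, and opposite sides of squares have the same label. -/
structure FiniteLabelling {α : Type u} (r : α → α → Prop) (Q : Type v) (Λ : Type w) where
  st : α → Q
  lab : α → α → Λ
  sim : ∀ p p' q, st p = st p' → Cov r p q → ∃ q', Cov r p' q' ∧ lab p' q' = lab p q ∧ st q' = st q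
  det : ∀ p q q', Cov r p q → Cov r p q' → lab p q = lab p q' → q = q'
  square : ∀ p q q' s, Cov r p q → Cov r p q' → q ≠ q' → Cov r q s → Cov r q' s →
    lab p q = lab q' s

/-- Transport of a labelling along an isomorphism. -/
def FiniteLabelling.map {α : Type u} {β : Type*} {r : α → α → Prop} {s : β → β → Prop} {Q : Type v}
    {Λ : Type w} (l : FiniteLabelling r Q Λ) (f : s ≃r r) : FiniteLabelling s Q Λ where
  st p := l.st (f p)
  lab p q := l.lab (f p) (f q)
  sim p p' q h hc := by
    obtain ⟨q', h1, h2, h3⟩ := l.sim _ _ _ h (hc.map f)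
    obtain ⟨q', rfl⟩ := f.surjective q'
    refine ⟨q', ?_, h2, h3⟩
    simpa using h1.map f.symm
  det p q q' h h' hl := f.injective (l.det _ _ _ (h.map f) (h'.map f) hl)
  square p q q' s h h' hne hs hs' := l.square _ _ _ _ (h.map f) (h'.map f)
    (fun hh => hne (f.injective hh)) (hs.map f) (hs'.map f)

/-! ### Trace automata -/

namespace TraceAutomaton

variable {Q A : Type} (M : TraceAutomaton Q A)

theorem run_append (q : Q) (w z : List A) : M.run q (w ++ z) = (M.run q w).bind fun s => M.run s z := by
  induction w generalizing q with
  | nil => rfl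
  | cons a w ih =>
    simp only [List.cons_append, run]
    cases M.step q a with
    | none => rfl
    | some s => exact ih s

/-- Both orders are computations, so both letters are enabled at the state before the exchange, and
the commutation axiom applies. -/
theorem Swap.run_eq {w w' : M.Computation} (h : M.Swap w w') :
    M.run M.init w.1 = M.run M.init w'.1 := by
  obtain ⟨x, y, a, b, hab, h1, h2⟩ := h
  have hw := w.2
  have hw' := w'.2
  rw [h1, run_append] at hw ⊢
  rw [h2, run_append] at hw' ⊢
  cases hq : M.run M.init x with
  | none => rfl
  | some q =>
    simp only [hq, Option.bind_some, run] at hw hw' ⊢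
    cases ha : M.step q a with
    | none => simp [ha] at hw
    | some s =>
      cases hb : M.step q b with
      | none => simp [hb] at hw'
      | some t =>
        obtain ⟨p, hp, hp'⟩ := M.commute a b q s t hab ha hb
        simp only [Option.bind_some, hp, hp']

/-- The state reached by a trace. -/
def traceState : M.Trace → Option Q :=
  Quot.lift (fun w => M.run M.init w.1) fun _ _ h => h.run_eq

open Classical in
/-- The number of occurrences of a letter in a trace. -/
noncomputable def traceCount (t : M.Trace) (a : A) : ℕ :=
  Quot.lift (fun w : M.Computation => w.1.count a) (fun w w' h => by
    obtain ⟨x, y, b, c, -, h1, h2⟩ := h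
    rw [h1, h2]
    exact ((List.Perm.swap c b y).append_left x).count_eq a) t

/-- The length of a trace. -/
def traceLength : M.Trace → ℕ :=
  Quot.lift (fun w => w.1.length) fun w w' h => by
    obtain ⟨x, y, b, c, -, h1, h2⟩ := h
    simp [h1, h2]

theorem extend_congr {w w' : M.Computation} (h : Quot.mk M.Swap w = Quot.mk M.Swap w') (a : A)
    (hw : (M.run M.init (w.1 ++ [a])).isSome) (hw' : (M.run M.init (w'.1 ++ [a])).isSome) :
    Quot.mk M.Swap ⟨w.1 ++ [a], hw⟩ = Quot.mk M.Swap ⟨w'.1 ++ [a], hw'⟩ := by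
  have h' := Quot.eqvGen_exact h
  clear h
  induction h' with
  | rel w w' h =>
    apply Quot.sound
    obtain ⟨x, y, b, c, hbc, h1, h2⟩ := h
    exact ⟨x, y ++ [a], b, c, hbc, by simp [h1], by simp [h2]⟩
  | refl w => rfl
  | symm w w' h ih => exact (ih hw' hw).symm
  | trans w w₁ w' h _ ih ih' =>
    have e1 := Quot.eqvGen_sound h
    have hs : M.run M.init w.1 = M.run M.init w₁.1 := congrArg M.traceState e1
    -- Equivalent computations end in the same state, so the intermediate one can also be extended
    -- by `a`.
    have hw₁ : (M.run M.init (w₁.1 ++ [a])).isSome := by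
      rw [run_append, ← hs, ← run_append]
      exact hw
    exact (ih hw hw₁).trans (ih' hw₁ hw')

theorem eq_of_traceLE {t t' : M.Trace} (h : M.TraceLE t t')
    (hl : M.traceLength t' ≤ M.traceLength t) : t = t' := by
  obtain ⟨w, w', rfl, rfl, h⟩ := h
  exact congrArg _ (Subtype.ext (h.eq_of_length_le hl))

theorem cov_extend (w : M.Computation) (a : A) (hw : (M.run M.init (w.1 ++ [a])).isSome) :
    Cov M.TraceLE (Quot.mk _ w) (Quot.mk _ ⟨w.1 ++ [a], hw⟩) := by
  have hlen : M.traceLength (Quot.mk _ ⟨w.1 ++ [a], hw⟩) = M.traceLength (Quot.mk _ w) + 1 :=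
    List.length_append
  refine ⟨⟨w, _, rfl, rfl, List.prefix_append _ _⟩, fun h => ?_, fun z h1 h2 => ?_⟩
  · rw [← h] at hlen
    omega
  · by_cases hz : M.traceLength z ≤ M.traceLength (Quot.mk _ w)
    · exact Or.inl (M.eq_of_traceLE h1 hz).symm
    · exact Or.inr (M.eq_of_traceLE h2 (by omega))

theorem exists_of_cov {t t' : M.Trace} (h : Cov M.TraceLE t t') :
    ∃ (w : M.Computation) (a : A) (hw : (M.run M.init (w.1 ++ [a])).isSome),
      t = Quot.mk _ w ∧ t' = Quot.mk _ ⟨w.1 ++ [a], hw⟩ := by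
  obtain ⟨⟨w, w', rfl, rfl, z, hz⟩, hne, hmin⟩ := h
  cases z with
  | nil => exact absurd (congrArg _ (Subtype.ext (by simpa using hz))) hne
  | cons a z =>
    have hw : (M.run M.init (w.1 ++ [a])).isSome := by
      have := w'.2
      rw [← hz, List.append_cons, run_append] at this
      exact Option.isSome_of_isSome_bind this
    refine ⟨w, a, hw, rfl, ?_⟩
    rcases hmin (Quot.mk _ ⟨w.1 ++ [a], hw⟩) (M.cov_extend w a hw).1
      ⟨_, w', rfl, rfl, z, by simp [← hz]⟩ with h | h
    · exact absurd h.symm (M.cov_extend w a hw).2.1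
    · exact h.symm

open Classical in
theorem traceCount_extend (w : M.Computation) (a : A)
    (hw : (M.run M.init (w.1 ++ [a])).isSome) (b : A) :
    M.traceCount (Quot.mk _ ⟨w.1 ++ [a], hw⟩) b =
      M.traceCount (Quot.mk _ w) b + if a = b then 1 else 0 := by
  change (w.1 ++ [a]).count b = w.1.count b + _
  rw [List.count_append, List.count_singleton]
  simp

/-- The labelling of the domain of a trace automaton: a covering pair is labelled with the letter
that is added. -/
noncomputable def finiteLabelling : FiniteLabelling M.TraceLE (Option Q) (A → ℤ) where
  st := M.traceState
  -- The difference of letter counts is defined for all pairs of traces and does not depend on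
  -- representatives. On a covering pair it is the indicator of the added letter.
  lab t t' a := M.traceCount t' a - M.traceCount t a
  sim p p' q h hc := by
    obtain ⟨w, a, hw, rfl, rfl⟩ := M.exists_of_cov hc
    induction p' using Quot.ind with
    | mk w' =>
      have hs : M.run M.init w.1 = M.run M.init w'.1 := h
      have hr : M.run M.init (w'.1 ++ [a]) = M.run M.init (w.1 ++ [a]) := by
        rw [run_append, ← hs, ← run_append]
      refine ⟨_, M.cov_extend w' a (hr ▸ hw), ?_, hr⟩
      funext b
      simp only [traceCount_extend]
      push_cast
      ring
  det p q q' h h' hl := by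
    obtain ⟨w, a, hw, rfl, rfl⟩ := M.exists_of_cov h
    obtain ⟨w', b, hw', hww, rfl⟩ := M.exists_of_cov h'
    have := congrFun hl a
    rw [hww] at this
    simp only [traceCount_extend, ← hww] at this
    have hab : b = a := by
      by_contra hne
      simp [hne] at this
    subst hab
    exact M.extend_congr hww b hw hw'
  square p q q' s h h' hne hs hs' := by
    obtain ⟨w₁, a, hw₁, h1, h2⟩ := M.exists_of_cov h
    obtain ⟨w₂, b, hw₂, h3, h4⟩ := M.exists_of_cov h'
    obtain ⟨w₃, c, hw₃, h5, h6⟩ := M.exists_of_cov hs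
    obtain ⟨w₄, d, hw₄, h7, h8⟩ := M.exists_of_cov hs'
    have k1 := fun e => h1 ▸ h2 ▸ M.traceCount_extend w₁ a hw₁ e
    have k2 := fun e => h3 ▸ h4 ▸ M.traceCount_extend w₂ b hw₂ e
    have k3 := fun e => h5 ▸ h6 ▸ M.traceCount_extend w₃ c hw₃ e
    have k4 := fun e => h7 ▸ h8 ▸ M.traceCount_extend w₄ d hw₄ e
    have hab : b ≠ a := by
      rintro rfl
      apply hne
      rw [h2, h4]
      exact M.extend_congr (h1.symm.trans h3) b _ _
    -- The two ways around the square add the same letters with multiplicity. Since `b ≠ a`, the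
    -- letter `a` must be the second one on the other way.
    have hda : d = a := by
      by_contra hda
      have e1 := k1 a
      have e2 := k2 a
      have e3 := k3 a
      have e4 := k4 a
      simp only [if_neg hab, if_neg hda, if_true] at e1 e2 e3 e4
      omega
    subst hda
    funext e
    have e1 := k1 e
    have e4 := k4 e
    omega

end TraceAutomaton

/-! ### Labelled event structures -/

namespace EventStructure

variable {E : Type u} (S : EventStructure E)

theorem cov_insert {c : S.Domain} {e : E} (he : e ∈ S.enabled c) :
    Cov S.DomainLE c ⟨insert e c.1, he.2⟩ := by
  refine ⟨Set.subset_insert _ _, fun h => ?_, fun z h1 h2 => ?_⟩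
  · exact he.1 (congrArg Subtype.val h ▸ Set.mem_insert e c.1)
  · by_cases hz : e ∈ z.1
    · exact Or.inr (S.domainLE_antisymm h2 (Set.insert_subset hz h1))
    · refine Or.inl (S.domainLE_antisymm (fun x hx => ?_) h1)
      rcases h2 hx with rfl | hx'
      · exact absurd hx hz
      · exact hx'

theorem exists_of_cov {c d : S.Domain} (h : Cov S.DomainLE c d) :
    ∃ e, ∃ he : e ∈ S.enabled c, d = ⟨insert e c.1, he.2⟩ := by
  obtain ⟨h1, h2, h3⟩ := h
  have hne : (d.1 \ c.1).Nonempty := by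
    by_contra hh
    exact h2 (S.domainLE_antisymm h1 (Set.sdiff_eq_empty.1 (Set.not_nonempty_iff_eq_empty.1 hh)))
  -- An event of the difference with the fewest causes has all its proper causes in `c`, so it is
  -- enabled at `c`.
  obtain ⟨e, he, hmin⟩ := Set.exists_min_image (d.1 \ c.1) (fun e => {x | S.le x e}.ncard)
    (d.2.finite.subset Set.sdiff_subset) hne
  have hen : e ∈ S.enabled c := by
    refine ⟨he.2, c.2.finite.insert e, ?_, ?_⟩
    · have hsub : insert e c.1 ⊆ d.1 := Set.insert_subset he.1 h1
      exact fun a ha b hb => d.2.conflict_free a (hsub ha) b (hsub hb)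
    · rintro a (rfl | ha) b hb
      · by_cases hba : b = a
        · exact Or.inl hba
        · refine Or.inr ?_
          by_contra hbc
          have hlt : {x | S.le x b}.ncard < {x | S.le x a}.ncard := by
            refine Set.ncard_lt_ncard ⟨fun x hx => S.le_trans _ _ _ hx hb, fun hh => hba ?_⟩
              (S.finite_down a)
            exact S.le_antisymm _ _ hb (hh (S.le_refl a))
          exact absurd (hmin b ⟨d.2.down_closed _ he.1 _ hb, hbc⟩) (not_le.2 hlt)
      · exact Or.inr (c.2.down_closed a ha b hb)
  refine ⟨e, hen, ?_⟩
  rcases h3 ⟨_, hen.2⟩ (Set.subset_insert _ _) (Set.insert_subset he.1 h1) with h | h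
  · exact absurd (congrArg Subtype.val h ▸ Set.mem_insert e c.1) he.2
  · exact h.symm

theorem insert_sdiff_self_of_enabled {c : S.Domain} {e : E} (he : e ∈ S.enabled c) :
    insert e c.1 \ c.1 = {e} := by
  rw [Set.insert_sdiff_of_notMem _ he.1, Set.sdiff_self, insert_empty_eq]

theorem mem_residualEvents_of_enabled {c : S.Domain} {e : E} (he : e ∈ S.enabled c) :
    e ∈ S.residualEvents c :=
  ⟨he.1, fun ⟨a, ha, h⟩ =>
    he.2.conflict_free a (Set.mem_insert_of_mem _ ha) e (Set.mem_insert _ _) h⟩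

theorem mem_residualEvents_insert {c : S.Domain} {e : E} (he : e ∈ S.enabled c) {x : E} :
    x ∈ S.residualEvents ⟨insert e c.1, he.2⟩ ↔
      x ∈ S.residualEvents c ∧ x ≠ e ∧ ¬ S.conf e x := by
  constructor
  · rintro ⟨h1, h2⟩
    exact ⟨⟨fun h => h1 (Or.inr h), fun ⟨a, ha, h⟩ => h2 ⟨a, Or.inr ha, h⟩⟩,
      fun h => h1 (Or.inl h), fun h => h2 ⟨e, Or.inl rfl, h⟩⟩
  · rintro ⟨⟨h1, h2⟩, h3, h4⟩
    refine ⟨fun h => h.elim h3 h1, ?_⟩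
    rintro ⟨a, rfl | ha, h⟩
    · exact h4 h
    · exact h2 ⟨a, ha, h⟩

variable {A : Type v} (lab : E → A)

/-- The residuals of two configurations are isomorphic as labelled event structures. -/
def LabelledIso (c c' : S.Domain) : Prop :=
  ∃ f : S.residualEvents c ≃ S.residualEvents c',
    IsIso (S.residual c) (S.residual c') f ∧ ∀ e, lab (f e).1 = lab e.1

theorem labelledIso_equivalence : Equivalence (S.LabelledIso lab) where
  refl c := ⟨Equiv.refl _, fun _ _ => ⟨Iff.rfl, Iff.rfl⟩, fun _ => rfl⟩
  symm := by
    rintro c c' ⟨f, hf, hl⟩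
    refine ⟨f.symm, hf.symm, fun e => ?_⟩
    rw [← hl, f.apply_symm_apply]
  trans := by
    rintro c c' c'' ⟨f, hf, hl⟩ ⟨g, hg, hl'⟩
    exact ⟨f.trans g, fun e e' => ⟨(hf e e').1.trans (hg _ _).1, (hf e e').2.trans (hg _ _).2⟩,
      fun e => (hl' _).trans (hl e)⟩

/-- Enabled events are the minimal events of the residual, so isomorphisms of residuals preserve
them. -/
theorem LabelledIso.enabled {S : EventStructure E} {c c' : S.Domain}
    {f : S.residualEvents c ≃ S.residualEvents c'}
    (hf : IsIso (S.residual c) (S.residual c') f) {e : S.residualEvents c}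
    (he : e.1 ∈ S.enabled c) : (f e).1 ∈ S.enabled c' := by
  refine ⟨(f e).2.1, c'.2.finite.insert _, ?_, ?_⟩
  · rintro a (rfl | ha) b (rfl | hb) h
    · exact S.conf_irrefl _ h
    · exact (f e).2.2 ⟨b, hb, S.conf_symm _ _ h⟩
    · exact (f e).2.2 ⟨a, ha, h⟩
    · exact c'.2.conflict_free a ha b hb h
  · rintro a (rfl | ha) b hb
    · by_cases hbc : b ∈ c'.1
      · exact Or.inr hbc
      · have hbr : b ∈ S.residualEvents c' :=
          ⟨hbc, fun ⟨a, ha, h⟩ => (f e).2.2 ⟨a, ha, S.conf_inherit _ _ _ h hb⟩⟩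
        obtain ⟨x, hx⟩ := f.surjective ⟨b, hbr⟩
        have hxe : S.le x.1 e.1 := (hf x e).1.2 (by rw [hx]; exact hb)
        rcases he.2.down_closed _ (Set.mem_insert _ _) _ hxe with h | h
        · refine Or.inl ?_
          rw [← Subtype.ext h, hx]
        · exact absurd h x.2.1
    · exact Or.inr (c'.2.down_closed a ha b hb)

/-- The residual after one more event consists of the events of the old residual that differ from it
and are not in conflict with it, so the isomorphism restricts. This makes isomorphism classes usable
as states. -/
theorem LabelledIso.extend {S : EventStructure E} {lab : E → A} {c c' : S.Domain}
    {f : S.residualEvents c ≃ S.residualEvents c'}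
    (hf : IsIso (S.residual c) (S.residual c') f) (hl : ∀ e, lab (f e).1 = lab e.1)
    {e : S.residualEvents c} (he : e.1 ∈ S.enabled c) (he' : (f e).1 ∈ S.enabled c') :
    S.LabelledIso lab ⟨insert e.1 c.1, he.2⟩ ⟨insert (f e).1 c'.1, he'.2⟩ := by
  have key : ∀ x : S.residualEvents c, x.1 ∈ S.residualEvents ⟨insert e.1 c.1, he.2⟩ ↔
      (f x).1 ∈ S.residualEvents ⟨insert (f e).1 c'.1, he'.2⟩ := by
    intro x
    rw [S.mem_residualEvents_insert he, S.mem_residualEvents_insert he']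
    refine and_congr (iff_of_true x.2 (f x).2) (and_congr (not_congr ?_) (not_congr (hf e x).2))
    rw [← Subtype.ext_iff, ← Subtype.ext_iff, f.injective.eq_iff]
  have sub : ∀ {d d' : S.Domain}, S.DomainLE d d' → S.residualEvents d' ⊆ S.residualEvents d :=
    fun h x hx => ⟨fun hh => hx.1 (h hh), fun ⟨a, ha, hh⟩ => hx.2 ⟨a, h ha, hh⟩⟩
  have s1 := sub (d := c) (d' := ⟨insert e.1 c.1, he.2⟩) (Set.subset_insert _ _)
  have s2 := sub (d := c') (d' := ⟨insert (f e).1 c'.1, he'.2⟩) (Set.subset_insert _ _)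
  refine ⟨⟨fun x => ⟨(f ⟨x.1, s1 x.2⟩).1, (key ⟨x.1, s1 x.2⟩).1 x.2⟩,
    fun y => ⟨(f.symm ⟨y.1, s2 y.2⟩).1, (key _).2 (by rw [f.apply_symm_apply]; exact y.2)⟩,
    fun x => ?_, fun y => ?_⟩, fun x y => hf ⟨x.1, s1 x.2⟩ ⟨y.1, s1 y.2⟩,
    fun x => hl ⟨x.1, s1 x.2⟩⟩
  · apply Subtype.ext
    simp
  · apply Subtype.ext
    simp

variable {A : Type} {lab : E → A}

/-- The labelling of the domain of a regular trace event structure. -/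
noncomputable def finiteLabelling {M : TraceAlphabet A} (hlab : S.IsTraceLabeling M lab) :
    FiniteLabelling S.DomainLE (Quotient ⟨_, S.labelledIso_equivalence lab⟩) (Set A) where
  st := Quotient.mk _
  lab c d := lab '' (d.1 \ c.1)
  sim c c' d h hc := by
    obtain ⟨f, hf, hl⟩ := Quotient.exact h
    obtain ⟨e, he, rfl⟩ := S.exists_of_cov hc
    let e₀ : S.residualEvents c := ⟨e, S.mem_residualEvents_of_enabled he⟩
    have he' : (f e₀).1 ∈ S.enabled c' := LabelledIso.enabled hf he
    refine ⟨_, S.cov_insert he', ?_, (Quotient.sound (LabelledIso.extend hf hl he he')).symm⟩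
    simp only [S.insert_sdiff_self_of_enabled he', S.insert_sdiff_self_of_enabled he,
      Set.image_singleton, hl, e₀]
  det c d d' h h' hl := by
    obtain ⟨e, he, rfl⟩ := S.exists_of_cov h
    obtain ⟨e', he', rfl⟩ := S.exists_of_cov h'
    simp only [S.insert_sdiff_self_of_enabled he', S.insert_sdiff_self_of_enabled he,
      Set.image_singleton, Set.singleton_eq_singleton_iff] at hl
    have below : ∀ {a x : E}, a ∈ S.enabled c → S.le x a → x ≠ a → x ∈ c.1 := by
      intro a x ha hx hne
      exact (ha.2.down_closed _ (Set.mem_insert _ _) _ hx).resolve_left hne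
    by_contra hne
    have hee : e ≠ e' := by
      rintro rfl
      exact hne rfl
    -- Equal labels are dependent, so `e` and `e'` are ordered or in conflict. Both are enabled at
    -- `c`, which excludes order and makes any conflict minimal, but events in minimal conflict have
    -- different labels.
    have hdep : ¬ M.indep (lab e) (lab e') := hl ▸ M.irrefl _
    rcases hlab.les3 e e' hdep with h1 | h1 | h1
    · exact he.1 (below he' h1 hee)
    · exact he'.1 (below he h1 hee.symm)
    · refine hlab.les1 e e' ⟨h1, ?_⟩ hl
      rintro ⟨x, h2, h3, ⟨h4, h5⟩ | ⟨h4, h5⟩⟩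
      · exact he'.2.conflict_free x (Or.inr (below he h4 h2)) e' (Or.inl rfl) h5
      · exact he.2.conflict_free x (Or.inr (below he' h4 h3)) e (Or.inl rfl) h5
  square p q q' s h h' hne hs hs' := by
    obtain ⟨e, he, rfl⟩ := S.exists_of_cov h
    obtain ⟨e', he', rfl⟩ := S.exists_of_cov h'
    obtain ⟨a, ha, rfl⟩ := S.exists_of_cov hs
    obtain ⟨b, hb, hab⟩ := S.exists_of_cov hs'
    have hee : e ≠ e' := by
      rintro rfl
      exact hne rfl
    have hab' := congrArg Subtype.val hab
    dsimp only at hab'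
    have heb : e = b := by
      have : e ∈ insert a (insert e p.1) := Or.inr (Or.inl rfl)
      rw [hab'] at this
      rcases this with h | h | h
      · exact h
      · exact absurd h hee
      · exact absurd h he.1
    subst heb
    rw [hab]
    exact congrArg _ ((S.insert_sdiff_self_of_enabled he).trans
      (S.insert_sdiff_self_of_enabled hb).symm)

theorem finite_quotient (h : S.LabeledFiniteIndex lab) :
    Finite (Quotient ⟨_, S.labelledIso_equivalence lab⟩) := by
  obtain ⟨R, hR, h⟩ := h
  have := hR.to_subtype
  refine Finite.of_surjective
    (fun c : R => Quotient.mk ⟨_, S.labelledIso_equivalence lab⟩ c.1) fun c => ?_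
  induction c using Quotient.ind with
  | _ c =>
    obtain ⟨c', hc', hh⟩ := h c
    exact ⟨⟨c', hc'⟩, (Quotient.sound hh).symm⟩

/-- The domains of recognizable and of regular trace event structures have finite labellings. -/
theorem exists_finiteLabelling (h : S.IsRegularTrace ∨ S.IsRecognizable) :
    ∃ (Q : Type u) (Λ : Type) (_ : Finite Q), Nonempty (FiniteLabelling S.DomainLE Q Λ) := by
  rcases h with ⟨A, _, _, M, lab, hlab, hfin⟩ | ⟨Q, A, _, _, M, ⟨f⟩⟩
  · exact ⟨_, _, S.finite_quotient hfin, ⟨S.finiteLabelling hlab⟩⟩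
  · obtain ⟨n, ⟨e⟩⟩ := Finite.exists_equiv_fin (Option Q)
    let l := M.finiteLabelling.map f.symm
    -- The states are lifted to the universe in which the isomorphism classes of residuals live, so
    -- that both cases have the same form.
    refine ⟨ULift (Option Q), A → ℤ, inferInstance, ⟨⟨fun p => ⟨l.st p⟩, l.lab, ?_, l.det, l.square⟩⟩⟩
    intro p p' q h hc
    obtain ⟨q', h1, h2, h3⟩ := l.sim p p' q (ULift.up_injective h) hc
    exact ⟨q', h1, h2, congrArg _ h3⟩

end EventStructure

/-! ## The action of the state `c` on words is transitive -/

namespace Wise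

/-- The action of the state `c` on words. -/
def turn (u : List (Fin 2)) : List (Fin 2) := outWord 2 u

/-- Whether a state changes the next letter. -/
def active : Fin 3 → Fin 2 := ![0, 1, 1]

theorem out_eq (t : Fin 3) (h : Fin 2) : out t h = h + active t := by
  revert t h
  decide

theorem iterate_turn_nil (j : ℕ) : turn^[j] [] = [] :=
  Function.iterate_fixed rfl j

/-- Modulo 2, the last letter is flipped once for each active state met while the rest of the word
runs through its orbit. -/
theorem iterate_turn_cons (j : ℕ) (s : Fin 2) (u : List (Fin 2)) :
    turn^[j] (s :: u) =
      (s + ∑ i ∈ Finset.range j, active (nextWord 2 (turn^[i] u))) :: turn^[j] u := by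
  induction j with
  | zero => simp
  | succ j ih =>
    rw [Function.iterate_succ_apply', Function.iterate_succ_apply', ih, turn, outWord, out_eq,
      Finset.sum_range_succ, add_assoc]
    rfl

/-- The words of a given length. -/
def words : ℕ → Finset (List (Fin 2))
  | 0 => {[]}
  | n + 1 => (Finset.univ ×ˢ words n).map
      ⟨fun p => p.1 :: p.2, fun _ _ h => Prod.ext (List.cons.inj h).1 (List.cons.inj h).2⟩

theorem mem_words {n : ℕ} {u : List (Fin 2)} : u ∈ words n ↔ u.length = n := by
  induction n generalizing u with
  | zero => simp [words]
  | succ n ih =>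
    rw [words, Finset.mem_map]
    constructor
    · rintro ⟨⟨s, u'⟩, h, rfl⟩
      exact congrArg Nat.succ (ih.1 (Finset.mem_product.1 h).2)
    · intro h
      rcases u with _ | ⟨s, u⟩
      · simp at h
      · exact ⟨(s, u), Finset.mem_product.2 ⟨Finset.mem_univ s, ih.2 (Nat.succ.inj h)⟩, rfl⟩

theorem card_words (n : ℕ) : (words n).card = 2 ^ n := by
  induction n with
  | zero => rfl
  | succ n ih => simp [words, ih, pow_succ']

/-- Modulo 2, the activities of the two successors of a state add up to the activity of the state.
The total over a level is thus independent of the level, and it is the activity 1 of `c` at the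
root. -/
theorem sum_active (n : ℕ) : ∑ u ∈ words n, active (nextWord 2 u) = 1 := by
  induction n with
  | zero => rfl
  | succ n ih =>
    have h : ∀ q, active (next q 0) + active (next q 1) = active q := by decide
    rw [words, Finset.sum_map, Finset.sum_product_right]
    refine (Finset.sum_congr rfl fun u _ => ?_).trans ih
    rw [Fin.sum_univ_two]
    exact h _

/-- By induction, the action on words of length `n` is a single cycle of length `2 ^ n`. Going once
around this cycle flips the next letter, because the total activity of the level is odd, so the
cycle doubles. -/
theorem turn_transitive (n : ℕ) : (∀ u : List (Fin 2), u.length = n → turn^[2 ^ n] u = u) ∧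
    ∀ u u' : List (Fin 2), u.length = n → u'.length = n → ∃ j < 2 ^ n, turn^[j] u = u' := by
  induction n with
  | zero =>
    simp only [List.length_eq_zero_iff]
    refine ⟨?_, ?_⟩
    · rintro u rfl
      exact iterate_turn_nil _
    · rintro u u' rfl rfl
      exact ⟨0, by norm_num, rfl⟩
  | succ n ih =>
    obtain ⟨ih1, ih2⟩ := ih
    -- By transitivity, `2 ^ n` iterates visit all `2 ^ n` words, each exactly once, so the sum
    -- along the orbit is the sum over the level.
    have hsum : ∀ u : List (Fin 2), u.length = n →
        ∑ i ∈ Finset.range (2 ^ n), active (nextWord 2 (turn^[i] u)) = 1 := by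
      intro u hu
      have himage : (Finset.range (2 ^ n)).image (fun i => turn^[i] u) ⊇ words n := by
        intro u' hu'
        obtain ⟨j, hj, rfl⟩ := ih2 u u' hu (mem_words.1 hu')
        exact Finset.mem_image.2 ⟨j, Finset.mem_range.2 hj, rfl⟩
      have hcard : ((Finset.range (2 ^ n)).image fun i => turn^[i] u).card = 2 ^ n :=
        le_antisymm (Finset.card_image_le.trans (Finset.card_range _).le)
          ((card_words n).symm.le.trans (Finset.card_le_card himage))
      have hinj : Set.InjOn (fun i => turn^[i] u) (Finset.range (2 ^ n)) :=
        Finset.card_image_iff.1 (hcard.trans (Finset.card_range _).symm)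
      have heq := Finset.eq_of_subset_of_card_le himage (hcard.trans (card_words n).symm).le
      rw [← sum_active n, heq, Finset.sum_image hinj]
    have hflip : ∀ (s : Fin 2) (u : List (Fin 2)), u.length = n →
        turn^[2 ^ n] (s :: u) = (s + 1) :: u := by
      intro s u hu
      rw [iterate_turn_cons, hsum u hu, ih1 u hu]
    have hadd : ∀ s : Fin 2, s + 1 + 1 = s := by decide
    have hne : ∀ s s' : Fin 2, s ≠ s' → s + 1 = s' := by decide
    have hpow : 2 ^ (n + 1) = 2 ^ n + 2 ^ n := by ring
    constructor
    · rintro (_ | ⟨s, u⟩) hu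
      · simp at hu
      · have hu : u.length = n := by simpa using hu
        rw [hpow, Function.iterate_add_apply, hflip _ _ hu, hflip _ _ hu, hadd]
    · rintro (_ | ⟨s, u⟩) (_ | ⟨s', u'⟩) hu hu'
      · simp at hu
      · simp at hu
      · simp at hu'
      · have hu : u.length = n := by simpa using hu
        have hu' : u'.length = n := by simpa using hu'
        obtain ⟨j, hj, hju⟩ := ih2 u u' hu hu'
        have hcons := iterate_turn_cons j s u
        rw [hju] at hcons
        by_cases hs : s + ∑ i ∈ Finset.range j, active (nextWord 2 (turn^[i] u)) = s'
        · exact ⟨j, by omega, hcons.trans (by rw [hs])⟩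
        · refine ⟨2 ^ n + j, by omega, ?_⟩
          rw [Function.iterate_add_apply, hcons, hflip _ _ hu', hne _ _ hs]

theorem row_replicate (u : List (Fin 2)) (j : ℕ) : row u (List.replicate j 2) = turn^[j] u := by
  induction j with
  | zero => rfl
  | succ j ih =>
    rw [Function.iterate_succ_apply', ← ih]
    rfl

theorem hor_of_row_eq_replicate {v : List (Fin 3)} {n : ℕ}
    (h : row (List.replicate n 0) v = List.replicate n 0) {i : ℕ} (hi : i < n) :
    hor (List.replicate i 0) 0 v = 0 := by
  induction n with
  | zero => exact absurd hi (Nat.not_lt_zero i)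
  | succ n ih =>
    rw [List.replicate_succ, row_cons] at h
    obtain ⟨h1, h2⟩ := List.cons.inj h
    rcases Nat.lt_succ_iff_lt_or_eq.1 hi with hi | rfl
    · exact ih h2 hi
    · exact h1

/-- The rows above `x^∞` along `c^∞` have no common eventual period. -/
theorem exists_row_not_periodic (i p : ℕ) (hp : 0 < p) :
    ∃ j, hor (List.replicate i 0) 0 (List.replicate j 2) ≠
      hor (List.replicate (i + p) 0) 0 (List.replicate j 2) := by
  -- Choose the height at which the row above `x^(i+p+1)` reads `x^(i+p) y`. Positions `i` and `i +
  -- p` then differ.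
  obtain ⟨j, -, hj⟩ := (turn_transitive (i + p + 1)).2 (List.replicate (i + p + 1) 0)
    (1 :: List.replicate (i + p) 0) (by simp) (by simp)
  rw [← row_replicate, List.replicate_succ, row_cons] at hj
  obtain ⟨h1, h2⟩ := List.cons.inj hj
  refine ⟨j, ?_⟩
  rw [h1, hor_of_row_eq_replicate h2 (by omega)]
  decide

end Wise

/-! ## The quadrant with tips has no finite labelling -/

section

variable {α : Type u} (r : α → α → Prop)

/-- There is a chain of `n` covering pairs above `p`. -/
def Deep : ℕ → α → Prop
  | 0, _ => True
  | n + 1, p => ∃ q, Cov r p q ∧ Deep n q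

/-- Some cover of `p` is the bottom of chains with exactly `L` elements. -/
def HasTip (L : ℕ) (p : α) : Prop := ∃ t, Cov r p t ∧ ∀ n, Deep r n t ↔ n < L

end

namespace FiniteLabelling

variable {α : Type u} {r : α → α → Prop} {Q : Type v} {Λ : Type w} (l : FiniteLabelling r Q Λ)

theorem deep_congr {n : ℕ} {p p' : α} (h : l.st p = l.st p') (hp : Deep r n p) : Deep r n p' := by
  induction n generalizing p p' with
  | zero => trivial
  | succ n ih =>
    obtain ⟨q, hq, hn⟩ := hp
    obtain ⟨q', hq', -, hst⟩ := l.sim p p' q h hq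
    exact ⟨q', hq', ih hst.symm hn⟩

/-- The lengths of tips are expressed by covering pairs alone, so a state determines them. -/
theorem hasTip_congr {L : ℕ} {p p' : α} (h : l.st p = l.st p') (hp : HasTip r L p) :
    HasTip r L p' := by
  obtain ⟨q, hq, hn⟩ := hp
  obtain ⟨q', hq', -, hst⟩ := l.sim p p' q h hq
  exact ⟨q', hq', fun n => ⟨fun hd => (hn n).1 (l.deep_congr hst hd),
    fun hd => l.deep_congr hst.symm ((hn n).2 hd)⟩⟩

/-- State and label together act as a deterministic automaton: simulation provides a successor with
the right state, and determinism identifies it with the given one. -/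
theorem st_congr {p p' q q' : α} (h : l.st p = l.st p') (hq : Cov r p q) (hq' : Cov r p' q')
    (hlab : l.lab p q = l.lab p' q') : l.st q = l.st q' := by
  obtain ⟨z, hz, hz', hst⟩ := l.sim p p' q h hq
  rw [l.det p' z q' hz hq' (hz'.trans hlab)] at hst
  exact hst.symm

end FiniteLabelling

/-! ### Reading colors from tips, and the contradiction with periodicity -/

namespace Wise

variable (r : WiseColor → ℕ)

/-- The distance from the root. -/
def modelRank : Model r → ℕ
  | .inl p => (nodeTree _).depth p.1 + (nodeTree _).depth p.2
  | .inr t => (nodeTree _).depth t.1.1 + (nodeTree _).depth t.1.2 + t.2 + 1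

theorem modelRank_arc (d d' : Model r) (h : modelArc r d d') :
    modelRank r d' = modelRank r d + 1 := by
  rcases d with d | d <;> rcases d' with d' | d'
  · rcases h with ⟨h1, h2⟩ | ⟨h1, h2⟩
    · rw [modelRank, modelRank, ← h2, (nodeTree _).depth_arc _ _ h1]
      omega
    · rw [modelRank, modelRank, ← h1, (nodeTree _).depth_arc _ _ h2]
      omega
  · rw [modelRank, modelRank, h.2, ← h.1]
  · exact h.elim
  · rw [modelRank, modelRank, h.2, ← h.1]
    omega

/-- The order of the quadrant with tips. -/
abbrev modelLE : Model r → Model r → Prop := ReflTransGen (modelArc r)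

theorem cov_iff {d d' : Model r} : Cov (modelLE r) d d' ↔ modelArc r d d' :=
  cov_reflTransGen_iff (modelRank_arc r)

theorem cov_horizontal {p p' : Node (Fin 2)} (h : (nodeTree _).arc p p') (q : Node (Fin 3)) :
    Cov (modelLE r) (.inl (p, q)) (.inl (p', q)) :=
  (cov_iff r).2 (Or.inl ⟨h, rfl⟩)

theorem cov_vertical (p : Node (Fin 2)) {q q' : Node (Fin 3)} (h : (nodeTree _).arc q q') :
    Cov (modelLE r) (.inl (p, q)) (.inl (p, q')) :=
  (cov_iff r).2 (Or.inr ⟨rfl, h⟩)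

theorem deep_inl (n : ℕ) (p : Point) : Deep (modelLE r) n (.inl p) := by
  induction n generalizing p with
  | zero => trivial
  | succ n ih =>
    obtain ⟨⟨u, _ | s⟩, q⟩ := p
    · exact ⟨.inl ((u, some 0), q), cov_horizontal r (arc_half u 0) q, ih _⟩
    · exact ⟨.inl ((s :: u, none), q), cov_horizontal r (arc_full u s) q, ih _⟩

theorem deep_inr (n : ℕ) (p : Point) (k : ℕ) (hk : k < tipLen r p) :
    Deep (modelLE r) n (.inr ⟨p, k, hk⟩) ↔ n + k < tipLen r p := by
  induction n generalizing k with
  | zero => simpa [Deep] using hk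
  | succ n ih =>
    constructor
    · rintro ⟨q | ⟨p', k', hk'⟩, hq, hn⟩
      · exact ((cov_iff r).1 hq).elim
      · obtain ⟨h1, h2⟩ := (cov_iff r).1 hq
        dsimp only at h1 h2
        subst h1 h2
        have := (ih _ hk').1 hn
        omega
    · intro h
      exact ⟨.inr ⟨p, k + 1, by omega⟩, (cov_iff r).2 ⟨rfl, rfl⟩, (ih _ _).2 (by omega)⟩

/-- Points of the quadrant have arbitrarily long chains above them, so a cover with bounded chains
is the start of the attached tip, and the bound is the length of that tip. -/
theorem hasTip_inl {L : ℕ} {p : Point} (h : HasTip (modelLE r) L (.inl p)) :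
    L = tipLen r p := by
  obtain ⟨t | ⟨p', k, hk⟩, h1, h2⟩ := h
  · exact absurd ((h2 L).1 (deep_inl r L t)) (lt_irrefl L)
  · obtain ⟨h3, h4⟩ := (cov_iff r).1 h1
    dsimp only at h3 h4
    subst h3 h4
    have h5 := fun n => (h2 n).symm.trans (deep_inr r n p 0 hk)
    have h6 := h5 L
    have h7 := h5 (tipLen r p)
    omega

theorem hasTip_tipLen {p : Point} (h : 0 < tipLen r p) :
    HasTip (modelLE r) (tipLen r p) (.inl p) :=
  ⟨.inr ⟨p, 0, h⟩, (cov_iff r).2 ⟨rfl, rfl⟩, fun n => deep_inr r n p 0 h⟩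

/-- The element has covers with the tips of the colors `x` and `y`. -/
def IsFork (d : Model r) : Prop :=
  ∃ z z', Cov (modelLE r) d z ∧ Cov (modelLE r) d z' ∧ HasTip (modelLE r) (r .x) z ∧
    HasTip (modelLE r) (r .y) z'

variable {r}

theorem isFork_old (hpos : ∀ e, 0 < r e) (u : List (Fin 2)) (v : List (Fin 3)) :
    IsFork r (.inl ((u, none), (v, none))) := by
  obtain ⟨s, hs⟩ := (hor_bijective u v).2 0
  obtain ⟨s', hs'⟩ := (hor_bijective u v).2 1
  have key : ∀ s, HasTip (modelLE r) (r (hcol (hor u s v))) (.inl ((u, some s), (v, none))) :=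
    fun s => hasTip_tipLen r (p := ((u, some s), (v, none))) (hpos _)
  have k1 := key s
  have k2 := key s'
  rw [show hor u s v = 0 from hs] at k1
  rw [show hor u s' v = 1 from hs'] at k2
  exact ⟨_, _, cov_horizontal r (arc_half u s) _, cov_horizontal r (arc_half u s') _, k1, k2⟩

/-- At the middle of a horizontal edge, the possible covers are the end of the edge, the center of a
square, and the start of the tip. The covers of a center are the middles of one vertical and one
horizontal edge, and a point on a tip has at most one cover. Neither can show the tips of both `x`
and `y`. -/
theorem eq_of_isFork (hinj : Function.Injective r) {u : List (Fin 2)} {s : Fin 2}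
    {v : List (Fin 3)} {d : Model r} (hd : Cov (modelLE r) (.inl ((u, some s), (v, none))) d)
    (hf : IsFork r d) : d = .inl ((s :: u, none), (v, none)) := by
  obtain ⟨z, z', hz, hz', ht, ht'⟩ := hf
  rw [cov_iff] at hd hz hz'
  rcases d with ⟨p, q⟩ | ⟨p, k, hk⟩
  · rcases hd with ⟨h1, h2⟩ | ⟨h1, h2⟩
    · dsimp only at h1 h2
      subst h2
      rcases arc_cases h1 with ⟨u', s', h3, rfl⟩ | ⟨u', s', h3, rfl⟩
      · cases h3
      · cases h3
        rfl
    · exfalso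
      dsimp only at h1 h2
      subst h1
      rcases arc_cases h2 with ⟨v', t, h3, rfl⟩ | ⟨v', t, h3, rfl⟩
      · cases h3
        have key : ∀ (e : WiseColor) (z : Model r),
            modelArc r (.inl ((u, some s), (v, some t))) z → (∀ t, e ≠ vcol t) →
            HasTip (modelLE r) (r e) z → e = hcol (hor u s (t :: v)) := by
          rintro e (⟨p, q⟩ | ⟨p, k, hk⟩) hz he ht
          · have hL := hasTip_inl r ht
            rcases hz with ⟨h1, h2⟩ | ⟨h1, h2⟩
            · dsimp only at h1 h2
              subst h2
              rcases arc_cases h1 with ⟨u', s', h3, rfl⟩ | ⟨u', s', h3, rfl⟩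
              · cases h3
              · cases h3
                exact absurd (hinj hL) (he _)
            · dsimp only at h1 h2
              subst h1
              rcases arc_cases h2 with ⟨v', t', h3, rfl⟩ | ⟨v', t', h3, rfl⟩
              · cases h3
              · cases h3
                exact hinj hL
          · obtain ⟨h1, -⟩ := hz
            dsimp only at h1
            subst h1
            exact absurd hk (Nat.not_lt_zero k)
        have e1 := key .x z hz (fun t => hcol_ne_vcol 0 t) ht
        have e2 := key .y z' hz' (fun t => hcol_ne_vcol 1 t) ht'
        cases e1.trans e2.symm
      · cases h3
  · exfalso
    rcases z with z | ⟨p₁, k₁, hk₁⟩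
    · exact hz
    rcases z' with z' | ⟨p₂, k₂, hk₂⟩
    · exact hz'
    obtain ⟨h1, h2⟩ := hz
    obtain ⟨h3, h4⟩ := hz'
    dsimp only at h1 h2 h3 h4
    subst h1 h2 h3 h4
    obtain ⟨a, ha, ha'⟩ := ht
    obtain ⟨b, hb, hb'⟩ := ht'
    rw [cov_iff] at ha hb
    rcases a with a | ⟨p₁, k₁, hk₁⟩
    · exact ha
    rcases b with b | ⟨p₂, k₂, hk₂⟩
    · exact hb
    obtain ⟨h1, h2⟩ := ha
    obtain ⟨h3, h4⟩ := hb
    dsimp only at h1 h2 h3 h4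
    subst h1 h2 h3 h4
    have h5 := fun n => (ha' n).symm.trans (hb' n)
    have h6 := h5 (r .x)
    have h7 := h5 (r .y)
    have h8 : r .x = r .y := by omega
    cases hinj h8

section

variable {Q : Type u} {Λ : Type v} (l : FiniteLabelling (modelLE r) Q Λ)

/-- Opposite sides of squares have equal labels, so a label is carried up the column from the bottom
row. -/
theorem lab_row {p p' : Node (Fin 2)} (h : (nodeTree _).arc p p') (q : Node (Fin 3)) :
    l.lab (.inl (p, q)) (.inl (p', q)) =
      l.lab (.inl (p, ([], none))) (.inl (p', ([], none))) := by
  induction q using (nodeTree _).induction with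
  | hroot => rfl
  | harc q q' hq ih =>
    rw [← ih]
    refine (l.square _ _ (.inl (p, q')) _ (cov_horizontal r h q)
      (cov_vertical r p hq) (fun hh => ?_) (cov_vertical r p' hq) (cov_horizontal r h q')).symm
    have h1 : p' = p := congrArg Prod.fst (Sum.inl.inj hh)
    have h2 := (nodeTree _).depth_arc _ _ h
    rw [h1] at h2
    omega

/-- The vertices of the quadrant spanned by `x^∞` and `c^∞`. -/
def oldPt (i j : ℕ) : Model r := .inl ((List.replicate i 0, none), (List.replicate j 2, none))

/-- The midpoints of the horizontal edges of the quadrant spanned by `x^∞` and `c^∞`. -/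
def midPt (i j : ℕ) : Model r := .inl ((List.replicate i 0, some 0), (List.replicate j 2, none))

theorem cov_old_mid (i j : ℕ) : Cov (modelLE r) (oldPt i j) (midPt i j) :=
  cov_horizontal r (arc_half _ _) _

theorem cov_mid_old (i j : ℕ) : Cov (modelLE r) (midPt i j) (oldPt (i + 1) j) :=
  cov_horizontal r (arc_full (List.replicate i 0) 0) _

/-- The labels of two edges at the bottom agree, and so do those of their halves. -/
def SameLabels (i i' : ℕ) : Prop :=
  l.lab (oldPt i 0) (midPt i 0) = l.lab (oldPt i' 0) (midPt i' 0) ∧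
    l.lab (midPt i 0) (oldPt (i + 1) 0) = l.lab (midPt i' 0) (oldPt (i' + 1) 0)

theorem SameLabels.st_mid {i i' j j' : ℕ} (h : SameLabels l i i')
    (hst : l.st (oldPt i j) = l.st (oldPt i' j')) : l.st (midPt i j) = l.st (midPt i' j') :=
  l.st_congr hst (cov_old_mid i j) (cov_old_mid i' j')
    (((lab_row l (arc_half _ _) _).trans h.1).trans (lab_row l (arc_half _ _) _).symm)

/-- Labels that agree on the bottom agree at every height, so equality of states at any two heights
`j`, `j'` moves one edge to the right. -/
theorem SameLabels.st_old {i i' j j' : ℕ} (h : SameLabels l i i')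
    (hst : l.st (oldPt i j) = l.st (oldPt i' j')) :
    l.st (oldPt (i + 1) j) = l.st (oldPt (i' + 1) j') :=
  l.st_congr (h.st_mid l hst) (cov_mid_old i j) (cov_mid_old i' j')
    (((lab_row l (arc_full _ _) _).trans h.2).trans (lab_row l (arc_full _ _) _).symm)

/-- A state does not know which continuation is `x`, but its tips do. The simulated first half must
end at a point with a tip of length `r x`, hence at the middle of the `x`-edge. The simulated second
half must end at a fork, hence at the next vertex and not at a center or on the tip. -/
theorem sameLabels_of_st (hpos : ∀ e, 0 < r e) (hinj : Function.Injective r) {i i' : ℕ}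
    (h : l.st (oldPt i 0) = l.st (oldPt i' 0)) : SameLabels l i i' := by
  obtain ⟨q, hq, hlab, hst⟩ := l.sim _ _ _ h (cov_old_mid i 0)
  have hqm : q = midPt i' 0 := by
    have ht : HasTip (modelLE r) (r .x) q :=
      l.hasTip_congr hst.symm (hasTip_tipLen r (p := ((List.replicate i 0, some 0), ([], none)))
        (hpos .x))
    rw [cov_iff] at hq
    rcases q with ⟨p, q⟩ | ⟨p, k, hk⟩
    · have hL := hasTip_inl r ht
      rcases hq with ⟨h1, h2⟩ | ⟨h1, h2⟩
      · dsimp only at h1 h2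
        subst h2
        rcases arc_cases h1 with ⟨u, s, h3, rfl⟩ | ⟨u, s, h3, rfl⟩
        · cases h3
          have : (0 : Fin 2) = s := hcol_injective (hinj hL)
          subst this
          rfl
        · cases h3
      · dsimp only at h1 h2
        subst h1
        rcases arc_cases h2 with ⟨v, t, h3, rfl⟩ | ⟨v, t, h3, rfl⟩
        · exact absurd (hinj hL) (hcol_ne_vcol 0 _)
        · cases h3
    · obtain ⟨h1, -⟩ := hq
      dsimp only at h1
      subst h1
      exact absurd hk (Nat.not_lt_zero k)
  subst hqm
  obtain ⟨q, hq, hlab', hst'⟩ := l.sim _ _ _ hst.symm (cov_mid_old i 0)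
  have hfork : IsFork r q := by
    obtain ⟨z, z', hz, hz', ht, ht'⟩ := isFork_old hpos (List.replicate (i + 1) 0) []
    obtain ⟨y, hy, -, hyst⟩ := l.sim _ _ _ hst'.symm hz
    obtain ⟨y', hy', -, hyst'⟩ := l.sim _ _ _ hst'.symm hz'
    exact ⟨y, y', hy, hy', l.hasTip_congr hyst.symm ht, l.hasTip_congr hyst'.symm ht'⟩
  have hqo : q = oldPt (i' + 1) 0 := eq_of_isFork hinj hq hfork
  subst hqo
  exact ⟨hlab.symm, hlab'.symm⟩

/-- A repeated state makes the bottom labels periodic. These labels drive every other row, whose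
states then become periodic too, within a range and with a period that depend only on the number of
states. The colors of all rows would have a common eventual period, which the action of `c` forbids.
-/
theorem false_of_finiteLabelling [Finite Q] (hpos : ∀ e, 0 < r e) (hinj : Function.Injective r)
    (l : FiniteLabelling (modelLE r) Q Λ) : False := by
  obtain ⟨i₀, i₁, hne, h01⟩ := Finite.exists_ne_map_eq_of_infinite fun i => l.st (oldPt i 0)
  wlog hlt : i₀ < i₁ generalizing i₀ i₁
  · exact this i₁ i₀ hne.symm h01.symm (by omega)
  -- The period of the bottom row is `p + 1`.
  obtain ⟨p, rfl⟩ := Nat.exists_eq_add_of_lt hlt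
  have hbot : ∀ k, l.st (oldPt (i₀ + k) 0) = l.st (oldPt (i₀ + (p + 1) + k) 0) := by
    intro k
    induction k with
    | zero => exact h01
    | succ k ih => exact (sameLabels_of_st l hpos hinj ih).st_old l ih
  have hlab : ∀ m i, i₀ ≤ i → SameLabels l i (i + m * (p + 1)) := by
    intro m i hi
    obtain ⟨k, rfl⟩ := Nat.exists_eq_add_of_le hi
    apply sameLabels_of_st l hpos hinj
    induction m with
    | zero => simp
    | succ m ih =>
      rw [ih]
      convert hbot (k + m * (p + 1)) using 3 <;> ring
  let N := Nat.card Q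
  have hrow : ∀ j i, i₀ + N * (p + 1) ≤ i →
      l.st (oldPt i j) = l.st (oldPt (i + N.factorial * (p + 1)) j) := by
    intro j
    -- Among `N + 1` vertices of row `j`, spaced by the bottom period, two share a state. The
    -- spacing ensures that the labels following them agree.
    have hpig : ∃ n d, n + (d + 1) ≤ N ∧ l.st (oldPt (i₀ + n * (p + 1)) j) =
        l.st (oldPt (i₀ + n * (p + 1) + (d + 1) * (p + 1)) j) := by
      have := Fintype.ofFinite Q
      obtain ⟨a, b, hab, heq⟩ := Fintype.exists_ne_map_eq_of_card_lt
        (fun n : Fin (N + 1) => l.st (oldPt (i₀ + n.1 * (p + 1)) j))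
        (by rw [Fintype.card_fin, ← Nat.card_eq_fintype_card]; exact Nat.lt_succ_self _)
      wlog hlt : a < b generalizing a b
      · exact this b a hab.symm heq.symm (lt_of_le_of_ne (not_lt.1 hlt) hab.symm)
      obtain ⟨d, hd⟩ := Nat.exists_eq_add_of_lt hlt
      refine ⟨a, d, by omega, heq.trans ?_⟩
      rw [hd]
      congr 2
      ring
    obtain ⟨n, d, hnd, heq⟩ := hpig
    have hshift : ∀ k, l.st (oldPt (i₀ + n * (p + 1) + k) j) =
        l.st (oldPt (i₀ + n * (p + 1) + (d + 1) * (p + 1) + k) j) := by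
      intro k
      induction k with
      | zero => exact heq
      | succ k ih =>
        refine SameLabels.st_old l ?_ ih
        have h := hlab (d + 1) (i₀ + n * (p + 1) + k) (by omega)
        rwa [Nat.add_right_comm _ k] at h
    have hmul : ∀ m k, l.st (oldPt (i₀ + n * (p + 1) + k) j) =
        l.st (oldPt (i₀ + n * (p + 1) + k + m * ((d + 1) * (p + 1))) j) := by
      intro m k
      induction m with
      | zero => simp
      | succ m ih =>
        rw [ih]
        convert hshift (k + m * ((d + 1) * (p + 1))) using 3 <;> ring
    intro i hi
    -- The factor `d + 1` found for this row is at most `N`, so it divides `N!`. Hence `N! * (p +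
    -- 1)` is a period for every row, valid from `i₀ + N * (p + 1)` on since `n ≤ N`.
    obtain ⟨m, hm⟩ := Nat.dvd_factorial (Nat.succ_pos d) (show d + 1 ≤ N by omega)
    have hle : i₀ + n * (p + 1) ≤ i :=
      le_trans (Nat.add_le_add_left (Nat.mul_le_mul_right _ (by omega)) _) hi
    obtain ⟨k, rfl⟩ := Nat.exists_eq_add_of_le hle
    rw [hmul m k, hm, Nat.succ_eq_add_one]
    congr 2
    ring
  obtain ⟨j, hj⟩ := exists_row_not_periodic (i₀ + N * (p + 1)) (N.factorial * (p + 1))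
    (Nat.mul_pos N.factorial_pos (Nat.succ_pos p))
  have hst := (hlab N.factorial (i₀ + N * (p + 1)) (Nat.le_add_right _ _)).st_mid l
    (hrow j _ le_rfl)
  -- Midpoints with equal states have tips of equal length, so the two edges of row `j` have the
  -- same color, against the choice of `j`.
  have ht := l.hasTip_congr hst (hasTip_tipLen r
    (p := ((List.replicate (i₀ + N * (p + 1)) 0, some 0), (List.replicate j 2, none))) (hpos _))
  exact hj (hcol_injective (hinj (hasTip_inl r ht)))

end

end Wise

/-! ## The counterexample -/

namespace Wise

theorem finite_color : Finite wiseX.E :=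
  Finite.of_surjective (Sum.elim hcol vcol) fun e => by
    rcases exists_col e with ⟨h, rfl⟩ | ⟨t, rfl⟩
    · exact ⟨.inl h, rfl⟩
    · exact ⟨.inr t, rfl⟩

theorem finite_baryVertex : Finite wiseX.BaryVertex := by
  have := finite_color
  refine Finite.of_surjective (fun x : Unit ⊕ wiseX.E ⊕ Fin 6 =>
    (Sum.elim .old (Sum.elim .mid .center) x : wiseX.BaryVertex)) ?_
  rintro (v | e | s)
  · exact ⟨.inl v, rfl⟩
  · exact ⟨.inr (.inl e), rfl⟩
  · exact ⟨.inr (.inr s), rfl⟩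

theorem finite_baryEdge : Finite wiseX.BaryEdge := by
  have := finite_color
  refine Finite.of_surjective
    (fun x : (wiseX.E ⊕ wiseX.E) ⊕ (Fin 6 ⊕ Fin 6) ⊕ (Fin 6 ⊕ Fin 6) =>
      (Sum.elim (Sum.elim .fst .snd) (Sum.elim (Sum.elim .botToCenter .leftToCenter)
        (Sum.elim .centerToRight .centerToTop)) x : wiseX.BaryEdge)) ?_
  rintro (e | e | s | s | s | s)
  · exact ⟨.inl (.inl e), rfl⟩
  · exact ⟨.inl (.inr e), rfl⟩
  · exact ⟨.inr (.inl (.inl s)), rfl⟩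
  · exact ⟨.inr (.inl (.inr s)), rfl⟩
  · exact ⟨.inr (.inr (.inl s)), rfl⟩
  · exact ⟨.inr (.inr (.inr s)), rfl⟩

theorem finite_V (r : WiseColor → ℕ) : Finite (wiseW r).V := by
  have := finite_baryVertex
  have h : Finite (Σ x : wiseX.BaryVertex, Fin (wiseTipLength r x)) :=
    @Finite.instSigma _ _ _ fun x => Finite.of_fintype (Fin (wiseTipLength r x))
  exact @Finite.instSum wiseX.BaryVertex (Σ x : wiseX.BaryVertex, Fin (wiseTipLength r x)) _ h

theorem finite_E (r : WiseColor → ℕ) : Finite (wiseW r).E := by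
  have := finite_baryVertex
  have := finite_baryEdge
  have h : Finite (Σ x : wiseX.BaryVertex, Fin (wiseTipLength r x)) :=
    @Finite.instSigma _ _ _ fun x => Finite.of_fintype (Fin (wiseTipLength r x))
  exact @Finite.instSum wiseX.BaryEdge (Σ x : wiseX.BaryVertex, Fin (wiseTipLength r x)) _ h

end Wise

theorem proposition5p6 (r : WiseColor → ℕ) (hr : Set.BijOn r Set.univ (Set.Icc 1 5))
    (w : (wiseCover r).V) (hw : IsZeroVertex r w) :
    (∃ (E : Type) (S : EventStructure E), Nonempty ((wiseCover r).FilterLE w ≃r S.DomainLE)) ∧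
    ∀ (E : Type u) (S : EventStructure E),
      Nonempty ((wiseCover r).FilterLE w ≃r S.DomainLE) →
        S.NaturalCliquesLE 11 ∧ S.IsRegular ∧ S.BoundedNaturalCliques ∧
        ¬ S.IsRegularTrace ∧ ¬ S.IsRecognizable ∧
        ¬ S.BDREquivalence ∧ ¬ S.BDRTraceEquivalence := by
  have hpos : ∀ e, 0 < r e := fun e => (hr.mapsTo (Set.mem_univ e)).1
  have hinj : Function.Injective r := Set.injOn_univ.1 hr.injOn
  obtain ⟨f⟩ := Wise.nonempty_model_iso r w hw
  refine ⟨⟨_, Wise.modelES r, ⟨f.symm.trans (Wise.modelIso r)⟩⟩, ?_⟩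
  rintro E S ⟨φ⟩
  have hcliques : S.NaturalCliquesLE 11 := by
    obtain ⟨g, hg⟩ := S.exists_isIso_of_domain (Wise.modelES r)
      (φ.symm.trans (f.symm.trans (Wise.modelIso r)))
    exact hg.naturalCliquesLE (Wise.naturalCliquesLE_modelES r)
  have hreg : S.IsRegular := by
    have := Wise.finite_V r
    have := Wise.finite_E r
    exact EventStructure.isRegular_of_filter φ
  -- Finite labellings are transported along order isomorphisms, so both properties are refuted at
  -- once on the model.
  have hno : ¬ (S.IsRegularTrace ∨ S.IsRecognizable) := by
    intro h
    obtain ⟨Q, Λ, _, ⟨l⟩⟩ := S.exists_finiteLabelling h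
    exact Wise.false_of_finiteLabelling hpos hinj (l.map (f.trans φ))
  have hbdd : S.BoundedNaturalCliques := ⟨11, hcliques⟩
  exact ⟨hcliques, hreg, hbdd, fun h => hno (Or.inl h), fun h => hno (Or.inr h),
    fun h => hno (Or.inr (h.2 ⟨hreg, hbdd⟩)), fun h => hno (Or.inl (h.1 hreg).1)⟩
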